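/- **Setting.** Let $q=e^{-\kappa}\in(0,1)$ and $\gamma>0$, and write $[x]=(q^x-q^{-x})/(q-q^{-1})$. For $I\in\mathbb N/2$ let $V_I$ be the irreducible $U_q(\mathfrak{su}(2))$-module of spin $I$ with orthonormal basis $(e^I_m)_{-I\le m\le I}$, let $C^{IJ}_K:V_K\to V_I\otimes V_J$ and $C^K_{IJ}:V_I\otimes V_J\to V_K$ be the (real, orthonormal) Clebsch–Gordan intertwiners, with coefficients $\langle IJ;np\,|\,K m\rangle$ and sign fixed by $\langle IJ;I,K-I\,|\,KK\rangle>0$, and let $u^{\ m}_{I\ n}$ be the matrix elements, a basis of $F_q(\mathrm{SU}(2))$, with dual basis $X^{\ m}_{I\ n}$ of $\prod_I\mathrm{End}(V_I)$ (the matrix units). For $\alpha=(n,p)$, $n\in\mathbb Z/2$, $p\in\mathbb R$, the principal representation of the quantum Lorentz group $D(U_q(\mathfrak{su}(2)))=U_q(\mathfrak{su}(2))\hat\otimes F_q(\mathrm{SU}(2))^{op}$ is $V_\alpha=\bigoplus_{I\in|n|+\mathbb N}V_I$ with $$\pi_\alpha(u^{\ a}_{J\ b})\,e^L_c=\sum_{N,M,c',m}\langle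 NJ;c'a|Mm\rangle\langle JL;bc|Mm\rangle\,\Lambda^{JM}_{NL}(\alpha)\,e^N_{c'},$$ $$\Lambda^{JM}_{NL}(n,p)=\frac{\sqrt{[2N+1][2L+1]}}{[2M+1]}\sum_{s=-J}^{J}q^{ips}\langle NJ;n\,s|M\,n{+}s\rangle\langle JL;s\,n|M\,n{+}s\rangle$$ (with $\Lambda^{JM}_{NL}(\alpha)=0$ unless $V_N$ and $V_L$ occur in $V_\alpha$). The braiding is $c_{\alpha,\beta}=\tau\circ(\pi_\alpha\otimes\pi_\beta)(R):V_\alpha\otimes V_\beta\to V_\beta\otimes V_\alpha$ with $R=\sum_{I,m,n} X^{\ m}_{I\ n}\otimes u^{\ m}_{I\ n}$ and $\tau$ the flip. For principal labels $\alpha_1,\dots,\alpha_4$, spins $K_i$ with $V_{K_i}\subset V_{\alpha_i}$ and $J\in\mathbb N/2$ put $$\iota_{\alpha_1(K_1)\alpha_2(K_2)\alpha_3(K_3)\alpha_4(K_4),J}=\sum_A \lambda_{[K],J}\circ\Big(\bigotimes_i f^{K_i}_{\alpha_i}\Big)\circ\Big(\bigotimes_i\pi_{\alpha_i}\Big)(\Delta^{(3)}(x^A))\,h(x_A),$$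 a linear form on $V_{\alpha_1}\otimes V_{\alpha_2}\otimes V_{\alpha_3}\otimes V_{\alpha_4}$, where $f^K_\alpha:V_\alpha\to V_K$ is the projection, $\lambda_{[K],J}=d_J\circ\big((\epsilon_J\circ C^J_{K_1K_2})\otimes C^J_{K_3K_4}\big)$ with $\epsilon_J(e^J_m)(e^J_n)=(-1)^{J+m}q^{J(J+1)+m}\delta_{m,-n}$ and $d_J:V_J^*\otimes V_J\to\mathbb C$ the evaluation, $x^A=X^{\ m}_{I\ n}u^{\ a}_{L\ b}$ runs over the product basis of the quantum Lorentz group, and $h$ is the Haar measure on the dual Hopf algebra, $h(x_A)=\delta_{I,0}\,\delta_{ab}\,[2L+1]\,q^{-2a}$ on the dual basis. Here the representation $\alpha_i$ and the component $V_{K_i}$ are independent data. Let $\mathcal L=\{K\in\mathbb N/2: 0<K\le 4\pi/(\gamma\kappa)\}$. **Proposition.** (a) Let $K_1,K_2,K_3,K_4\in\mathcal L$, let $\alpha_i=(K_i,\gamma K_i)$ be the corresponding EPRL representations, and let $J\in\mathbb N/2$. Then the series defining $\iota_{\alpha_1(K_1)\alpha_2(K_2)\alpha_3(K_3)\alpha_4(K_4),J}$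 and $\iota_{\alpha_2(K_2)\alpha_1(K)\alpha_3(K_3)\alpha_4(K_4),J}$, for every $K\in K_1+\mathbb N$, converge absolutely on every vector, only finitely many of the numbers $\Lambda^{K_2J}_{K_1K}(\alpha_1)$ are non-zero, and $$\iota_{\alpha_1(K_1)\alpha_2(K_2)\alpha_3(K_3)\alpha_4(K_4),J}\circ (c_{\alpha_2,\alpha_1}\otimes\mathrm{id}\otimes\mathrm{id})=\sum_K\Lambda^{K_2J}_{K_1K}(\alpha_1)\;\iota_{\alpha_2(K_2)\,\alpha_1(K)\,\alpha_3(K_3)\alpha_4(K_4),J}.$$ (b) The $q$-EPRL intertwiner is not invariant under braiding: for all $q\in(0,1)$ and $\gamma>0$ with $\mathcal L\neq\emptyset$ there are $K_1,\dots,K_4\in\mathcal L$ and $J$ such that $\iota_{\alpha_1(K_1)\alpha_2(K_2)\alpha_3(K_3)\alpha_4(K_4),J}\circ (c_{\alpha_2,\alpha_1}\otimes\mathrm{id}\otimes\mathrm{id})\ne\iota_{\alpha_2(K_2)\alpha_1(K_1)\alpha_3(K_3)\alpha_4(K_4),J}$. (c) In contrast, the quantum Barrett–Crane intertwiner is invariant: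 for $\alpha_i=(0,p_i)$ with $p_i\in[0,2\pi/\kappa]$, the series for $\iota_{\alpha_1(0)\alpha_2(0)\alpha_3(0)\alpha_4(0),0}$ and $\iota_{\alpha_2(0)\alpha_1(0)\alpha_3(0)\alpha_4(0),0}$ converge absolutely and $\iota_{\alpha_1(0)\alpha_2(0)\alpha_3(0)\alpha_4(0),0}\circ (c_{\alpha_2,\alpha_1}\otimes\mathrm{id}\otimes\mathrm{id})=\iota_{\alpha_2(0)\alpha_1(0)\alpha_3(0)\alpha_4(0),0}$. -/

import Mathlib

open scoped TensorProduct

namespace QLorentz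

noncomputable section

/-! Conventions.  The deformation parameter is a real number `q = e^{-κ}` in `(0,1)`.
A spin `I ∈ ℕ/2` is encoded by the natural number `d = 2I`.  A vector `e^I_m` of the standard
basis of `V_I` is encoded by `i : Fin (d+1)` with `i = I + m`. -/

/-- The logarithmic deformation parameter `κ`, `q = e^{-κ}`. -/
def kappa (q : ℝ) : ℝ := -Real.log q

/-- The `q`-number `[x]_q = (q^x - q^{-x}) / (q - q^{-1})`. -/
def qnum (q x : ℝ) : ℝ := (q ^ x - q ^ (-x)) / (q - q⁻¹)

/-- The magnetic number `m = i - I` of the basis vector with index `i` in `V_I`, `d = 2I`. -/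
def wt (d : ℕ) (i : Fin (d + 1)) : ℝ := (i : ℝ) - (d : ℝ) / 2

/-! ### The Hopf algebra `U_q(su(2))`: irreducible representations, Clebsch-Gordan coefficients -/

/-- The operator `q^{s J_z}` on `V_I`. -/
def qJz (q s : ℝ) (d : ℕ) : Matrix (Fin (d + 1)) (Fin (d + 1)) ℝ :=
  Matrix.diagonal fun i => q ^ (s * wt d i)

/-- The operator `J_-` on `V_I`: `J_- e_m = ([I+m][I-m+1])^{1/2} e_{m-1}`. The operator `J_+` is
its transpose. -/
def Jminus (q : ℝ) (d : ℕ) : Matrix (Fin (d + 1)) (Fin (d + 1)) ℝ :=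
  Matrix.of fun j i =>
    if (j : ℕ) + 1 = (i : ℕ) then
      Real.sqrt (qnum q (i : ℝ) * qnum q ((d : ℝ) - (i : ℝ) + 1))
    else 0

/-- The action of `Δ(J_-) = q^{-J_z} ⊗ J_- + J_- ⊗ q^{J_z}` on `V_I ⊗ V_J`. -/
def comulJminus (q : ℝ) (a b : ℕ) :
    Matrix (Fin (a + 1) × Fin (b + 1)) (Fin (a + 1) × Fin (b + 1)) ℝ :=
  Matrix.kroneckerMap (· * ·) (qJz q (-1) a) (Jminus q b) +
    Matrix.kroneckerMap (· * ·) (Jminus q a) (qJz q 1 b)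

/-- The fusion rule: `I+J-K`, `J+K-I`, `K+I-J` are non-negative integers. -/
def Admissible (a b c : ℕ) : Prop := Even (a + b + c) ∧ c ≤ a + b ∧ a ≤ b + c ∧ b ≤ a + c

instance (a b c : ℕ) : Decidable (Admissible a b c) := by
  unfold Admissible; infer_instance

/-- The vector of weight `K` in `V_I ⊗ V_J` that is killed by
`Δ(J_+) = q^{-J_z} ⊗ J_+ + J_+ ⊗ q^{J_z}`, with coefficient `1` at `e^I_I ⊗ e^J_{K-I}`:
the equation `Δ(J_+) v = 0` says that the coefficient at `n = I - l - 1` is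
`- q^{-(K+1)} ([J+K-I+l+1] [I+J-K-l] / ([l+1] [2I-l]))^{1/2}` times that at `n = I - l`. -/
def hwVec (q : ℝ) (a b c : ℕ) : Fin (a + 1) × Fin (b + 1) → ℝ := fun x =>
  if 2 * ((x.1 : ℕ) + (x.2 : ℕ)) = a + b + c then
    ∏ l ∈ Finset.range (a - (x.1 : ℕ)),
      (-(q ^ (-((c : ℝ) / 2 + 1))) *
        Real.sqrt (qnum q (((b : ℝ) + c - a) / 2 + l + 1) * qnum q (((a : ℝ) + b - c) / 2 - l) /
          (qnum q ((l : ℝ) + 1) * qnum q ((a : ℝ) - l))))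
  else 0

/-- The image in `V_I ⊗ V_J` of `e^K_{K-t}`: the normalised highest weight vector, lowered `t`
times by `Δ(J_-)` and divided by the corresponding matrix elements of `J_-` on `V_K`. -/
def cgVec (q : ℝ) (a b c : ℕ) : ℕ → (Fin (a + 1) × Fin (b + 1) → ℝ)
  | 0 => (Real.sqrt (∑ x, hwVec q a b c x ^ 2))⁻¹ • hwVec q a b c
  | t + 1 =>
      (Real.sqrt (qnum q ((c : ℝ) - t) * qnum q ((t : ℝ) + 1)))⁻¹ •
        (comulJminus q a b).mulVec (cgVec q a b c t)

/-- The Clebsch-Gordan coefficient `(n p; I J | K m)` of `C^{IJ}_K : V_K → V_I ⊗ V_J`.  These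
coefficients form a real orthogonal matrix, hence it is also the coefficient `(m; K | I J; n p)` of
`C^K_{IJ} : V_I ⊗ V_J → V_K`, normalised by `C^K_{IJ} ∘ C^{IJ}_K = id`. -/
def cg (q : ℝ) (a b c : ℕ) (i : Fin (a + 1)) (j : Fin (b + 1)) (k : Fin (c + 1)) : ℝ :=
  if Admissible a b c then cgVec q a b c (c - (k : ℕ)) (i, j) else 0

/-- The representation space `V_I`. -/
abbrev VSpin (d : ℕ) : Type := Fin (d + 1) → ℂ

/-- The Clebsch-Gordan intertwiner `C^K_{IJ} : V_I ⊗ V_J → V_K`. -/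
def cgProj (q : ℝ) (a b c : ℕ) : VSpin a ⊗[ℂ] VSpin b →ₗ[ℂ] VSpin c :=
  TensorProduct.lift <|
    LinearMap.mk₂ ℂ (fun v w k => ∑ i, ∑ j, (cg q a b c i j k : ℂ) * (v i * w j))
      (fun v v' w => by
        ext k; simp only [Pi.add_apply, add_mul, mul_add, Finset.sum_add_distrib])
      (fun r v w => by
        ext k; simp only [Pi.smul_apply, smul_eq_mul, Finset.mul_sum]
        exact Finset.sum_congr rfl fun i _ => Finset.sum_congr rfl fun j _ => by ring)
      (fun v w w' => by
        ext k; simp only [Pi.add_apply, mul_add, Finset.sum_add_distrib])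
      (fun r v w => by
        ext k; simp only [Pi.smul_apply, smul_eq_mul, Finset.mul_sum]
        exact Finset.sum_congr rfl fun i _ => Finset.sum_congr rfl fun j _ => by ring)

/-- The intertwiner `ε_I : V_I → V_I^*`, `ε_I(e_m)(e_n) = e^{-iπ(I+m)} q^{I(I+1)} q^m δ_{m,-n}`;
the exponential is the sign `(-1)^{I+m}`. -/
def epsMap (q : ℝ) (d : ℕ) : VSpin d →ₗ[ℂ] Module.Dual ℂ (VSpin d) :=
  Matrix.toLinearMap₂' ℂ
    (Matrix.of fun i j : Fin (d + 1) =>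
      if (i : ℕ) + (j : ℕ) = d then
        (-1 : ℂ) ^ (i : ℕ) * ((q ^ ((d : ℝ) / 2 * ((d : ℝ) / 2 + 1)) * q ^ wt d i : ℝ) : ℂ)
      else 0)

/-- The `U_q(su(2))`-intertwiner `λ_{[K],J} = d_J ∘ (C_{K₁K₂J} ⊗ C^J_{K₃K₄})` with
`C_{K₁K₂J} = ε_J ∘ C^J_{K₁K₂}` and `d_J` the evaluation `V_J^* ⊗ V_J → ℂ`. -/
def lambdaMap (q : ℝ) (K₁ K₂ K₃ K₄ J : ℕ) :
    (VSpin K₁ ⊗[ℂ] VSpin K₂) ⊗[ℂ] (VSpin K₃ ⊗[ℂ] VSpin K₄) →ₗ[ℂ] ℂ :=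
  contractLeft ℂ (VSpin J) ∘ₗ
    TensorProduct.map (epsMap q J ∘ₗ cgProj q K₁ K₂ J) (cgProj q K₃ K₄ J)

/-! ### The algebra `U_q(su(2))` completed to `∏_I End(V_I)` -/

/-- The completion `∏_I End(V_I)` of `U_q(su(2))`. -/
abbrev UqHat : Type := ∀ d : ℕ, Matrix (Fin (d + 1)) (Fin (d + 1)) ℂ

/-- Labels `(I, m, n)` of the matrix elements `u_I^m_n`, which are a basis of `F_q(SU(2))`. -/
abbrev MatIdx : Type := Σ d : ℕ, Fin (d + 1) × Fin (d + 1)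

/-- The element `X_I^m_n` of `∏_I End(V_I)` dual to `u_I^m_n`: the matrix unit `e^I_n ↦ e^I_m`. -/
def matUnit (B : MatIdx) : UqHat := Pi.single B.1 (Matrix.single B.2.1 B.2.2 1)

/-- The component of the coproduct `Δ(x)` in `End(V_A ⊗ V_B)`:
`∑_K C^{AB}_K ∘ x_K ∘ C^K_{AB}` (dual to the product of matrix elements in `F_q(SU(2))`). -/
def comul₂ (q : ℝ) (x : UqHat) (A B : ℕ) :
    Matrix (Fin (A + 1) × Fin (B + 1)) (Fin (A + 1) × Fin (B + 1)) ℂ :=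
  Matrix.of fun r s =>
    ∑ K ∈ Finset.range (A + B + 1), ∑ m : Fin (K + 1), ∑ n : Fin (K + 1),
      (cg q A B K r.1 r.2 m : ℂ) * x K m n * (cg q A B K s.1 s.2 n : ℂ)

/-- The component of the iterated coproduct `Δ^{(3)}(x) = (Δ ⊗ Δ)(Δ(x))` in
`End((V_A ⊗ V_B) ⊗ (V_C ⊗ V_D))`. -/
def comul₄ (q : ℝ) (x : UqHat) (A B C D : ℕ) :
    Matrix ((Fin (A + 1) × Fin (B + 1)) × (Fin (C + 1) × Fin (D + 1)))
      ((Fin (A + 1) × Fin (B + 1)) × (Fin (C + 1) × Fin (D + 1))) ℂ :=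
  Matrix.of fun r s =>
    ∑ S ∈ Finset.range (A + B + 1), ∑ T ∈ Finset.range (C + D + 1),
      ∑ m : Fin (S + 1) × Fin (T + 1), ∑ n : Fin (S + 1) × Fin (T + 1),
        ((cg q A B S r.1.1 r.1.2 m.1 * cg q C D T r.2.1 r.2.2 m.2 : ℝ) : ℂ) *
          comul₂ q x S T m n *
          ((cg q A B S s.1.1 s.1.2 n.1 * cg q C D T s.2.1 s.2.2 n.2 : ℝ) : ℂ)

/-! ### Principal representations of the quantum Lorentz group -/

/-- Label `α = (n, p)` of a principal representation; `twoN = 2n` with `n ∈ ℤ/2`. -/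
structure Label where
  twoN : ℤ
  p : ℝ

/-- `V_I` occurs in `V_α`, i.e. `I ∈ {|n|, |n|+1, |n|+2, …}` (with `d = 2I`). -/
def HasSpin (α : Label) (d : ℕ) : Prop := ∃ k : ℕ, d = α.twoN.natAbs + 2 * k

/-- Index set of the basis `e^I_m` of `V_α = ⊕_{I ≥ |n|} V_I`. -/
abbrev Idx (α : Label) : Type := Σ I : {d : ℕ // HasSpin α d}, Fin (I.1 + 1)

/-- The Harish-Chandra module `V_α`. -/
abbrev VRep (α : Label) : Type := Idx α →₀ ℂ

/-- The basis vector `e^I_m` of `V_α`. -/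
def basisVec (α : Label) (x : Idx α) : VRep α := Finsupp.single x 1

/-- The coefficient `Λ^{JM}_{NL}(α)` of the principal representation `α = (n,p)`:
`([2N+1][2L+1])^{1/2} / [2M+1] · ∑_s q^{ips} (n s; N J | M n+s) (n+s; M | J L; s n)`.
It describes the principal representation as induced from the character
`u_J^s_{s'} ↦ δ_{ss'} q^{ips}`, with `e^L_m` proportional to the matrix element `u_L^m_n`, in the
basis for which the representation is unitary; the label `p` has period `4π/κ`. -/
def Lam (q : ℝ) (α : Label) (J M N L : ℕ) : ℂ :=
  ((Real.sqrt (qnum q ((N : ℝ) + 1) * qnum q ((L : ℝ) + 1)) / qnum q ((M : ℝ) + 1) : ℝ) : ℂ) *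
    ∑ s : Fin (J + 1), (q : ℂ) ^ (Complex.I * (α.p : ℂ) * (wt J s : ℂ)) *
      ∑ i : Fin (N + 1), ∑ l : Fin (L + 1), ∑ k : Fin (M + 1),
        if 2 * ((i : ℕ) : ℤ) - (N : ℤ) = α.twoN ∧ 2 * ((l : ℕ) : ℤ) - (L : ℤ) = α.twoN then
          ((cg q N J M i s k * cg q J L M s l k : ℝ) : ℂ)
        else 0

open Classical in
/-- The action of `u_J^a_b ∈ F_q(SU(2))` on `V_α`:
`π_α(u_J^a_b) e^L_c = ∑_{N,M} e^N_{c'} (c' a; N J | M m) (m; M | J L; b c) Λ^{JM}_{NL}(α)`. -/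
def piU (q : ℝ) (α : Label) (B : MatIdx) : VRep α →ₗ[ℂ] VRep α :=
  Finsupp.linearCombination ℂ fun x : Idx α =>
    ∑ N ∈ Finset.range (2 * B.1 + x.1.1 + 1),
      if h : HasSpin α N then
        ∑ c' : Fin (N + 1),
          (∑ M ∈ Finset.range (B.1 + x.1.1 + 1), ∑ m : Fin (M + 1),
            ((cg q N B.1 M c' B.2.1 m * cg q B.1 x.1.1 M B.2.2 x.2 m : ℝ) : ℂ) *
              Lam q α B.1 M N x.1.1) • basisVec α ⟨⟨N, h⟩, c'⟩
      else 0

/-- The action of `x ∈ ∏_I End(V_I)` on `V_α = ⊕ V_I`. -/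
def piX (α : Label) (x : UqHat) : VRep α →ₗ[ℂ] VRep α :=
  Finsupp.linearCombination ℂ fun y : Idx α =>
    ∑ c' : Fin (y.1.1 + 1), x y.1.1 c' y.2 • basisVec α ⟨y.1, c'⟩

/-- `V[α] = V_{α₁} ⊗ V_{α₂} ⊗ V_{α₃} ⊗ V_{α₄}`. -/
abbrev VFour (α₁ α₂ α₃ α₄ : Label) : Type :=
  (VRep α₁ ⊗[ℂ] VRep α₂) ⊗[ℂ] (VRep α₃ ⊗[ℂ] VRep α₄)

/-- The action of `Δ^{(3)}(u_J^a_b)` on `V[α]`, for the opposite coproduct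
`Δ(u^a_b) = ∑_p u^p_b ⊗ u^a_p` of `F_q(SU(2))^{op}`. -/
def piU₄ (q : ℝ) (α₁ α₂ α₃ α₄ : Label) (B : MatIdx) :
    VFour α₁ α₂ α₃ α₄ →ₗ[ℂ] VFour α₁ α₂ α₃ α₄ :=
  ∑ b₁ : Fin (B.1 + 1), ∑ b₂ : Fin (B.1 + 1), ∑ b₃ : Fin (B.1 + 1),
    TensorProduct.map
      (TensorProduct.map (piU q α₁ ⟨B.1, b₁, B.2.2⟩) (piU q α₂ ⟨B.1, b₂, b₁⟩))
      (TensorProduct.map (piU q α₃ ⟨B.1, b₃, b₂⟩) (piU q α₄ ⟨B.1, B.2.1, b₃⟩))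

/-- Coordinates on `V[α]` in the basis `e^{L₁}_{c₁} ⊗ e^{L₂}_{c₂} ⊗ e^{L₃}_{c₃} ⊗ e^{L₄}_{c₄}`. -/
def coords₄ (α₁ α₂ α₃ α₄ : Label) :
    VFour α₁ α₂ α₃ α₄ ≃ₗ[ℂ] ((Idx α₁ × Idx α₂) × (Idx α₃ × Idx α₄)) →₀ ℂ :=
  (TensorProduct.congr (finsuppTensorFinsupp' ℂ (Idx α₁) (Idx α₂))
    (finsuppTensorFinsupp' ℂ (Idx α₃) (Idx α₄))) ≪≫ₗ
    finsuppTensorFinsupp' ℂ (Idx α₁ × Idx α₂) (Idx α₃ × Idx α₄)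

/-- The action of `Δ^{(3)}(x)`, `x ∈ ∏_I End(V_I)`, on `V[α]`. -/
def piX₄ (q : ℝ) (α₁ α₂ α₃ α₄ : Label) (x : UqHat) :
    VFour α₁ α₂ α₃ α₄ →ₗ[ℂ] VFour α₁ α₂ α₃ α₄ :=
  (Finsupp.linearCombination ℂ fun y : (Idx α₁ × Idx α₂) × (Idx α₃ × Idx α₄) =>
    ∑ c₁ : Fin (y.1.1.1.1 + 1), ∑ c₂ : Fin (y.1.2.1.1 + 1),
      ∑ c₃ : Fin (y.2.1.1.1 + 1), ∑ c₄ : Fin (y.2.2.1.1 + 1),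
        comul₄ q x y.1.1.1.1 y.1.2.1.1 y.2.1.1.1 y.2.2.1.1 ((c₁, c₂), (c₃, c₄))
            ((y.1.1.2, y.1.2.2), (y.2.1.2, y.2.2.2)) •
          ((basisVec α₁ ⟨y.1.1.1, c₁⟩ ⊗ₜ[ℂ] basisVec α₂ ⟨y.1.2.1, c₂⟩) ⊗ₜ[ℂ]
            (basisVec α₃ ⟨y.2.1.1, c₃⟩ ⊗ₜ[ℂ] basisVec α₄ ⟨y.2.2.1, c₄⟩))) ∘ₗ
    (coords₄ α₁ α₂ α₃ α₄).toLinearMap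

/-- The basis `x^A = X_I^m_n u_J^a_b` of the quantum Lorentz group is labelled by pairs
`A = ((I,m,n), (J,a,b))`; the same labels are used for the dual basis `x_A` of
`F_q(SL(2,ℂ)_ℝ) = F_q(SU(2)) ⊗ F_q(AN(2))`. This is the action of `Δ^{(3)}(x^A)` on `V[α]`. -/
def piD₄ (q : ℝ) (α₁ α₂ α₃ α₄ : Label) (A : MatIdx × MatIdx) :
    VFour α₁ α₂ α₃ α₄ →ₗ[ℂ] VFour α₁ α₂ α₃ α₄ :=
  piX₄ q α₁ α₂ α₃ α₄ (matUnit A.1) ∘ₗ piU₄ q α₁ α₂ α₃ α₄ A.2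

/-- The value `h(x_A)` of the Haar measure of `F_q(SL(2,ℂ)_ℝ)`: the Haar state of `F_q(SU(2))`
(which is `δ_{I,0}` on `u_I^m_n`) times the Haar weight `δ_{ab} [2J+1] q^{-2a}` of `F_q(AN(2))`. -/
def haar (q : ℝ) (A : MatIdx × MatIdx) : ℝ :=
  if A.1.1 = 0 ∧ A.2.2.1 = A.2.2.2 then
    qnum q ((A.2.1 : ℝ) + 1) * q ^ (-2 * wt A.2.1 A.2.2.1)
  else 0

open Classical in
/-- The projection `f^K_α : V_α → V_K` (zero if `V_K` does not occur in `V_α`). -/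
def proj (α : Label) (K : ℕ) : VRep α →ₗ[ℂ] VSpin K :=
  if h : HasSpin α K then LinearMap.pi fun i => Finsupp.lapply ⟨⟨K, h⟩, i⟩ else 0

/-- `f^{K₁}_{α₁} ⊗ f^{K₂}_{α₂} ⊗ f^{K₃}_{α₃} ⊗ f^{K₄}_{α₄}`. -/
def proj₄ (α₁ α₂ α₃ α₄ : Label) (K₁ K₂ K₃ K₄ : ℕ) :
    VFour α₁ α₂ α₃ α₄ →ₗ[ℂ] (VSpin K₁ ⊗[ℂ] VSpin K₂) ⊗[ℂ] (VSpin K₃ ⊗[ℂ] VSpin K₄) :=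
  TensorProduct.map (TensorProduct.map (proj α₁ K₁) (proj α₂ K₂))
    (TensorProduct.map (proj α₃ K₃) (proj α₄ K₄))

/-- The summand with label `A` of the intertwiner
`∑_A λ_{[K],J} ∘ (⊗ f^{K_i}_{α_i}) ∘ (⊗ π_{α_i})(Δ^{(3)}(x^A)) h(x_A)`, evaluated on `v`. -/
def iotaTerm (q : ℝ) (α₁ α₂ α₃ α₄ : Label) (K₁ K₂ K₃ K₄ J : ℕ) (v : VFour α₁ α₂ α₃ α₄)
    (A : MatIdx × MatIdx) : ℂ :=
  lambdaMap q K₁ K₂ K₃ K₄ J (proj₄ α₁ α₂ α₃ α₄ K₁ K₂ K₃ K₄ (piD₄ q α₁ α₂ α₃ α₄ A v)) *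
    (haar q A : ℂ)

/-- The intertwiner `ι_{α₁(K₁)α₂(K₂)α₃(K₃)α₄(K₄),J}`: the representations `α_i` and the spins `K_i`
of the components `V_{K_i} ⊂ V_{α_i}` on which `λ_{[K],J}` is evaluated are separate arguments. -/
def iota (q : ℝ) (α₁ α₂ α₃ α₄ : Label) (K₁ K₂ K₃ K₄ J : ℕ) (v : VFour α₁ α₂ α₃ α₄) : ℂ :=
  ∑' A : MatIdx × MatIdx, iotaTerm q α₁ α₂ α₃ α₄ K₁ K₂ K₃ K₄ J v A

/-- The series defining `ι_{α₁(K₁)α₂(K₂)α₃(K₃)α₄(K₄),J}` converges absolutely on all of `V[α]`. -/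
def IotaConverges (q : ℝ) (α₁ α₂ α₃ α₄ : Label) (K₁ K₂ K₃ K₄ J : ℕ) : Prop :=
  ∀ v : VFour α₁ α₂ α₃ α₄, Summable fun A => ‖iotaTerm q α₁ α₂ α₃ α₄ K₁ K₂ K₃ K₄ J v A‖

/-! ### Braiding -/

/-- The action of the `R`-matrix `R = ∑_{I,m,n} X_I^m_n ⊗ u_I^m_n` of the quantum double on
`V_α ⊗ V_β`; on `e^I_c ⊗ w` only the summands of spin `I` contribute. -/
def rAct (q : ℝ) (α β : Label) : VRep α ⊗[ℂ] VRep β →ₗ[ℂ] VRep α ⊗[ℂ] VRep β :=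
  TensorProduct.lift <|
    Finsupp.linearCombination ℂ fun x : Idx α =>
      ∑ m : Fin (x.1.1 + 1), ∑ n : Fin (x.1.1 + 1),
        (TensorProduct.mk ℂ (VRep α) (VRep β)
          (piX α (matUnit ⟨x.1.1, m, n⟩) (basisVec α x))) ∘ₗ piU q β ⟨x.1.1, m, n⟩

/-- The braiding `c_{α,β} = τ ∘ (π_α ⊗ π_β)(R) : V_α ⊗ V_β → V_β ⊗ V_α`. -/
def braid (q : ℝ) (α β : Label) : VRep α ⊗[ℂ] VRep β →ₗ[ℂ] VRep β ⊗[ℂ] VRep α :=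
  (TensorProduct.comm ℂ (VRep α) (VRep β)).toLinearMap ∘ₗ rAct q α β

/-- The braiding acting on the first two factors of a four-fold tensor product. -/
def braid₁₂ (q : ℝ) (α β α₃ α₄ : Label) : VFour α β α₃ α₄ →ₗ[ℂ] VFour β α α₃ α₄ :=
  TensorProduct.map (braid q α β) LinearMap.id

/-! ### EPRL and Barrett-Crane representations -/

/-- The label set `ℒ = {K ∈ ℕ/2 : 0 < K ≤ 4π/(γκ)}`, in terms of `2K`. -/
def eprlSpins (q γ : ℝ) : Set ℕ :=
  {K | 0 < K ∧ (K : ℝ) / 2 ≤ 4 * Real.pi / (γ * kappa q)}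

/-- The EPRL representation `α(K) = (K, γK)`. -/
def eprl (γ : ℝ) (K : ℕ) : Label := ⟨(K : ℤ), γ * ((K : ℝ) / 2)⟩

/-- The simple representation `(0, p)` of the Barrett-Crane model. -/
def simpleRep (p : ℝ) : Label := ⟨0, p⟩

end

end QLorentz

open QLorentz

namespace QLorentz

noncomputable section

open Matrix
open scoped Kronecker

set_option linter.unusedSectionVars false

/-! ### `q`-numbers -/

section qnum

variable {q : ℝ}

/-! Part (a) holds summand by summand. The Haar weight is supported on `X_0`, the projector onto the
`U_q(su(2))`-invariants, and `λ_{[K],J}` is already invariant; hence only the part of the series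
over the basis `u_L^a_b` of `F_q(SU(2))` remains (`iotaTerm_eq`). The braiding commutes with each
`Δ^{(3)}(u_L^a_b)`, because `RΔ = Δ^{op}R` (`braid₁₂_comp_piU₄`), so it can be moved onto `λ`. There
it acts through `π_{α₁}(u)`, and contracting the Clebsch-Gordan expansion of that operator with
`C^J_{K₁K₂}` leaves one coefficient `Λ` for each `K` (`lamProj_comp_braid₁₂`). The triangle
inequalities bound `K`.

The relation `RΔ = Δ^{op}R` rests on `π_α` being multiplicative (`piU_comp`), which the formula for
`Λ` does not show. It becomes visible when `V_α` is realised inside `F_q(SU(2))` as the span of the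
`u_L^c_n` with `n` fixed by the label: there `u_J^a_b` acts by `f ↦ ∑_s q^{ips} u_J^b_s f
(u_J^a_s)^*`, and multiplicativity follows from associativity of `F_q(SU(2))` and orthogonality of
the Clebsch-Gordan coefficients. Both follow from Schur's lemma, once the explicit coefficients are
known to be intertwiners. The modules are real with orthonormal weight bases, so adjoints are
transposes throughout.

Convergence: with `d` twice the spin, the factor `1/[M+1]` and the inequality `M ≥ d - L` make every
matrix element of `π_α(u_d)` of order `q^d` up to a polynomial, uniformly in `p`. Four of them
outweigh the Haar weight, which is at most of order `q^{-2d}` (`iotaConverges`).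

For (b), take spins `(D+1)/2, 1/2, (D+1)/2, 1/2` and `J = D/2`. Then a single `K` survives in (a),
and it remains to see that `ι ≠ 0` and `Λ ≠ 1`. With labels `α, β, β, α`, the last two factors
contribute the complex conjugate of the first two, so on the vector dual to `λ` all summands are
non-negative and that of the unit is positive (`iota_lamVec_ne_zero`). The coefficient is a
non-positive number times the phase `q^{-ip/2}`, hence equals `1` only if the phase is `-1`
(`Lam_top_ne_one`). The choice `D = 0` avoids this unless `γκ = 4π`, and then `D = 1` does.

For (c), all spins are zero, so only `K = 0` survives, with `Λ = 1`. -/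

theorem sub_inv_neg_of_lt_one (hq₀ : 0 < q) (hq₁ : q < 1) : q - q⁻¹ < 0 := by
  have := (one_lt_inv₀ hq₀).2 hq₁
  linarith

@[simp] theorem qnum_zero : qnum q 0 = 0 := by simp [qnum]

theorem qnum_pos (hq₀ : 0 < q) (hq₁ : q < 1) {x : ℝ} (hx : 0 < x) : 0 < qnum q x := by
  refine div_pos_of_neg_of_neg ?_ (sub_inv_neg_of_lt_one hq₀ hq₁)
  have := Real.rpow_lt_rpow_of_exponent_gt hq₀ hq₁ (show -x < x by linarith)
  linarith

theorem qnum_nonneg (hq₀ : 0 < q) (hq₁ : q < 1) {x : ℝ} (hx : 0 ≤ x) : 0 ≤ qnum q x := by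
  rcases hx.eq_or_lt with rfl | h
  · simp
  · exact (qnum_pos hq₀ hq₁ h).le

theorem qnum_one (hq₀ : 0 < q) (hq₁ : q < 1) : qnum q 1 = 1 := by
  have := sub_inv_neg_of_lt_one hq₀ hq₁
  rw [qnum, Real.rpow_neg_one, Real.rpow_one, div_self this.ne]

/-- This is `[J_+, J_-] = [2J_z]` at the level of matrix elements; it also drives the induction
along a string of lowered highest weight vectors. -/
theorem qnum_mul_sub (hq₀ : 0 < q) (hq₁ : q < 1) (x y : ℝ) :
    qnum q x * qnum q (y + 1) - qnum q (x + 1) * qnum q y = qnum q (x - y) := by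
  have h := (sub_inv_neg_of_lt_one hq₀ hq₁).ne
  have e1 : (q : ℝ) ^ (y + 1) = q ^ y * q := Real.rpow_add_one hq₀.ne' y
  have e2 : (q : ℝ) ^ (x + 1) = q ^ x * q := Real.rpow_add_one hq₀.ne' x
  have e3 : (q : ℝ) ^ (-(y + 1)) = q ^ (-y) * q⁻¹ := by
    rw [neg_add, Real.rpow_add hq₀, Real.rpow_neg_one]
  have e4 : (q : ℝ) ^ (-(x + 1)) = q ^ (-x) * q⁻¹ := by
    rw [neg_add, Real.rpow_add hq₀, Real.rpow_neg_one]
  have e5 : (q : ℝ) ^ (x - y) = q ^ x * q ^ (-y) := by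
    rw [sub_eq_add_neg, Real.rpow_add hq₀]
  have e6 : (q : ℝ) ^ (-(x - y)) = q ^ (-x) * q ^ y := by
    rw [show -(x - y) = -x + y by ring, Real.rpow_add hq₀]
  simp only [qnum]
  rw [e1, e2, e3, e4, e5, e6, div_mul_div_comm, div_mul_div_comm, ← sub_div,
    div_eq_div_iff (mul_ne_zero h h) h]
  ring

theorem qnum_add (hq₀ : 0 < q) (x y : ℝ) :
    q ^ (-x) * qnum q y + qnum q x * q ^ y = qnum q (x + y) := by
  have e5 : (q : ℝ) ^ (x + y) = q ^ x * q ^ y := Real.rpow_add hq₀ _ _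
  have e6 : (q : ℝ) ^ (-(x + y)) = q ^ (-x) * q ^ (-y) := by
    rw [neg_add, Real.rpow_add hq₀]
  simp only [qnum]
  rw [e5, e6]; ring

/-- Lower bound behind the exponential decay of `Λ`, whose denominator is a `q`-dimension. -/
theorem rpow_le_qnum (hq₀ : 0 < q) (hq₁ : q < 1) {x : ℝ} (hx : 0 ≤ x) :
    q ^ (-x) ≤ qnum q (x + 1) := by
  have h := sub_inv_neg_of_lt_one hq₀ hq₁
  rw [qnum, le_div_iff_of_neg h, Real.rpow_add_one hq₀.ne', neg_add, Real.rpow_add hq₀ (-x),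
    Real.rpow_neg_one, mul_sub]
  have : q ^ x ≤ q ^ (-x) := Real.rpow_le_rpow_of_exponent_ge hq₀ hq₁.le (by linarith)
  nlinarith

/-- The `q`-dimension of `V_I`. -/
theorem sum_rpow_wt (hq₀ : 0 < q) (hq₁ : q < 1) (d : ℕ) :
    ∑ i : Fin (d + 1), q ^ (-(2 * wt d i)) = qnum q ((d : ℝ) + 1) := by
  have h := (sub_inv_neg_of_lt_one hq₀ hq₁).ne
  simp only [wt]
  rw [qnum, eq_div_iff h, Fin.sum_univ_eq_sum_range (fun i : ℕ => q ^ (-(2 * ((i : ℝ) - d / 2)))),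
    Finset.sum_mul]
  -- Multiplying by `q - q⁻¹` makes the sum telescope.
  have : ∀ i : ℕ, q ^ (-(2 * ((i : ℝ) - (d : ℝ) / 2))) * (q - q⁻¹) =
      (fun i : ℕ => -q ^ ((d : ℝ) + 1 - 2 * i)) (i + 1) - (fun i : ℕ => -q ^ ((d : ℝ) + 1 - 2 * i)) i := by
    intro i
    have e1 : (q : ℝ) ^ ((d : ℝ) + 1 - 2 * i) = q ^ (-(2 * ((i : ℝ) - (d : ℝ) / 2))) * q := by
      rw [← Real.rpow_add_one hq₀.ne']; congr 1; ring
    have e2 : (q : ℝ) ^ ((d : ℝ) + 1 - 2 * (i + 1 : ℕ)) =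
        q ^ (-(2 * ((i : ℝ) - (d : ℝ) / 2))) * q⁻¹ := by
      rw [← Real.rpow_neg_one, ← Real.rpow_add hq₀]; congr 1; push_cast; ring
    simp only [e1, e2]; ring
  rw [Finset.sum_congr rfl fun i _ => this i, 
    Finset.sum_range_sub (fun i : ℕ => -q ^ ((d : ℝ) + 1 - 2 * i))]
  push_cast
  rw [show (d : ℝ) + 1 - 2 * (d + 1) = -(d + 1) by ring]
  simp; ring

end qnum

/-! ### Modules over `U_q(su(2))` with a real orthonormal weight basis -/

/-- A module with a real orthonormal basis of weight vectors: `wt` is twice the weight, `low` the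
matrix of `J_-`, whose transpose is the matrix of `J_+`. -/
structure QModule (ι : Type) where
  wt : ι → ℤ
  low : Matrix ι ι ℝ

variable {ι κ μ ν : Type} [Fintype ι] [Fintype κ] [Fintype μ] [Fintype ν]
  [DecidableEq ι] [DecidableEq κ] [DecidableEq μ] [DecidableEq ν]

/-- The tensor product of modules, for `Δ(J_-) = q^{-J_z} ⊗ J_- + J_- ⊗ q^{J_z}`. -/
def QModule.tensor (q : ℝ) (V : QModule ι) (W : QModule κ) : QModule (ι × κ) where
  wt x := V.wt x.1 + W.wt x.2
  low := Matrix.kroneckerMap (· * ·) (Matrix.diagonal fun i => q ^ (-((V.wt i : ℝ) / 2))) W.low +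
    Matrix.kroneckerMap (· * ·) V.low (Matrix.diagonal fun j => q ^ ((W.wt j : ℝ) / 2))

/-- The irreducible module `V_I`. -/
def spin (q : ℝ) (d : ℕ) : QModule (Fin (d + 1)) where
  wt i := 2 * ((i : ℕ) : ℤ) - d
  low := Jminus q d

/-- The defining relations of `U_q(su(2))`. -/
structure IsQModule (q : ℝ) (V : QModule ι) : Prop where
  low_wt : ∀ j i, V.low j i ≠ 0 → V.wt j = V.wt i - 2
  comm : V.lowᵀ * V.low - V.low * V.lowᵀ = Matrix.diagonal fun i => qnum q (V.wt i)

/-- Morphisms of modules. -/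
structure IsHom (V : QModule ι) (W : QModule κ) (T : Matrix κ ι ℝ) : Prop where
  wt : ∀ j i, T j i ≠ 0 → W.wt j = V.wt i
  low : T * V.low = W.low * T
  up : T * V.lowᵀ = W.lowᵀ * T

theorem wt_eq_spin_wt (q : ℝ) (d : ℕ) (i : Fin (d + 1)) : wt d i = ((spin q d).wt i : ℝ) / 2 := by
  simp only [wt, spin]; push_cast; ring

theorem tensor_spin_low (q : ℝ) (a b : ℕ) :
    ((spin q a).tensor q (spin q b)).low = comulJminus q a b := by
  simp only [QModule.tensor, comulJminus, qJz, wt_eq_spin_wt q, neg_one_mul, one_mul]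
  rfl

theorem Jminus_apply_succ (q : ℝ) (d : ℕ) (j i : Fin (d + 1)) (h : (j : ℕ) + 1 = i) :
    Jminus q d j i = Real.sqrt (qnum q (i : ℝ) * qnum q ((d : ℝ) - (i : ℝ) + 1)) := by
  simp [Jminus, h]

theorem Jminus_apply_of_ne (q : ℝ) (d : ℕ) (j i : Fin (d + 1)) (h : (j : ℕ) + 1 ≠ i) :
    Jminus q d j i = 0 := by
  simp [Jminus, h]

theorem Jminus_ne_zero {q : ℝ} (hq₀ : 0 < q) (hq₁ : q < 1) (d : ℕ) (j i : Fin (d + 1))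
    (h : (j : ℕ) + 1 = i) : Jminus q d j i ≠ 0 := by
  rw [Jminus_apply_succ q d j i h]
  refine (Real.sqrt_pos.2 (mul_pos (qnum_pos hq₀ hq₁ ?_) (qnum_pos hq₀ hq₁ ?_))).ne'
  · rw [← h]; positivity
  · have : ((i : ℕ) : ℝ) ≤ d := by exact_mod_cast Nat.lt_succ_iff.1 i.2
    linarith

theorem sum_mul_Jminus (q : ℝ) (d : ℕ) (f : Fin (d + 1) → ℝ) (k : Fin (d + 1)) :
    ∑ j, f j * Jminus q d j k = if h : 0 < (k : ℕ) then
      f ⟨k - 1, by omega⟩ * Real.sqrt (qnum q (k : ℝ) * qnum q ((d : ℝ) - (k : ℝ) + 1)) else 0 := by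
  split_ifs with h
  · rw [Finset.sum_eq_single ⟨k - 1, by omega⟩, Jminus_apply_succ]
    · simp only []; omega
    · intro j _ hj
      rw [Jminus_apply_of_ne, mul_zero]
      intro h'; apply hj; ext; simp only []; omega
    · simp
  · refine Finset.sum_eq_zero fun j _ => ?_
    rw [Jminus_apply_of_ne, mul_zero]; omega

theorem sum_Jminus_mul (q : ℝ) (d : ℕ) (f : Fin (d + 1) → ℝ) (k : Fin (d + 1)) :
    ∑ j, f j * Jminus q d k j = if h : (k : ℕ) < d then
      f ⟨k + 1, by omega⟩ * Real.sqrt (qnum q ((k : ℝ) + 1) * qnum q ((d : ℝ) - (k : ℝ))) else 0 := by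
  split_ifs with h
  · rw [Finset.sum_eq_single ⟨k + 1, by omega⟩, Jminus_apply_succ]
    · push_cast; ring_nf
    · simp
    · intro j _ hj
      rw [Jminus_apply_of_ne, mul_zero]
      intro h'; apply hj; ext; simp only []; omega
    · simp
  · refine Finset.sum_eq_zero fun j _ => ?_
    rw [Jminus_apply_of_ne, mul_zero]; omega

theorem isQModule_spin {q : ℝ} (hq₀ : 0 < q) (hq₁ : q < 1) (d : ℕ) : IsQModule q (spin q d) where
  low_wt j i h := by
    by_cases h' : (j : ℕ) + 1 = i
    · simp only [spin]; omega
    · exact absurd (Jminus_apply_of_ne q d j i h') h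
  comm := by
    ext i k
    simp only [spin, Matrix.sub_apply, Matrix.mul_apply, Matrix.transpose_apply,
      Matrix.diagonal_apply]
    have hi : ((i : ℕ) : ℝ) ≤ d := by exact_mod_cast Nat.lt_succ_iff.1 i.2
    rw [sum_mul_Jminus q d (fun j => Jminus q d j i), sum_Jminus_mul q d (fun j => Jminus q d i j)]
    have key := qnum_mul_sub hq₀ hq₁ (i : ℝ) ((d : ℝ) - i)
    by_cases hik : i = k
    · subst hik
      have n1 : 0 ≤ qnum q (i : ℝ) * qnum q ((d : ℝ) - i + 1) :=
        mul_nonneg (qnum_nonneg hq₀ hq₁ (by positivity)) (qnum_nonneg hq₀ hq₁ (by linarith))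
      have n2 : 0 ≤ qnum q ((i : ℝ) + 1) * qnum q ((d : ℝ) - i) :=
        mul_nonneg (qnum_nonneg hq₀ hq₁ (by positivity)) (qnum_nonneg hq₀ hq₁ (by linarith))
      have t1 : (if h : 0 < (i : ℕ) then Jminus q d ⟨i - 1, by omega⟩ i *
          Real.sqrt (qnum q (i : ℝ) * qnum q ((d : ℝ) - (i : ℝ) + 1)) else 0) =
          qnum q (i : ℝ) * qnum q ((d : ℝ) - i + 1) := by
        split_ifs with h
        · rw [Jminus_apply_succ q d _ _ (by simp only []; omega), Real.mul_self_sqrt n1]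
        · have : (i : ℕ) = 0 := by omega
          simp [this]
      have t2 : (if h : (i : ℕ) < d then Jminus q d i ⟨i + 1, by omega⟩ *
          Real.sqrt (qnum q ((i : ℝ) + 1) * qnum q ((d : ℝ) - (i : ℝ))) else 0) =
          qnum q ((i : ℝ) + 1) * qnum q ((d : ℝ) - i) := by
        split_ifs with h
        · rw [Jminus_apply_succ q d _ _ (by simp)]
          push_cast
          rw [show (d : ℝ) - (i + 1) + 1 = d - i by ring, Real.mul_self_sqrt n2]
        · have : (i : ℕ) = d := by omega
          simp [this]
      rw [t1, t2, key, if_pos rfl]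
      push_cast; ring_nf
    · have hne : (i : ℕ) ≠ k := fun h => hik (Fin.ext h)
      rw [if_neg hik]
      have t1 : (if h : 0 < (k : ℕ) then Jminus q d ⟨k - 1, by omega⟩ i *
          Real.sqrt (qnum q (k : ℝ) * qnum q ((d : ℝ) - (k : ℝ) + 1)) else 0) = 0 := by
        split_ifs with h
        · rw [Jminus_apply_of_ne q d _ _ (by simp only []; omega), zero_mul]
        · rfl
      have t2 : (if h : (k : ℕ) < d then Jminus q d i ⟨k + 1, by omega⟩ *
          Real.sqrt (qnum q ((k : ℝ) + 1) * qnum q ((d : ℝ) - (k : ℝ))) else 0) = 0 := by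
        split_ifs with h
        · rw [Jminus_apply_of_ne q d _ _ (by simp only []; omega), zero_mul]
        · rfl
      rw [t1, t2, sub_zero]

theorem QModule.tensor_wt (q : ℝ) (V : QModule ι) (W : QModule κ) (x : ι × κ) :
    (V.tensor q W).wt x = V.wt x.1 + W.wt x.2 := rfl

theorem QModule.tensor_low_apply (q : ℝ) (V : QModule ι) (W : QModule κ) (x y : ι × κ) :
    (V.tensor q W).low x y =
      (if x.1 = y.1 then q ^ (-((V.wt x.1 : ℝ) / 2)) * W.low x.2 y.2 else 0) +
      (if x.2 = y.2 then V.low x.1 y.1 * q ^ ((W.wt x.2 : ℝ) / 2) else 0) := by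
  simp only [QModule.tensor, Matrix.add_apply, Matrix.kroneckerMap_apply, Matrix.diagonal_apply]
  split_ifs <;> simp

/-- Moving `q^{-J_z}` past `J_-` on the first factor and `q^{J_z}` past `J_-` on the second produces
the same factor `q`, so the cross terms of the commutator cancel. The diagonal terms add up to
`[2J_z]` by `qnum_add`. -/
theorem IsQModule.tensor {q : ℝ} (hq₀ : 0 < q) {V : QModule ι} {W : QModule κ}
    (hV : IsQModule q V) (hW : IsQModule q W) : IsQModule q (V.tensor q W) where
  low_wt x y h := by
    rw [QModule.tensor_low_apply] at h
    simp only [QModule.tensor]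
    by_cases h1 : x.1 = y.1 ∧ W.low x.2 y.2 ≠ 0
    · rw [h1.1, hW.low_wt _ _ h1.2]; ring
    · by_cases h2 : x.2 = y.2 ∧ V.low x.1 y.1 ≠ 0
      · rw [h2.1, hV.low_wt _ _ h2.2]; ring
      · exfalso; apply h
        rw [not_and_or, not_not] at h1 h2
        rcases h1 with h1 | h1 <;> rcases h2 with h2 | h2 <;> simp [h1, h2]
  comm := by
    set A : Matrix ι ι ℝ := Matrix.diagonal fun i => q ^ (-((V.wt i : ℝ) / 2)) with hA
    set B : Matrix κ κ ℝ := Matrix.diagonal fun j => q ^ ((W.wt j : ℝ) / 2) with hB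
    have hAV : A * V.low = q • (V.low * A) := by
      ext i j
      simp only [hA, Matrix.diagonal_mul, Matrix.mul_diagonal, Matrix.smul_apply, smul_eq_mul]
      by_cases h : V.low i j = 0
      · simp [h]
      · rw [hV.low_wt _ _ h]
        have : q ^ (-(((V.wt j - 2 : ℤ) : ℝ) / 2)) = q ^ (-((V.wt j : ℝ) / 2)) * q := by
          rw [← Real.rpow_add_one hq₀.ne']; congr 1; push_cast; ring
        rw [this]; ring
    have hWB : W.low * B = q • (B * W.low) := by
      ext i j
      simp only [hB, Matrix.diagonal_mul, Matrix.mul_diagonal, Matrix.smul_apply, smul_eq_mul]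
      by_cases h : W.low i j = 0
      · simp [h]
      · have e := hW.low_wt _ _ h
        have : q ^ ((W.wt j : ℝ) / 2) = q ^ ((W.wt i : ℝ) / 2) * q := by
          rw [← Real.rpow_add_one hq₀.ne']; congr 1; rw [e]; push_cast; ring
        rw [this]; ring
    have hAt : Aᵀ = A := by simp [hA]
    have hBt : Bᵀ = B := by simp [hB]
    have hVA : V.lowᵀ * A = q • (A * V.lowᵀ) := by
      have := congrArg Matrix.transpose hAV
      simpa [hAt] using this
    have hBW : B * W.lowᵀ = q • (W.lowᵀ * B) := by
      have := congrArg Matrix.transpose hWB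
      simpa [hBt] using this
    have hlow : (V.tensor q W).low = A ⊗ₖ W.low + V.low ⊗ₖ B := rfl
    have hlowt : (V.tensor q W).lowᵀ = A ⊗ₖ W.lowᵀ + V.lowᵀ ⊗ₖ B := by
      rw [hlow, Matrix.transpose_add, ← Matrix.kroneckerMap_transpose,
        ← Matrix.kroneckerMap_transpose, hAt, hBt]
    have hdiag : (A * A) ⊗ₖ (W.lowᵀ * W.low - W.low * W.lowᵀ) +
        (V.lowᵀ * V.low - V.low * V.lowᵀ) ⊗ₖ (B * B) =
        Matrix.diagonal fun i => qnum q ((V.tensor q W).wt i) := by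
      rw [hV.comm, hW.comm, hA, hB, Matrix.diagonal_mul_diagonal, Matrix.diagonal_mul_diagonal,
        Matrix.diagonal_kronecker_diagonal, Matrix.diagonal_kronecker_diagonal,
        Matrix.diagonal_add]
      congr 1
      ext x
      simp only [QModule.tensor]
      push_cast
      rw [← qnum_add hq₀, ← Real.rpow_add hq₀, ← Real.rpow_add hq₀]
      congr 3 <;> ring
    have e1 : (A * V.low) ⊗ₖ (W.lowᵀ * B) = (V.low * A) ⊗ₖ (B * W.lowᵀ) := by
      rw [hAV, hBW, Matrix.smul_kronecker, Matrix.kronecker_smul]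
    have e2 : (V.lowᵀ * A) ⊗ₖ (B * W.low) = (A * V.lowᵀ) ⊗ₖ (W.low * B) := by
      rw [hVA, hWB, Matrix.smul_kronecker, Matrix.kronecker_smul]
    rw [hlowt, hlow, ← hdiag]
    have sub1 : (A * A) ⊗ₖ (W.lowᵀ * W.low - W.low * W.lowᵀ) =
        (A * A) ⊗ₖ (W.lowᵀ * W.low) - (A * A) ⊗ₖ (W.low * W.lowᵀ) := by
      ext; simp [mul_sub]
    have sub2 : (V.lowᵀ * V.low - V.low * V.lowᵀ) ⊗ₖ (B * B) =
        (V.lowᵀ * V.low) ⊗ₖ (B * B) - (V.low * V.lowᵀ) ⊗ₖ (B * B) := by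
      ext; simp [sub_mul]
    rw [sub1, sub2]
    simp only [add_mul, mul_add, ← Matrix.mul_kronecker_mul]
    rw [e1, e2]
    abel

/-! ### Morphisms -/

namespace IsHom

variable {V : QModule ι} {W : QModule κ} {X : QModule μ} {Y : QModule ν}

theorem zero : IsHom V W 0 := ⟨by simp, by simp, by simp⟩

theorem one : IsHom V V 1 :=
  ⟨fun j i h => by
    by_cases e : j = i
    · rw [e]
    · simp [e] at h, by simp, by simp⟩

theorem sub {S T : Matrix κ ι ℝ} (hS : IsHom V W S) (hT : IsHom V W T) : IsHom V W (S - T) where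
  wt j i h := by
    by_cases h1 : S j i = 0
    · exact hT.wt j i fun h2 => h (by simp [h1, h2])
    · exact hS.wt j i h1
  low := by rw [Matrix.sub_mul, Matrix.mul_sub, hS.low, hT.low]
  up := by rw [Matrix.sub_mul, Matrix.mul_sub, hS.up, hT.up]

theorem smul {T : Matrix κ ι ℝ} (c : ℝ) (hT : IsHom V W T) : IsHom V W (c • T) where
  wt j i h := hT.wt j i fun h2 => h (by simp [h2])
  low := by rw [Matrix.smul_mul, Matrix.mul_smul, hT.low]
  up := by rw [Matrix.smul_mul, Matrix.mul_smul, hT.up]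

theorem transpose {T : Matrix κ ι ℝ} (hT : IsHom V W T) : IsHom W V Tᵀ where
  wt j i h := (hT.wt i j h).symm
  low := by
    have := congrArg Matrix.transpose hT.up
    simpa using this.symm
  up := by
    have := congrArg Matrix.transpose hT.low
    simpa using this.symm

theorem mul {S : Matrix μ κ ℝ} {T : Matrix κ ι ℝ} (hS : IsHom W X S) (hT : IsHom V W T) :
    IsHom V X (S * T) where
  wt j i h := by
    rw [Matrix.mul_apply] at h
    obtain ⟨k, -, hk⟩ := Finset.exists_ne_zero_of_sum_ne_zero h
    exact (hS.wt j k (left_ne_zero_of_mul hk)).trans (hT.wt k i (right_ne_zero_of_mul hk))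
  low := by rw [Matrix.mul_assoc, hT.low, ← Matrix.mul_assoc, hS.low, Matrix.mul_assoc]
  up := by rw [Matrix.mul_assoc, hT.up, ← Matrix.mul_assoc, hS.up, Matrix.mul_assoc]

/-- A weight-preserving map commutes with every function of the weight, in particular with the
factors `q^{±J_z}` of the coproduct. -/
theorem mul_diagonal {T : Matrix κ ι ℝ} (hT : IsHom V W T) (f : ℤ → ℝ) :
    T * Matrix.diagonal (fun i => f (V.wt i)) = Matrix.diagonal (fun i => f (W.wt i)) * T := by
  ext j i
  rw [Matrix.mul_diagonal, Matrix.diagonal_mul]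
  by_cases h : T j i = 0
  · simp [h]
  · rw [hT.wt j i h, mul_comm]

theorem tensor {q : ℝ} {T : Matrix κ ι ℝ} {S : Matrix ν μ ℝ} (hT : IsHom V W T)
    (hS : IsHom X Y S) : IsHom (V.tensor q X) (W.tensor q Y) (T ⊗ₖ S) where
  wt j i h := by
    rw [Matrix.kroneckerMap_apply] at h
    simp only [QModule.tensor]
    rw [hT.wt _ _ (left_ne_zero_of_mul h), hS.wt _ _ (right_ne_zero_of_mul h)]
  low := by
    simp only [QModule.tensor]
    rw [Matrix.mul_add, Matrix.add_mul, ← Matrix.mul_kronecker_mul, ← Matrix.mul_kronecker_mul,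
      ← Matrix.mul_kronecker_mul, ← Matrix.mul_kronecker_mul, hT.low, hS.low,
      hT.mul_diagonal (fun n => q ^ (-((n : ℝ) / 2))), hS.mul_diagonal (fun n => q ^ ((n : ℝ) / 2))]
  up := by
    simp only [QModule.tensor, Matrix.transpose_add, ← Matrix.kroneckerMap_transpose,
      Matrix.diagonal_transpose]
    rw [Matrix.mul_add, Matrix.add_mul, ← Matrix.mul_kronecker_mul, ← Matrix.mul_kronecker_mul,
      ← Matrix.mul_kronecker_mul, ← Matrix.mul_kronecker_mul, hT.up, hS.up,
      hT.mul_diagonal (fun n => q ^ (-((n : ℝ) / 2))), hS.mul_diagonal (fun n => q ^ ((n : ℝ) / 2))]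

end IsHom

/-- Coassociativity of `Δ` on `J_-`: the weight factors `q^{±J_z}` are multiplicative on tensor
products. -/
theorem tensor_assoc_low {q : ℝ} (hq₀ : 0 < q) (V : QModule ι) (W : QModule κ) (X : QModule μ) :
    (V.tensor q (W.tensor q X)).low.submatrix (Equiv.prodAssoc ι κ μ) (Equiv.prodAssoc ι κ μ) =
      ((V.tensor q W).tensor q X).low := by
  ext ⟨⟨i, j⟩, k⟩ ⟨⟨i', j'⟩, k'⟩
  simp only [Matrix.submatrix_apply, QModule.tensor_low_apply, Equiv.prodAssoc_apply,
    QModule.tensor_wt, Prod.mk.injEq]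
  have e1 : q ^ (-(((V.wt i + W.wt j : ℤ) : ℝ) / 2)) =
      q ^ (-((V.wt i : ℝ) / 2)) * q ^ (-((W.wt j : ℝ) / 2)) := by
    rw [← Real.rpow_add hq₀]; congr 1; push_cast; ring
  have e2 : q ^ (((W.wt j + X.wt k : ℤ) : ℝ) / 2) =
      q ^ ((W.wt j : ℝ) / 2) * q ^ ((X.wt k : ℝ) / 2) := by
    rw [← Real.rpow_add hq₀]; congr 1; push_cast; ring
  rw [e1, e2]
  by_cases h1 : i = i' <;> by_cases h2 : j = j' <;> by_cases h3 : k = k' <;> simp [h1, h2, h3] <;>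
    ring

theorem IsHom.assoc {q : ℝ} (hq₀ : 0 < q) {V : QModule ι} {W : QModule κ} {X : QModule μ}
    {Y : QModule ν} {T : Matrix (ι × κ × μ) ν ℝ} (hT : IsHom Y (V.tensor q (W.tensor q X)) T) :
    IsHom Y ((V.tensor q W).tensor q X) (T.submatrix (Equiv.prodAssoc ι κ μ) id) where
  wt := by
    rintro ⟨⟨i, j⟩, k⟩ l h
    have := hT.wt _ _ h
    simp only [QModule.tensor, Equiv.prodAssoc_apply, id_eq] at this ⊢
    rw [← this]; ring
  low := by
    rw [← tensor_assoc_low hq₀, Matrix.submatrix_mul_equiv, ← hT.low]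
    rfl
  up := by
    rw [← tensor_assoc_low hq₀, Matrix.transpose_submatrix, Matrix.submatrix_mul_equiv, ← hT.up]
    rfl

/-! ### Schur's lemma -/

section Schur

variable {q : ℝ} (hq₀ : 0 < q) (hq₁ : q < 1)
include hq₀ hq₁

/-- The highest weight vector generates `V_P`: all matrix elements of `J_-` between neighbouring
weights are non-zero. -/
theorem IsHom.eq_zero_of_last {W : QModule κ} {P : ℕ} {T : Matrix κ (Fin (P + 1)) ℝ}
    (hT : IsHom (spin q P) W T) (h : ∀ j, T j (Fin.last P) = 0) : T = 0 := by
  have key : ∀ t : ℕ, ∀ i : Fin (P + 1), (i : ℕ) + t = P → ∀ j, T j i = 0 := by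
    intro t
    induction t with
    | zero =>
      intro i hi j
      rw [show i = Fin.last P from Fin.ext (by simpa using hi), h]
    | succ t ih =>
      intro i hi j
      have h1 := congrFun (congrFun hT.low j) ⟨i + 1, by omega⟩
      rw [Matrix.mul_apply, Matrix.mul_apply] at h1
      simp only [ih ⟨i + 1, by omega⟩ (by simp only []; omega), mul_zero,
        Finset.sum_const_zero] at h1
      rw [Finset.sum_eq_single i] at h1
      · exact (mul_eq_zero.1 h1).resolve_right (Jminus_ne_zero hq₀ hq₁ P _ _ rfl)
      · intro k _ hk
        have : (spin q P).low k ⟨i + 1, by omega⟩ = 0 :=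
          Jminus_apply_of_ne q P _ _ (fun e => hk (Fin.ext (by simpa using e)))
        rw [this, mul_zero]
      · simp
  ext j i
  exact key (P - i) i (by omega) j

/-- A highest weight vector is sent to a vector killed by `J_+`. A non-zero component at `j` has
weight `P`, which for `P ≠ Q` places `j` below the top of `V_Q`, where `J_+` does not vanish. -/
theorem IsHom.eq_zero_of_ne {P Q : ℕ} (hPQ : P ≠ Q) {T : Matrix (Fin (Q + 1)) (Fin (P + 1)) ℝ}
    (hT : IsHom (spin q P) (spin q Q) T) : T = 0 := by
  refine hT.eq_zero_of_last hq₀ hq₁ fun j => ?_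
  by_contra hne
  have hw := hT.wt _ _ hne
  simp only [spin, Fin.val_last] at hw
  have h1 := congrFun (congrFun hT.up ⟨j + 1, by omega⟩) (Fin.last P)
  rw [Matrix.mul_apply, Matrix.mul_apply] at h1
  rw [Finset.sum_eq_zero, Finset.sum_eq_single j] at h1
  · have h2 : (spin q Q).lowᵀ ⟨j + 1, by omega⟩ j ≠ 0 := Jminus_ne_zero hq₀ hq₁ Q _ _ rfl
    exact mul_ne_zero h2 hne h1.symm
  · intro k _ hk
    have : (spin q Q).lowᵀ ⟨j + 1, by omega⟩ k = 0 :=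
      Jminus_apply_of_ne q Q _ _ (fun e => hk (Fin.ext (by simpa using e)))
    rw [this, zero_mul]
  · simp
  · intro k _
    have : (spin q P).lowᵀ k (Fin.last P) = 0 :=
      Jminus_apply_of_ne q P _ _ (by simp only [Fin.val_last]; omega)
    rw [this, mul_zero]

/-- The top weight space is one-dimensional, so subtracting a multiple of the identity kills the
highest weight vector. -/
theorem IsHom.eq_smul_one {P : ℕ} {T : Matrix (Fin (P + 1)) (Fin (P + 1)) ℝ}
    (hT : IsHom (spin q P) (spin q P) T) :
    T = T (Fin.last P) (Fin.last P) • (1 : Matrix (Fin (P + 1)) (Fin (P + 1)) ℝ) := by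
  have := (hT.sub (IsHom.one.smul (T (Fin.last P) (Fin.last P)))).eq_zero_of_last hq₀ hq₁ ?_
  · exact sub_eq_zero.1 this
  · intro j
    by_cases hj : j = Fin.last P
    · subst hj; simp
    · have h0 : T j (Fin.last P) = 0 := by
        by_contra hne
        have hw := hT.wt _ _ hne
        simp only [spin, Fin.val_last] at hw
        exact hj (Fin.ext (by rw [Fin.val_last]; omega))
      simp [h0, hj]

/-- A highest weight vector generates an irreducible module. -/
theorem isHom_of_highestWeight {V : QModule ι} (hV : IsQModule q V) {c : ℕ} (v : ℕ → ι → ℝ)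
    (hwt : ∀ i, v 0 i ≠ 0 → V.wt i = c) (h0 : V.lowᵀ *ᵥ v 0 = 0)
    (hs : ∀ t, v (t + 1) = (Real.sqrt (qnum q ((c : ℝ) - t) * qnum q ((t : ℝ) + 1)))⁻¹ •
      V.low *ᵥ v t) :
    IsHom (spin q c) V (Matrix.of fun i (k : Fin (c + 1)) => v (c - k) i) := by
  set r : ℕ → ℝ := fun t => qnum q ((c : ℝ) - t) * qnum q ((t : ℝ) + 1) with hr
  have rpos : ∀ t < c, 0 < r t := fun t ht => by
    have : (t : ℝ) < c := by exact_mod_cast ht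
    exact mul_pos (qnum_pos hq₀ hq₁ (by linarith)) (qnum_pos hq₀ hq₁ (by positivity))
  have hw : ∀ t i, v t i ≠ 0 → V.wt i = c - 2 * t := by
    intro t
    induction t with
    | zero => intro i hi; rw [hwt i hi]; simp
    | succ t ih =>
      intro i hi
      rw [hs, Pi.smul_apply] at hi
      have hi := right_ne_zero_of_smul hi
      rw [Matrix.mulVec, dotProduct] at hi
      obtain ⟨k, -, hk⟩ := Finset.exists_ne_zero_of_sum_ne_zero hi
      rw [hV.low_wt _ _ (left_ne_zero_of_mul hk), ih k (right_ne_zero_of_mul hk)]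
      push_cast; ring
  have hdiag : ∀ t, (Matrix.diagonal fun i => qnum q (V.wt i)) *ᵥ v t =
      qnum q ((c : ℝ) - 2 * t) • v t := by
    intro t; ext i
    rw [Matrix.mulVec_diagonal, Pi.smul_apply, smul_eq_mul]
    by_cases h : v t i = 0
    · simp [h]
    · rw [hw t i h]; push_cast; rfl
  have hlow : ∀ t < c, V.low *ᵥ v t = Real.sqrt (r t) • v (t + 1) := fun t ht => by
    rw [hs, smul_smul, mul_inv_cancel₀ (Real.sqrt_pos.2 (rpos t ht)).ne', one_smul]
  have hcomm : ∀ t, V.lowᵀ *ᵥ (V.low *ᵥ v t) =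
      V.low *ᵥ (V.lowᵀ *ᵥ v t) + qnum q ((c : ℝ) - 2 * t) • v t := fun t => by
    rw [← hdiag, ← hV.comm, Matrix.sub_mulVec, Matrix.mulVec_mulVec, Matrix.mulVec_mulVec]
    abel
  -- Here `J_+ J_- v_t = [c-t][t+1] v_t`; the induction step is `[c-t][t+1] + [c-2t-2] =
  -- [c-t-1][t+2]`.
  have hEF : ∀ t ≤ c, V.lowᵀ *ᵥ (V.low *ᵥ v t) = r t • v t := by
    intro t
    induction t with
    | zero =>
      intro _
      rw [hcomm, h0, Matrix.mulVec_zero, zero_add]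
      simp [hr, qnum_one hq₀ hq₁]
    | succ t ih =>
      intro ht
      have e : V.lowᵀ *ᵥ v (t + 1) = Real.sqrt (r t) • v t := by
        rw [hs, Matrix.mulVec_smul, ih (by omega), smul_smul]
        congr 1
        rw [inv_mul_eq_div, Real.div_sqrt]
      rw [hcomm, e, Matrix.mulVec_smul, hlow t (by omega), smul_smul,
        Real.mul_self_sqrt (rpos t (by omega)).le, ← add_smul]
      congr 1
      have k := qnum_mul_sub hq₀ hq₁ ((c : ℝ) - t - 1) ((t : ℝ) + 1)
      simp only [hr]
      push_cast
      rw [show (c : ℝ) - 2 * (t + 1) = c - t - 1 - (t + 1) by ring, ← k]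
      ring_nf
  have hup : ∀ t < c, V.lowᵀ *ᵥ v (t + 1) = Real.sqrt (r t) • v t := fun t ht => by
    rw [hs, Matrix.mulVec_smul, hEF t ht.le, smul_smul]
    congr 1
    rw [inv_mul_eq_div, Real.div_sqrt]
  -- The string stops by positivity: `‖J_- v_c‖² = ⟨v_c, J_+ J_- v_c⟩`, and the eigenvalue contains
  -- `[0] = 0`.
  have hlast : V.low *ᵥ v c = 0 := by
    have h1 := hEF c le_rfl
    rw [show r c = 0 by simp [hr], zero_smul] at h1
    have h2 : (V.low *ᵥ v c) ⬝ᵥ (V.low *ᵥ v c) = 0 := by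
      rw [Matrix.dotProduct_mulVec, ← Matrix.mulVec_transpose, h1, zero_dotProduct]
    exact dotProduct_self_eq_zero.1 h2
  refine ⟨fun i k h => ?_, ?_, ?_⟩
  · rw [hw _ i h]
    simp only [spin]; omega
  · ext i k
    rw [Matrix.mul_apply]
    simp only [Matrix.of_apply, spin]
    rw [sum_mul_Jminus q c (fun j => v (c - (j : ℕ)) i)]
    change _ = (V.low *ᵥ v (c - k)) i
    split_ifs with h
    · rw [hlow _ (by omega), Pi.smul_apply, smul_eq_mul, mul_comm]
      have e : ((c - (k : ℕ) : ℕ) : ℝ) = c - k := by rw [Nat.cast_sub (by omega)]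
      simp only [hr, e]
      congr 2
      · congr 2; ring
      · omega
    · rw [show c - (k : ℕ) = c by omega, hlast]; rfl
  · ext i k
    rw [Matrix.mul_apply]
    simp only [Matrix.of_apply, spin, Matrix.transpose_apply]
    rw [sum_Jminus_mul q c (fun j => v (c - (j : ℕ)) i)]
    change _ = (V.lowᵀ *ᵥ v (c - k)) i
    split_ifs with h
    · have e1 : c - (k : ℕ) = (c - (k + 1)) + 1 := by omega
      rw [e1, hup _ (by omega), Pi.smul_apply, smul_eq_mul, mul_comm]
      have e : ((c - (k + 1 : ℕ) : ℕ) : ℝ) = c - (k + 1) := by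
        rw [Nat.cast_sub (by omega)]; push_cast; rfl
      simp only [hr, e]
      congr 2
      congr 2 <;> ring
    · rw [show c - (k : ℕ) = 0 by omega, h0]; rfl

end Schur

end

end QLorentz

namespace QLorentz

noncomputable section

open Matrix
open scoped Kronecker

set_option linter.unusedSectionVars false

/-! ### Clebsch-Gordan matrices -/

/-- The matrix of `C^{IJ}_K`. -/
def cgMat (q : ℝ) (a b c : ℕ) : Matrix (Fin (a + 1) × Fin (b + 1)) (Fin (c + 1)) ℝ :=
  Matrix.of fun x k => cg q a b c x.1 x.2 k

theorem cgMat_of_not_admissible (q : ℝ) {a b c : ℕ} (h : ¬ Admissible a b c) :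
    cgMat q a b c = 0 := by
  ext x k; simp [cgMat, cg, h]

section

variable {q : ℝ} (hq₀ : 0 < q) (hq₁ : q < 1)
include hq₀ hq₁

/-- Lowering `i` by one adds one factor to the product. On the relevant weight line the `q`-numbers
in that factor are the squared matrix elements of `J_-` on the two tensor factors, which is the form
needed for the cancellation in `Δ(J_+)v`. -/
theorem hwVec_step {a b c : ℕ} (i : Fin (a + 1)) (j : Fin (b + 1))
    (hij : 2 * ((i : ℕ) + (j : ℕ)) = a + b + c + 2) (hi : 0 < (i : ℕ)) (hj : 0 < (j : ℕ)) :
    hwVec q a b c (⟨i - 1, by omega⟩, j) = hwVec q a b c (i, ⟨j - 1, by omega⟩) *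
      (-(q ^ (-((c : ℝ) / 2 + 1))) *
        (Real.sqrt (qnum q j * qnum q ((b : ℝ) - j + 1)) /
          Real.sqrt (qnum q i * qnum q ((a : ℝ) - i + 1)))) := by
  have hi' := i.2
  have hj' := j.2
  have e : a - ((i : ℕ) - 1) = (a - i) + 1 := by omega
  have hc : ((i : ℕ) : ℝ) + (j : ℕ) = ((a : ℝ) + b + c + 2) / 2 := by
    have : (2 * (((i : ℕ) : ℝ) + (j : ℕ))) = (a : ℝ) + b + c + 2 := by exact_mod_cast hij
    linarith
  have hs : ((a - (i : ℕ) : ℕ) : ℝ) = a - (i : ℕ) := by rw [Nat.cast_sub (by omega)]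
  simp only [hwVec]
  rw [if_pos (by omega), if_pos (by omega), e, Finset.prod_range_succ, hs]
  congr 2
  rw [← Real.sqrt_div]
  · congr 2
    · congr 2 <;> linarith
    · rw [mul_comm]; congr 2; ring
  · refine mul_nonneg (qnum_nonneg hq₀ hq₁ (by positivity)) (qnum_nonneg hq₀ hq₁ ?_)
    have : ((j : ℕ) : ℝ) ≤ b := by exact_mod_cast Nat.lt_succ_iff.1 hj'
    linarith

/-- Only entries one step above weight `c` can be non-zero. Each receives one contribution from
raising either factor, and the power `q^{-(c/2+1)}` in `hwVec` makes them opposite. -/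
theorem raise_hwVec {a b c : ℕ} (h : Admissible a b c) :
    ((spin q a).tensor q (spin q b)).lowᵀ *ᵥ hwVec q a b c = 0 := by
  obtain ⟨-, h1, h2, h3⟩ := h
  ext ⟨i, j⟩
  have hi' := i.2
  have hj' := j.2
  have hsplit : (((spin q a).tensor q (spin q b)).lowᵀ *ᵥ hwVec q a b c) (i, j) =
      q ^ (-wt a i) * (∑ j', hwVec q a b c (i, j') * Jminus q b j' j) +
      q ^ (wt b j) * (∑ i', hwVec q a b c (i', j) * Jminus q a i' i) := by
    simp only [Matrix.mulVec, dotProduct, Matrix.transpose_apply, QModule.tensor_low_apply,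
      add_mul, Finset.sum_add_distrib, Fintype.sum_prod_type, ite_mul, zero_mul]
    congr 1
    · rw [Finset.sum_eq_single i]
      · simp only [if_true, Finset.mul_sum, wt_eq_spin_wt q]
        exact Finset.sum_congr rfl fun j' _ => by simp only [spin]; ring
      · intro k _ hk; simp [hk]
      · simp
    · rw [Finset.mul_sum]
      refine Finset.sum_congr rfl fun i' _ => ?_
      rw [Finset.sum_eq_single j]
      · simp only [if_true, wt_eq_spin_wt q]; simp only [spin]; ring
      · intro k _ hk; simp [hk]
      · simp
  rw [hsplit, sum_mul_Jminus q b (fun j' => hwVec q a b c (i, j')),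
    sum_mul_Jminus q a (fun i' => hwVec q a b c (i', j))]
  by_cases hij : 2 * ((i : ℕ) + (j : ℕ)) = a + b + c + 2
  · have hi : 0 < (i : ℕ) := by omega
    have hj : 0 < (j : ℕ) := by omega
    rw [dif_pos hi, dif_pos hj, hwVec_step hq₀ hq₁ i j hij hi hj]
    have hia : ((i : ℕ) : ℝ) ≤ a := by exact_mod_cast Nat.lt_succ_iff.1 hi'
    have hpos : Real.sqrt (qnum q i * qnum q ((a : ℝ) - i + 1)) ≠ 0 :=
      (Real.sqrt_pos.2 (mul_pos (qnum_pos hq₀ hq₁ (by exact_mod_cast hi))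
        (qnum_pos hq₀ hq₁ (by linarith)))).ne'
    have hc : ((i : ℕ) : ℝ) + (j : ℕ) = ((a : ℝ) + b + c + 2) / 2 := by
      have : (2 * (((i : ℕ) : ℝ) + (j : ℕ))) = (a : ℝ) + b + c + 2 := by exact_mod_cast hij
      linarith
    have hexp : q ^ (wt b j) * q ^ (-((c : ℝ) / 2 + 1)) = q ^ (-wt a i) := by
      rw [← Real.rpow_add hq₀]; congr 1; simp only [wt]; linarith
    rw [← hexp]
    simp only [Pi.zero_apply]
    field_simp
    ring
  · have z1 : ∀ h : 0 < (j : ℕ), hwVec q a b c (i, ⟨j - 1, by omega⟩) = 0 := fun h => by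
      simp only [hwVec]; rw [if_neg]; omega
    have z2 : ∀ h : 0 < (i : ℕ), hwVec q a b c (⟨i - 1, by omega⟩, j) = 0 := fun h => by
      simp only [hwVec]; rw [if_neg]; omega
    have t1 : (if h : 0 < (j : ℕ) then hwVec q a b c (i, ⟨j - 1, by omega⟩) *
        Real.sqrt (qnum q j * qnum q ((b : ℝ) - j + 1)) else 0) = 0 := by
      split_ifs with h
      · rw [z1 h, zero_mul]
      · rfl
    have t2 : (if h : 0 < (i : ℕ) then hwVec q a b c (⟨i - 1, by omega⟩, j) *
        Real.sqrt (qnum q i * qnum q ((a : ℝ) - i + 1)) else 0) = 0 := by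
      split_ifs with h
      · rw [z2 h, zero_mul]
      · rfl
    rw [t1, t2]; simp

theorem isHom_cgMat (a b c : ℕ) :
    IsHom (spin q c) ((spin q a).tensor q (spin q b)) (cgMat q a b c) := by
  by_cases h : Admissible a b c
  · have := isHom_of_highestWeight hq₀ hq₁
      ((isQModule_spin hq₀ hq₁ a).tensor hq₀ (isQModule_spin hq₀ hq₁ b)) (c := c)
      (cgVec q a b c) ?_ ?_ ?_
    · convert this using 1
      ext x k; simp [cgMat, cg, h]
    · intro x hx
      simp only [cgVec, Pi.smul_apply, smul_eq_mul] at hx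
      have := right_ne_zero_of_mul hx
      simp only [hwVec] at this
      have h2 : 2 * ((x.1 : ℕ) + (x.2 : ℕ)) = a + b + c := by
        by_contra h2; exact this (if_neg h2)
      simp only [QModule.tensor, spin]; omega
    · simp only [cgVec, Matrix.mulVec_smul, raise_hwVec hq₀ hq₁ h, smul_zero]
    · intro t
      rw [tensor_spin_low]; rfl
  · rw [cgMat_of_not_admissible q h]; exact IsHom.zero

/-! ### Orthonormality and completeness of the Clebsch-Gordan coefficients. -/

omit hq₀ hq₁ in
theorem hwVec_top {a b c : ℕ} (h : Admissible a b c) :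
    hwVec q a b c (Fin.last a, ⟨(b + c - a) / 2, by obtain ⟨-, h1, h2, -⟩ := h; omega⟩) = 1 := by
  obtain ⟨⟨r, hr⟩, h1, h2, h3⟩ := h
  simp only [hwVec, Fin.val_last]
  rw [if_pos (by omega)]; simp

omit hq₀ hq₁ in
theorem sum_hwVec_sq_pos {a b c : ℕ} (h : Admissible a b c) : 0 < ∑ x, hwVec q a b c x ^ 2 := by
  refine Finset.sum_pos' (fun x _ => sq_nonneg _)
    ⟨(Fin.last a, ⟨(b + c - a) / 2, by obtain ⟨-, h1, h2, -⟩ := h; omega⟩), Finset.mem_univ _, ?_⟩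
  rw [hwVec_top h]; norm_num

/-- By Schur's lemma the product is a scalar, read off from the normalised highest weight vector. -/
theorem cgMat_transpose_mul_self {a b c : ℕ} (h : Admissible a b c) :
    (cgMat q a b c)ᵀ * cgMat q a b c = 1 := by
  have hh := isHom_cgMat hq₀ hq₁ a b c
  rw [(hh.transpose.mul hh).eq_smul_one hq₀ hq₁]
  have : ((cgMat q a b c)ᵀ * cgMat q a b c) (Fin.last c) (Fin.last c) = 1 := by
    rw [Matrix.mul_apply]
    simp only [Matrix.transpose_apply, cgMat, Matrix.of_apply, cg, h, if_true, Fin.val_last,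
      Nat.sub_self, cgVec, Pi.smul_apply, smul_eq_mul]
    have hp := sum_hwVec_sq_pos (q := q) h
    have e : ∀ x, (Real.sqrt (∑ x, hwVec q a b c x ^ 2))⁻¹ * hwVec q a b c x *
        ((Real.sqrt (∑ x, hwVec q a b c x ^ 2))⁻¹ * hwVec q a b c x) =
        (∑ x, hwVec q a b c x ^ 2)⁻¹ * hwVec q a b c x ^ 2 := fun x => by
      rw [mul_mul_mul_comm, ← mul_inv, Real.mul_self_sqrt hp.le, sq]
    rw [Finset.sum_congr rfl fun x _ => e x, ← Finset.mul_sum, inv_mul_cancel₀ hp.ne']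
  rw [this, one_smul]

theorem cgMat_transpose_mul_of_ne (a b : ℕ) {c c' : ℕ} (h : c ≠ c') :
    (cgMat q a b c)ᵀ * cgMat q a b c' = 0 :=
  ((isHom_cgMat hq₀ hq₁ a b c).transpose.mul (isHom_cgMat hq₀ hq₁ a b c')).eq_zero_of_ne
    hq₀ hq₁ h.symm

omit hq₀ hq₁ in
-- The count `∑_K dim V_K = dim V_I · dim V_J`, which turns orthogonality into completeness.
theorem sum_admissible_dim (a b n : ℕ) (hn : a + b ≤ n) :
    ∑ c ∈ Finset.range (n + 1), (if Admissible a b c then (c : ℝ) + 1 else 0) =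
      ((a : ℝ) + 1) * (b + 1) := by
  have h1 : ∀ m : ℕ, ∑ k ∈ Finset.range (m + 1), ((a : ℝ) + b + 1 - 2 * k) =
      (m + 1) * (a + b + 1 - m) := by
    intro m
    induction m with
    | zero => simp
    | succ m ih => rw [Finset.sum_range_succ, ih]; push_cast; ring
  rw [← Finset.sum_filter]
  have h2 : ∑ c ∈ (Finset.range (n + 1)).filter (fun c => Admissible a b c), ((c : ℝ) + 1) =
      ∑ k ∈ Finset.range (min a b + 1), ((a : ℝ) + b + 1 - 2 * k) := by
    symm
    refine Finset.sum_bij (fun k _ => a + b - 2 * k) ?_ ?_ ?_ ?_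
    · intro k hk
      rw [Finset.mem_filter]
      simp only [Finset.mem_range, Admissible] at hk ⊢
      refine ⟨by omega, ⟨a + b - k, by omega⟩, by omega, by omega, by omega⟩
    · intro k hk l hl e
      simp only [Finset.mem_range] at hk hl e
      omega
    · intro c hc
      rw [Finset.mem_filter] at hc
      simp only [Finset.mem_range, Admissible] at hc
      obtain ⟨-, ⟨r, hr⟩, h1, h2, h3⟩ := hc
      exact ⟨(a + b - c) / 2, by simp only [Finset.mem_range]; omega, by omega⟩
    · intro k hk
      simp only [Finset.mem_range] at hk
      rw [Nat.cast_sub (by omega)]; push_cast; ring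
  rw [h2, h1]
  rcases le_total a b with h | h
  · rw [min_eq_left h]; ring
  · rw [min_eq_right h]; ring

/-- Completeness of the Clebsch-Gordan decomposition of `V_I ⊗ V_J`. -/
theorem sum_cgMat_mul_transpose (a b n : ℕ) (hn : a + b ≤ n) :
    ∑ c ∈ Finset.range (n + 1), cgMat q a b c * (cgMat q a b c)ᵀ = 1 := by
  set E := ∑ c ∈ Finset.range (n + 1), cgMat q a b c * (cgMat q a b c)ᵀ with hE
  have hsymm : Eᵀ = E := by
    rw [hE, Matrix.transpose_sum]; simp
  have hidem : E * E = E := by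
    conv_lhs => rw [hE, Finset.sum_mul]
    refine (Finset.sum_congr rfl fun c hc => ?_).trans hE.symm
    rw [Finset.mul_sum, Finset.sum_eq_single c]
    · rw [Matrix.mul_assoc, ← Matrix.mul_assoc (cgMat q a b c)ᵀ]
      by_cases h : Admissible a b c
      · rw [cgMat_transpose_mul_self hq₀ hq₁ h, Matrix.one_mul]
      · simp [cgMat_of_not_admissible q h]
    · intro c' _ hne
      rw [Matrix.mul_assoc, ← Matrix.mul_assoc (cgMat q a b c)ᵀ,
        cgMat_transpose_mul_of_ne hq₀ hq₁ a b hne.symm]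
      simp
    · intro h; exact absurd hc h
  have htr : Matrix.trace E = ((a : ℝ) + 1) * (b + 1) := by
    rw [hE, Matrix.trace_sum, ← sum_admissible_dim a b n hn]
    refine Finset.sum_congr rfl fun c _ => ?_
    rw [Matrix.trace_mul_comm]
    split_ifs with h
    · rw [cgMat_transpose_mul_self hq₀ hq₁ h]; simp
    · simp [cgMat_of_not_admissible q h]
  -- `E` is an orthogonal projection whose trace is the full dimension; the complementary projection
  -- has trace zero, hence vanishes.
  have hz : (1 - E)ᴴ * (1 - E) = 1 - E := by
    rw [Matrix.conjTranspose_eq_transpose_of_trivial, Matrix.transpose_sub, hsymm,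
      Matrix.transpose_one, Matrix.mul_sub, Matrix.sub_mul, Matrix.sub_mul, hidem]
    simp
  have : 1 - E = 0 := by
    rw [← Matrix.trace_conjTranspose_mul_self_eq_zero_iff, hz, Matrix.trace_sub, htr]
    simp
  exact (sub_eq_zero.1 this).symm

/-! ### Associativity -/

/-- A morphism into `V_I ⊗ V_J` from an irreducible module is a multiple of the Clebsch-Gordan
matrix. -/
theorem IsHom.eq_smul_cgMat {a b c : ℕ} {T : Matrix (Fin (a + 1) × Fin (b + 1)) (Fin (c + 1)) ℝ}
    (hT : IsHom (spin q c) ((spin q a).tensor q (spin q b)) T) :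
    ∃ r : ℝ, T = r • cgMat q a b c := by
  have h1 : T = (∑ d ∈ Finset.range (a + b + c + 1), cgMat q a b d * (cgMat q a b d)ᵀ) * T := by
    rw [sum_cgMat_mul_transpose hq₀ hq₁ a b _ (by omega), Matrix.one_mul]
  rw [Matrix.sum_mul, Finset.sum_eq_single c] at h1
  · rw [Matrix.mul_assoc,
      ((isHom_cgMat hq₀ hq₁ a b c).transpose.mul hT).eq_smul_one hq₀ hq₁] at h1
    exact ⟨_, h1.trans (by rw [Matrix.mul_smul, Matrix.mul_one])⟩
  · intro d _ hd
    rw [Matrix.mul_assoc, ((isHom_cgMat hq₀ hq₁ a b d).transpose.mul hT).eq_zero_of_ne hq₀ hq₁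
      hd.symm, Matrix.mul_zero]
  · intro h; exact absurd (Finset.mem_range.2 (by omega)) h

/-- Expansion of a morphism `V_P → W` with respect to a decomposition of `W` into irreducibles. -/
theorem IsHom.expand {κ : Type} [Fintype κ] [DecidableEq κ] {W : QModule κ} {n m : ℕ}
    {f : ℕ → ∀ P : ℕ, Matrix κ (Fin (P + 1)) ℝ} (hf : ∀ M P, IsHom (spin q P) W (f M P))
    (hcomp : ∑ P ∈ Finset.range n, ∑ M ∈ Finset.range m, f M P * (f M P)ᵀ = 1) {P : ℕ}
    {T : Matrix κ (Fin (P + 1)) ℝ} (hT : IsHom (spin q P) W T) (hP : P < n) :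
    T = ∑ M ∈ Finset.range m, ((f M P)ᵀ * T) (Fin.last P) (Fin.last P) • f M P := by
  have h1 : T = (∑ P ∈ Finset.range n, ∑ M ∈ Finset.range m, f M P * (f M P)ᵀ) * T := by
    rw [hcomp, Matrix.one_mul]
  rw [Matrix.sum_mul, Finset.sum_eq_single P] at h1
  · refine h1.trans ?_
    rw [Matrix.sum_mul]
    refine Finset.sum_congr rfl fun M _ => ?_
    rw [Matrix.mul_assoc]
    conv_lhs => rw [((hf M P).transpose.mul hT).eq_smul_one hq₀ hq₁]
    rw [Matrix.mul_smul, Matrix.mul_one]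
  · intro d _ hd
    rw [Matrix.sum_mul]
    refine Finset.sum_eq_zero fun M _ => ?_
    rw [Matrix.mul_assoc, ((hf M d).transpose.mul hT).eq_zero_of_ne hq₀ hq₁ hd.symm,
      Matrix.mul_zero]
  · intro h; exact absurd (Finset.mem_range.2 hP) h

/-- Two orthogonal decompositions of `W` differ, on the multiplicity space of `V_P`, by a change of
orthonormal basis, which does not affect a sum of products over that basis. The indices `r` and `r'`
stay independent because Schur's lemma makes the change of basis the same for every weight vector of
`V_P`. -/
theorem sum_isotypic_eq {κ : Type} [Fintype κ] [DecidableEq κ] {W : QModule κ} {n m m' : ℕ}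
    {f g : ℕ → ∀ P : ℕ, Matrix κ (Fin (P + 1)) ℝ} (hf : ∀ M P, IsHom (spin q P) W (f M P))
    (hg : ∀ M P, IsHom (spin q P) W (g M P))
    (hfc : ∑ P ∈ Finset.range n, ∑ M ∈ Finset.range m, f M P * (f M P)ᵀ = 1)
    (hgc : ∑ P ∈ Finset.range n, ∑ M ∈ Finset.range m', g M P * (g M P)ᵀ = 1) {P : ℕ}
    (hP : P < n) (x y : κ) (r r' : Fin (P + 1)) :
    ∑ M ∈ Finset.range m, f M P x r * f M P y r' =
      ∑ M ∈ Finset.range m', g M P x r * g M P y r' := by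
  -- The same matrix, read by rows or by columns, expands `f` in `g` and `g` in `f`; using both
  -- expansions avoids proving that it is orthogonal.
  set u : ℕ → ℕ → ℝ := fun M N => ((f M P)ᵀ * g N P) (Fin.last P) (Fin.last P) with hu
  have h1 : ∀ M, f M P = ∑ N ∈ Finset.range m', u M N • g N P := fun M => by
    refine ((hf M P).expand hq₀ hq₁ hg hgc hP).trans (Finset.sum_congr rfl fun N _ => ?_)
    congr 1
    simp only [hu, Matrix.mul_apply, Matrix.transpose_apply]
    exact Finset.sum_congr rfl fun _ _ => mul_comm _ _
  have h2 : ∀ N, g N P = ∑ M ∈ Finset.range m, u M N • f M P := fun N =>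
    (hg N P).expand hq₀ hq₁ hf hfc hP
  have h1' : ∀ M, f M P x r = ∑ N ∈ Finset.range m', u M N * g N P x r := fun M => by
    have := congrFun (congrFun (h1 M) x) r
    simpa [Matrix.sum_apply] using this
  have h2' : ∀ N, g N P y r' = ∑ M ∈ Finset.range m, u M N * f M P y r' := fun N => by
    have := congrFun (congrFun (h2 N) y) r'
    simpa [Matrix.sum_apply] using this
  calc _ = ∑ M ∈ Finset.range m, ∑ N ∈ Finset.range m', u M N * g N P x r * f M P y r' := by
        refine Finset.sum_congr rfl fun M _ => ?_
        rw [h1' M, Finset.sum_mul]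
    _ = ∑ N ∈ Finset.range m', ∑ M ∈ Finset.range m, u M N * g N P x r * f M P y r' :=
        Finset.sum_comm
    _ = _ := by
        refine Finset.sum_congr rfl fun N _ => ?_
        rw [h2' N, Finset.mul_sum]
        exact Finset.sum_congr rfl fun _ _ => by ring

/-- `V_P → V_M ⊗ V_L → (V_A ⊗ V_B) ⊗ V_L`. -/
def tripleLeft (q : ℝ) (A B L M P : ℕ) :
    Matrix ((Fin (A + 1) × Fin (B + 1)) × Fin (L + 1)) (Fin (P + 1)) ℝ :=
  (cgMat q A B M ⊗ₖ (1 : Matrix (Fin (L + 1)) (Fin (L + 1)) ℝ)) * cgMat q M L P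

/-- `V_P → V_A ⊗ V_M → V_A ⊗ (V_B ⊗ V_L)`. -/
def tripleRight (q : ℝ) (A B L M P : ℕ) :
    Matrix (Fin (A + 1) × Fin (B + 1) × Fin (L + 1)) (Fin (P + 1)) ℝ :=
  ((1 : Matrix (Fin (A + 1)) (Fin (A + 1)) ℝ) ⊗ₖ cgMat q B L M) * cgMat q A M P

omit hq₀ hq₁ in
theorem tripleLeft_apply (A B L M P : ℕ) (i : Fin (A + 1)) (j : Fin (B + 1)) (l : Fin (L + 1))
    (p : Fin (P + 1)) : tripleLeft q A B L M P ((i, j), l) p =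
      ∑ m, cg q A B M i j m * cg q M L P m l p := by
  simp only [tripleLeft, Matrix.mul_apply, Matrix.kroneckerMap_apply, Fintype.sum_prod_type,
    Matrix.one_apply, cgMat, Matrix.of_apply]
  refine Finset.sum_congr rfl fun m _ => ?_
  rw [Finset.sum_eq_single l] <;> simp +contextual [eq_comm]

omit hq₀ hq₁ in
theorem tripleRight_apply (A B L M P : ℕ) (i : Fin (A + 1)) (j : Fin (B + 1)) (l : Fin (L + 1))
    (p : Fin (P + 1)) : tripleRight q A B L M P (i, j, l) p =
      ∑ m, cg q B L M j l m * cg q A M P i m p := by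
  simp only [tripleRight, Matrix.mul_apply, Matrix.kroneckerMap_apply, Fintype.sum_prod_type,
    Matrix.one_apply, cgMat, Matrix.of_apply]
  rw [Finset.sum_eq_single i]
  · simp
  · intro k _ hk; simp [Ne.symm hk]
  · simp

/-- Completeness for `V_M ⊗ V_L` at fixed `M`, then for `V_A ⊗ V_B`. The range of `P` contains every
`P ≤ M + L` with `M ≤ A + B`. -/
theorem sum_tripleLeft (A B L : ℕ) :
    ∑ P ∈ Finset.range (A + B + L + 1), ∑ M ∈ Finset.range (A + B + 1),
      tripleLeft q A B L M P * (tripleLeft q A B L M P)ᵀ = 1 := by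
  rw [Finset.sum_comm]
  have h : ∀ M ∈ Finset.range (A + B + 1), ∑ P ∈ Finset.range (A + B + L + 1),
      tripleLeft q A B L M P * (tripleLeft q A B L M P)ᵀ =
      (cgMat q A B M * (cgMat q A B M)ᵀ) ⊗ₖ (1 : Matrix (Fin (L + 1)) (Fin (L + 1)) ℝ) := by
    intro M hM
    have hM := Finset.mem_range.1 hM
    set X := cgMat q A B M ⊗ₖ (1 : Matrix (Fin (L + 1)) (Fin (L + 1)) ℝ) with hX
    have : ∀ P, tripleLeft q A B L M P * (tripleLeft q A B L M P)ᵀ =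
        X * (cgMat q M L P * (cgMat q M L P)ᵀ) * Xᵀ := fun P => by
      simp only [tripleLeft, Matrix.transpose_mul, Matrix.mul_assoc, hX]
    rw [Finset.sum_congr rfl fun P _ => this P, ← Matrix.sum_mul, ← Matrix.mul_sum,
      sum_cgMat_mul_transpose hq₀ hq₁ M L _ (by omega), Matrix.mul_one, hX,
      ← Matrix.kroneckerMap_transpose, ← Matrix.mul_kronecker_mul, Matrix.transpose_one,
      Matrix.mul_one]
  rw [Finset.sum_congr rfl h]
  have := congrArg (fun Y => Y ⊗ₖ (1 : Matrix (Fin (L + 1)) (Fin (L + 1)) ℝ))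
    (sum_cgMat_mul_transpose hq₀ hq₁ A B (A + B) le_rfl)
  simp only [Matrix.one_kronecker_one] at this
  rw [← this]
  ext x y
  simp [Matrix.sum_apply, Matrix.kroneckerMap_apply, Finset.sum_mul]

theorem sum_tripleRight (A B L : ℕ) :
    ∑ P ∈ Finset.range (A + B + L + 1), ∑ M ∈ Finset.range (B + L + 1),
      tripleRight q A B L M P * (tripleRight q A B L M P)ᵀ = 1 := by
  rw [Finset.sum_comm]
  have h : ∀ M ∈ Finset.range (B + L + 1), ∑ P ∈ Finset.range (A + B + L + 1),
      tripleRight q A B L M P * (tripleRight q A B L M P)ᵀ =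
      (1 : Matrix (Fin (A + 1)) (Fin (A + 1)) ℝ) ⊗ₖ (cgMat q B L M * (cgMat q B L M)ᵀ) := by
    intro M hM
    have hM := Finset.mem_range.1 hM
    set X := (1 : Matrix (Fin (A + 1)) (Fin (A + 1)) ℝ) ⊗ₖ cgMat q B L M with hX
    have : ∀ P, tripleRight q A B L M P * (tripleRight q A B L M P)ᵀ =
        X * (cgMat q A M P * (cgMat q A M P)ᵀ) * Xᵀ := fun P => by
      simp only [tripleRight, Matrix.transpose_mul, Matrix.mul_assoc, hX]
    rw [Finset.sum_congr rfl fun P _ => this P, ← Matrix.sum_mul, ← Matrix.mul_sum,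
      sum_cgMat_mul_transpose hq₀ hq₁ A M _ (by omega), Matrix.mul_one, hX,
      ← Matrix.kroneckerMap_transpose, ← Matrix.mul_kronecker_mul, Matrix.transpose_one,
      Matrix.mul_one]
  rw [Finset.sum_congr rfl h]
  have := congrArg (fun Y => (1 : Matrix (Fin (A + 1)) (Fin (A + 1)) ℝ) ⊗ₖ Y)
    (sum_cgMat_mul_transpose hq₀ hq₁ B L (B + L) le_rfl)
  simp only [Matrix.one_kronecker_one] at this
  rw [← this]
  ext x y
  simp [Matrix.sum_apply, Matrix.kroneckerMap_apply, Finset.mul_sum]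

/-- Associativity of the product of matrix elements, in terms of Clebsch-Gordan coefficients. -/
theorem cg_assoc (A B L P : ℕ) (hP : P ≤ A + B + L) (i i' : Fin (A + 1)) (j j' : Fin (B + 1))
    (l l' : Fin (L + 1)) (p p' : Fin (P + 1)) :
    ∑ M ∈ Finset.range (A + B + 1), (∑ m, cg q A B M i j m * cg q M L P m l p) *
        (∑ m, cg q A B M i' j' m * cg q M L P m l' p') =
      ∑ M ∈ Finset.range (B + L + 1), (∑ m, cg q B L M j l m * cg q A M P i m p) *
        (∑ m, cg q B L M j' l' m * cg q A M P i' m p') := by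
  have h := sum_isotypic_eq hq₀ hq₁ (n := A + B + L + 1) (m := A + B + 1) (m' := B + L + 1)
    (W := ((spin q A).tensor q (spin q B)).tensor q (spin q L))
    (f := fun M P => tripleLeft q A B L M P)
    (g := fun M P => (tripleRight q A B L M P).submatrix (Equiv.prodAssoc _ _ _) id)
    (fun M P => ((isHom_cgMat hq₀ hq₁ A B M).tensor IsHom.one).mul (isHom_cgMat hq₀ hq₁ M L P))
    (fun M P => ((IsHom.one.tensor (isHom_cgMat hq₀ hq₁ B L M)).mul
      (isHom_cgMat hq₀ hq₁ A M P)).assoc hq₀)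
    (sum_tripleLeft hq₀ hq₁ A B L)
    (by
      have := congrArg (fun Y => Y.submatrix (Equiv.prodAssoc _ _ _) (Equiv.prodAssoc _ _ _))
        (sum_tripleRight hq₀ hq₁ A B L)
      rw [Matrix.submatrix_one_equiv] at this
      rw [← this]
      ext x y
      simp [Matrix.sum_apply, Matrix.mul_apply])
    (P := P) (by omega) ((i, j), l) ((i', j'), l') p p'
  simpa only [tripleLeft_apply, Matrix.submatrix_apply, Equiv.prodAssoc_apply, id_eq,
    tripleRight_apply] using h

end

end

end QLorentz

namespace QLorentz

noncomputable section

open Matrix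
open scoped Kronecker

set_option linter.unusedSectionVars false

/-! ### Symmetries of the Clebsch-Gordan coefficients -/

theorem admissible_swap {a b c : ℕ} (h : Admissible a b c) : Admissible b a c := by
  obtain ⟨h0, h1, h2, h3⟩ := h
  exact ⟨by rwa [add_comm b a], by omega, by omega, by omega⟩

theorem admissible_rotate {a b c : ℕ} (h : Admissible a b c) : Admissible c b a := by
  obtain ⟨h0, h1, h2, h3⟩ := h
  exact ⟨by rwa [show c + b + a = a + b + c by ring], by omega, by omega, by omega⟩

theorem cg_of_not_admissible (q : ℝ) {a b c : ℕ} (h : ¬ Admissible a b c) (i : Fin (a + 1))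
    (j : Fin (b + 1)) (k : Fin (c + 1)) : cg q a b c i j k = 0 := by
  simp [cg, h]

theorem spin_wt_rev (q : ℝ) (d : ℕ) (i : Fin (d + 1)) :
    (spin q d).wt i.rev = -(spin q d).wt i := by
  have := i.2
  simp only [spin, Fin.val_rev]; omega

theorem wt_rev (d : ℕ) (i : Fin (d + 1)) : wt d i.rev = -wt d i := by
  rw [wt_eq_spin_wt 0, wt_eq_spin_wt 0, spin_wt_rev]; push_cast; ring

theorem Jminus_rev (q : ℝ) (d : ℕ) (i j : Fin (d + 1)) :
    Jminus q d i.rev j.rev = Jminus q d j i := by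
  have hi := i.2
  have hj := j.2
  by_cases h : (j : ℕ) + 1 = i
  · have e : ((d + 1 - ((j : ℕ) + 1) : ℕ) : ℝ) = d - j := by
      rw [Nat.cast_sub (by omega)]; push_cast; ring
    rw [Jminus_apply_succ q d j i h, Jminus_apply_succ q d _ _ (by simp only [Fin.val_rev]; omega),
      Fin.val_rev, e, ← h, mul_comm]
    push_cast
    congr 3 <;> ring
  · rw [Jminus_apply_of_ne q d j i h, Jminus_apply_of_ne q d _ _
      (by simp only [Fin.val_rev]; omega)]

section

variable {ι κ μ : Type} [Fintype ι] [Fintype κ] [Fintype μ]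
  [DecidableEq ι] [DecidableEq κ] [DecidableEq μ]

theorem tensor_low_mul_apply (q : ℝ) (V : QModule ι) (W : QModule κ) (T : Matrix (ι × κ) μ ℝ)
    (i : ι) (j : κ) (m : μ) :
    ((V.tensor q W).low * T) (i, j) m =
      q ^ (-((V.wt i : ℝ) / 2)) * ∑ k, W.low j k * T (i, k) m +
        q ^ ((W.wt j : ℝ) / 2) * ∑ k, V.low i k * T (k, j) m := by
  simp only [Matrix.mul_apply, QModule.tensor_low_apply, add_mul, Finset.sum_add_distrib,
    Fintype.sum_prod_type, ite_mul, zero_mul]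
  congr 1
  · rw [Finset.sum_eq_single i]
    · simp only [if_true, Finset.mul_sum, mul_assoc]
    · intro k _ hk; simp [Ne.symm hk]
    · simp
  · rw [Finset.mul_sum]
    refine Finset.sum_congr rfl fun i' _ => ?_
    rw [Finset.sum_eq_single j]
    · simp only [if_true]; ring
    · intro k _ hk; simp [Ne.symm hk]
    · simp

theorem tensor_lowT_mul_apply (q : ℝ) (V : QModule ι) (W : QModule κ) (T : Matrix (ι × κ) μ ℝ)
    (i : ι) (j : κ) (m : μ) :
    ((V.tensor q W).lowᵀ * T) (i, j) m =
      q ^ (-((V.wt i : ℝ) / 2)) * ∑ k, W.low k j * T (i, k) m +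
        q ^ ((W.wt j : ℝ) / 2) * ∑ k, V.low k i * T (k, j) m := by
  simp only [Matrix.mul_apply, Matrix.transpose_apply, QModule.tensor_low_apply, add_mul,
    Finset.sum_add_distrib, Fintype.sum_prod_type, ite_mul, zero_mul]
  congr 1
  · rw [Finset.sum_eq_single i]
    · simp only [if_true, Finset.mul_sum, mul_assoc]
    · intro k _ hk; simp [hk]
    · simp
  · rw [Finset.mul_sum]
    refine Finset.sum_congr rfl fun i' _ => ?_
    rw [Finset.sum_eq_single j]
    · simp only [if_true]; ring
    · intro k _ hk; simp [hk]
    · simp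

/-- The coefficients of the duality `V_J ≅ V_J^*`. -/
def dualCoeff (q : ℝ) (J : ℕ) (a : Fin (J + 1)) : ℝ := (-1) ^ (a : ℕ) * q ^ (-wt J a)

/-- The power of `q` cancels and leaves `(-1)^a`, which alternates. -/
theorem dualCoeff_adjacent {q : ℝ} (hq₀ : 0 < q) {J : ℕ} {a b : Fin (J + 1)}
    (h : (a : ℕ) + 1 = b ∨ (b : ℕ) + 1 = a) :
    q ^ (wt J b) * dualCoeff q J b = -(q ^ (wt J a) * dualCoeff q J a) := by
  have e : ∀ c : Fin (J + 1), q ^ (wt J c) * dualCoeff q J c = (-1) ^ (c : ℕ) := fun c => by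
    rw [dualCoeff, mul_left_comm, ← Real.rpow_add hq₀, add_neg_cancel, Real.rpow_zero, mul_one]
  rw [e, e]
  rcases h with h | h <;> rw [← h, pow_succ] <;> ring

/-- Moving the factor `V_J` to the other side of a morphism. -/
theorem isHom_dual {q : ℝ} (hq₀ : 0 < q) {J : ℕ} {V : QModule ι} {W : QModule κ}
    {C : Matrix (ι × Fin (J + 1)) κ ℝ} (hC : IsHom W (V.tensor q (spin q J)) C) :
    IsHom V (W.tensor q (spin q J))
      (Matrix.of fun x m => dualCoeff q J x.2 * C (m, x.2.rev) x.1) := by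
  have hwt : ∀ m b c, C (m, Fin.rev b) c ≠ 0 → V.wt m = W.wt c + (spin q J).wt b := by
    intro m b c h
    have := hC.wt _ _ h
    simp only [QModule.tensor_wt, spin_wt_rev] at this
    linarith
  have key : ∀ (a b : Fin (J + 1)) (m : ι) (c : κ), ((a : ℕ) + 1 = b ∨ (b : ℕ) + 1 = a) →
      q ^ (-((W.wt c : ℝ) / 2)) * (dualCoeff q J b * C (m, b.rev) c) =
        -(q ^ (wt J a) * dualCoeff q J a * (q ^ (-((V.wt m : ℝ) / 2)) * C (m, b.rev) c)) := by
    intro a b m c hab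
    by_cases h : C (m, b.rev) c = 0
    · simp [h]
    · have e : q ^ (-((W.wt c : ℝ) / 2)) = q ^ (wt J b) * q ^ (-((V.wt m : ℝ) / 2)) := by
        rw [← Real.rpow_add hq₀, hwt m b c h, wt_eq_spin_wt q]; congr 1; push_cast; ring
      rw [e]
      linear_combination (q ^ (-((V.wt m : ℝ) / 2)) * C (m, b.rev) c) * dualCoeff_adjacent hq₀ hab
  have hcancel : ∀ a : Fin (J + 1), q ^ (wt J a) * q ^ (wt J a.rev) = 1 := fun a => by
    rw [← Real.rpow_add hq₀, wt_rev, add_neg_cancel, Real.rpow_zero]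
  refine ⟨?_, ?_, ?_⟩
  · rintro ⟨c, a⟩ m h
    simp only [Matrix.of_apply] at h
    rw [hwt m a c (right_ne_zero_of_mul h), QModule.tensor_wt]
  · ext ⟨c, a⟩ m
    -- Dualising `V_J` reverses its weights and exchanges `J_+` with `J_-`, so compatibility with
    -- `J_-` comes from that of `C` with `J_+`, and conversely below.
    have h1 := congrFun (congrFun hC.up (m, a.rev)) c
    rw [tensor_lowT_mul_apply, Matrix.mul_apply, ← wt_eq_spin_wt] at h1
    simp only [Matrix.transpose_apply] at h1
    have h2 : ∑ k, (spin q J).low k a.rev * C (m, k) c =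
        ∑ b : Fin (J + 1), (spin q J).low a b * C (m, b.rev) c := by
      rw [← Equiv.sum_comp Fin.revPerm]
      refine Finset.sum_congr rfl fun b _ => ?_
      simp only [Fin.revPerm_apply, spin, Jminus_rev]
    rw [h2] at h1
    rw [tensor_low_mul_apply, Matrix.mul_apply, ← wt_eq_spin_wt]
    simp only [Matrix.of_apply]
    have h3 : ∑ k, W.low c k * (dualCoeff q J a * C (m, a.rev) k) =
        dualCoeff q J a * ∑ j, C (m, a.rev) j * W.low c j := by
      rw [Finset.mul_sum]; exact Finset.sum_congr rfl fun _ _ => by ring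
    have h4 : q ^ (-((W.wt c : ℝ) / 2)) *
        ∑ k, (spin q J).low a k * (dualCoeff q J k * C (m, k.rev) c) =
        -(q ^ (wt J a) * dualCoeff q J a * (q ^ (-((V.wt m : ℝ) / 2)) *
          ∑ b : Fin (J + 1), (spin q J).low a b * C (m, b.rev) c)) := by
      simp only [Finset.mul_sum, ← Finset.sum_neg_distrib]
      refine Finset.sum_congr rfl fun b _ => ?_
      by_cases hab : (a : ℕ) + 1 = b
      · linear_combination (spin q J).low a b * key a b m c (Or.inl hab)
      · have : (spin q J).low a b = 0 := Jminus_apply_of_ne q J a b hab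
        simp [this]
    have h5 : ∑ j, dualCoeff q J a * C (j, a.rev) c * V.low j m =
        dualCoeff q J a * ∑ k, V.low k m * C (k, a.rev) c := by
      rw [Finset.mul_sum]; exact Finset.sum_congr rfl fun _ _ => by ring
    rw [h3, h4, h5, h1]
    linear_combination (-(dualCoeff q J a * ∑ k, V.low k m * C (k, a.rev) c)) * hcancel a
  · ext ⟨c, a⟩ m
    have h1 := congrFun (congrFun hC.low (m, a.rev)) c
    rw [tensor_low_mul_apply, Matrix.mul_apply, ← wt_eq_spin_wt] at h1
    have h2 : ∑ k, (spin q J).low a.rev k * C (m, k) c =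
        ∑ b : Fin (J + 1), (spin q J).low b a * C (m, b.rev) c := by
      rw [← Equiv.sum_comp Fin.revPerm]
      refine Finset.sum_congr rfl fun b _ => ?_
      simp only [Fin.revPerm_apply, spin, Jminus_rev]
    rw [h2] at h1
    rw [tensor_lowT_mul_apply, Matrix.mul_apply, ← wt_eq_spin_wt]
    simp only [Matrix.of_apply, Matrix.transpose_apply]
    have h3 : ∑ k, W.low k c * (dualCoeff q J a * C (m, a.rev) k) =
        dualCoeff q J a * ∑ j, C (m, a.rev) j * W.low j c := by
      rw [Finset.mul_sum]; exact Finset.sum_congr rfl fun _ _ => by ring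
    have h4 : q ^ (-((W.wt c : ℝ) / 2)) *
        ∑ k, (spin q J).low k a * (dualCoeff q J k * C (m, k.rev) c) =
        -(q ^ (wt J a) * dualCoeff q J a * (q ^ (-((V.wt m : ℝ) / 2)) *
          ∑ b : Fin (J + 1), (spin q J).low b a * C (m, b.rev) c)) := by
      simp only [Finset.mul_sum, ← Finset.sum_neg_distrib]
      refine Finset.sum_congr rfl fun b _ => ?_
      by_cases hab : (b : ℕ) + 1 = a
      · linear_combination (spin q J).low b a * key a b m c (Or.inr hab)
      · have : (spin q J).low b a = 0 := Jminus_apply_of_ne q J b a hab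
        simp [this]
    have h5 : ∑ j, dualCoeff q J a * C (j, a.rev) c * V.low m j =
        dualCoeff q J a * ∑ k, V.low m k * C (k, a.rev) c := by
      rw [Finset.mul_sum]; exact Finset.sum_congr rfl fun _ _ => by ring
    rw [h3, h4, h5, h1]
    linear_combination (-(dualCoeff q J a * ∑ k, V.low m k * C (k, a.rev) c)) * hcancel a

end

section

variable {q : ℝ} (hq₀ : 0 < q) (hq₁ : q < 1)
include hq₀ hq₁

theorem cg_wt {a b c : ℕ} {i : Fin (a + 1)} {j : Fin (b + 1)} {k : Fin (c + 1)}
    (h : cg q a b c i j k ≠ 0) : wt a i + wt b j = wt c k := by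
  have := (isHom_cgMat hq₀ hq₁ a b c).wt (i, j) k h
  rw [wt_eq_spin_wt q, wt_eq_spin_wt q, wt_eq_spin_wt q, ← this, QModule.tensor_wt]
  push_cast; ring

theorem cg_val {a b c : ℕ} {i : Fin (a + 1)} {j : Fin (b + 1)} {k : Fin (c + 1)}
    (h : cg q a b c i j k ≠ 0) : 2 * ((i : ℤ) + j - k) = (a : ℤ) + b - c := by
  have := (isHom_cgMat hq₀ hq₁ a b c).wt (i, j) k h
  simp only [QModule.tensor_wt, spin] at this
  linarith

theorem sum_cg_mul_self {a b c : ℕ} (h : Admissible a b c) (k k' : Fin (c + 1)) :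
    ∑ i, ∑ j, cg q a b c i j k * cg q a b c i j k' = if k = k' then 1 else 0 := by
  have := congrFun (congrFun (cgMat_transpose_mul_self hq₀ hq₁ h) k) k'
  rwa [Matrix.mul_apply, Fintype.sum_prod_type, Matrix.one_apply] at this

theorem sum_cg_mul_of_ne (a b : ℕ) {c c' : ℕ} (h : c ≠ c') (k : Fin (c + 1)) (k' : Fin (c' + 1)) :
    ∑ i, ∑ j, cg q a b c i j k * cg q a b c' i j k' = 0 := by
  have := congrFun (congrFun (cgMat_transpose_mul_of_ne hq₀ hq₁ a b h) k) k'
  rwa [Matrix.mul_apply, Fintype.sum_prod_type] at this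

theorem abs_cg_le_one (a b c : ℕ) (i : Fin (a + 1)) (j : Fin (b + 1)) (k : Fin (c + 1)) :
    |cg q a b c i j k| ≤ 1 := by
  by_cases h : Admissible a b c
  · rw [← sq_le_one_iff_abs_le_one]
    have h1 := sum_cg_mul_self hq₀ hq₁ h k k
    rw [if_pos rfl] at h1
    rw [← h1, sq]
    calc cg q a b c i j k * cg q a b c i j k ≤ ∑ j, cg q a b c i j k * cg q a b c i j k :=
          Finset.single_le_sum (f := fun j => cg q a b c i j k * cg q a b c i j k)
            (fun j _ => mul_self_nonneg _) (Finset.mem_univ j)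
      _ ≤ _ := Finset.single_le_sum (f := fun i => ∑ j, cg q a b c i j k * cg q a b c i j k)
            (fun i _ => Finset.sum_nonneg fun j _ => mul_self_nonneg _) (Finset.mem_univ i)
  · simp [cg_of_not_admissible q h]

/-- Exchanging the factors replaces `Δ` by the opposite coproduct; reversing the weights exchanges
`J_±` and inverts `q^{J_z}`. Together they restore `Δ`. -/
theorem isHom_flip (a b c : ℕ) :
    IsHom (spin q c) ((spin q b).tensor q (spin q a))
      (Matrix.of fun x k => cg q a b c x.2.rev x.1.rev k.rev) := by
  have hh := isHom_cgMat hq₀ hq₁ a b c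
  refine ⟨?_, ?_, ?_⟩
  · rintro ⟨j, i⟩ k h
    have := hh.wt (i.rev, j.rev) k.rev h
    simp only [QModule.tensor_wt, spin_wt_rev] at this ⊢
    linarith
  · ext ⟨j, i⟩ k
    have h1 := congrFun (congrFun hh.up (i.rev, j.rev)) k.rev
    rw [tensor_lowT_mul_apply, Matrix.mul_apply, ← Equiv.sum_comp Fin.revPerm,
      ← Equiv.sum_comp Fin.revPerm (fun k => (spin q b).low k _ * _),
      ← Equiv.sum_comp Fin.revPerm (fun k => (spin q a).low k _ * _)] at h1
    rw [tensor_low_mul_apply, Matrix.mul_apply]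
    simp only [Fin.revPerm_apply, Matrix.transpose_apply, spin_wt_rev, Matrix.of_apply] at h1 ⊢
    simp only [spin, Jminus_rev, cgMat, Matrix.of_apply] at h1 ⊢
    rw [h1, add_comm]
    push_cast
    congr 3 <;> ring
  · ext ⟨j, i⟩ k
    have h1 := congrFun (congrFun hh.low (i.rev, j.rev)) k.rev
    rw [tensor_low_mul_apply, Matrix.mul_apply, ← Equiv.sum_comp Fin.revPerm,
      ← Equiv.sum_comp Fin.revPerm (fun k => (spin q b).low _ k * _),
      ← Equiv.sum_comp Fin.revPerm (fun k => (spin q a).low _ k * _)] at h1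
    rw [tensor_lowT_mul_apply, Matrix.mul_apply]
    simp only [Fin.revPerm_apply, Matrix.transpose_apply, spin_wt_rev, Matrix.of_apply] at h1 ⊢
    simp only [spin, Jminus_rev, cgMat, Matrix.of_apply] at h1 ⊢
    rw [h1, add_comm]
    push_cast
    congr 3 <;> ring

/-- Exchange of the two factors of a tensor product together with reversal of the weights. -/
theorem exists_cg_flip (a b c : ℕ) : ∃ σ : ℝ, σ * σ = 1 ∧ ∀ i j k,
    cg q a b c i j k = σ * cg q b a c j.rev i.rev k.rev := by
  by_cases h : Admissible a b c
  · obtain ⟨r, hr⟩ := (isHom_flip hq₀ hq₁ a b c).eq_smul_cgMat hq₀ hq₁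
    have hr' : ∀ i j k, cg q a b c i j k = r * cg q b a c j.rev i.rev k.rev := fun i j k => by
      have := congrFun (congrFun hr (j.rev, i.rev)) k.rev
      simpa [cgMat] using this
    refine ⟨r, ?_, hr'⟩
    have h1 := sum_cg_mul_self hq₀ hq₁ h (Fin.last c) (Fin.last c)
    have h2 := sum_cg_mul_self hq₀ hq₁ (admissible_swap h) (Fin.last c).rev (Fin.last c).rev
    rw [if_pos rfl] at h1 h2
    rw [Finset.sum_comm, ← Equiv.sum_comp Fin.revPerm] at h2
    simp_rw [← Equiv.sum_comp Fin.revPerm (fun j : Fin (b + 1) => cg q b a c j _ _ * _)] at h2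
    simp only [Fin.revPerm_apply] at h2
    simp only [hr' _ _ (Fin.last c)] at h1
    rw [← h1, ← mul_one (r * r), ← h2, Finset.mul_sum]
    refine Finset.sum_congr rfl fun i _ => ?_
    rw [Finset.mul_sum]
    exact Finset.sum_congr rfl fun j _ => by ring
  · exact ⟨1, by norm_num, fun i j k => by
      rw [cg_of_not_admissible q h, cg_of_not_admissible q fun h' => h (admissible_swap h'),
        mul_zero]⟩

/-- The sign of `exists_cg_flip` never has to be determined: only products of two coefficients with
the same spins are used. -/
theorem cg_flip_mul (a b c : ℕ) (i i' : Fin (a + 1)) (j j' : Fin (b + 1)) (k k' : Fin (c + 1)) :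
    cg q a b c i j k * cg q a b c i' j' k' =
      cg q b a c j.rev i.rev k.rev * cg q b a c j'.rev i'.rev k'.rev := by
  obtain ⟨σ, h1, h2⟩ := exists_cg_flip hq₀ hq₁ a b c
  rw [h2 i j k, h2 i' j' k']
  linear_combination (cg q b a c j.rev i.rev k.rev * cg q b a c j'.rev i'.rev k'.rev) * h1

theorem cg_flip_mul' (a b c : ℕ) (i : Fin (a + 1)) (j : Fin (b + 1)) (k k' : Fin (c + 1))
    (i' : Fin (b + 1)) (j' : Fin (a + 1)) :
    cg q a b c i j k * cg q b a c i' j' k' =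
      cg q b a c j.rev i.rev k.rev * cg q a b c j'.rev i'.rev k'.rev := by
  obtain ⟨σ, h1, h2⟩ := exists_cg_flip hq₀ hq₁ a b c
  rw [h2 i j k, h2 j'.rev i'.rev k'.rev]
  simp only [Fin.rev_rev]; ring

theorem sum_rpow_wt' (d : ℕ) :
    ∑ i : Fin (d + 1), q ^ (2 * wt d i) = qnum q ((d : ℝ) + 1) := by
  rw [← sum_rpow_wt hq₀ hq₁, ← Equiv.sum_comp Fin.revPerm]
  refine Finset.sum_congr rfl fun i _ => ?_
  rw [Fin.revPerm_apply, wt_rev, mul_neg]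

/-- Moving `V_J` across by `isHom_dual` gives a morphism, hence `τ` times a Clebsch-Gordan matrix.
Only `τ²` is needed, and it is a ratio of `q`-dimensions. -/
theorem cg_dual_mul (N J M : ℕ) (c n : Fin (N + 1)) (a s : Fin (J + 1)) (m r : Fin (M + 1)) :
    qnum q ((N : ℝ) + 1) * (cg q N J M c a m * cg q N J M n s r) =
      qnum q ((M : ℝ) + 1) * (dualCoeff q J a * dualCoeff q J s *
        (cg q M J N m a.rev c * cg q M J N r s.rev n)) := by
  by_cases h : Admissible N J M
  · obtain ⟨τ, hτ⟩ := (isHom_dual hq₀ (isHom_cgMat hq₀ hq₁ M J N)).eq_smul_cgMat hq₀ hq₁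
    have ht : ∀ c a m, dualCoeff q J a * cg q M J N m a.rev c = τ * cg q N J M c a m :=
      fun c a m => congrFun (congrFun hτ (c, a)) m
    -- A `q`-trace computed in two ways: `∑ q^{2c} (C^{MJ}_N)²` gives `[N+1]` when summed first over
    -- `V_M ⊗ V_J`, and `τ²[M+1]` when summed first over `V_N ⊗ V_J`.
    have hsq : τ ^ 2 * qnum q ((M : ℝ) + 1) = qnum q ((N : ℝ) + 1) := by
      rw [← sum_rpow_wt' hq₀ hq₁ M, ← sum_rpow_wt' hq₀ hq₁ N, Finset.mul_sum]
      have h1 : ∀ m : Fin (M + 1), τ ^ 2 * q ^ (2 * wt M m) =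
          ∑ c : Fin (N + 1), ∑ a : Fin (J + 1), q ^ (2 * wt N c) *
            (cg q M J N m a.rev c * cg q M J N m a.rev c) := by
        intro m
        have h2 := sum_cg_mul_self hq₀ hq₁ h m m
        rw [if_pos rfl] at h2
        rw [← mul_one (τ ^ 2 * _), ← h2, Finset.mul_sum]
        refine Finset.sum_congr rfl fun c _ => ?_
        rw [Finset.mul_sum]
        refine Finset.sum_congr rfl fun a _ => ?_
        have h3 := ht c a m
        by_cases hz : cg q M J N m a.rev c = 0
        · rw [hz, mul_zero] at h3
          rw [hz]
          linear_combination (-τ * q ^ (2 * wt M m) * cg q N J M c a m) * h3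
        · have hw := cg_wt hq₀ hq₁ hz
          rw [wt_rev] at hw
          have e : q ^ (2 * wt N c) = q ^ (2 * wt M m) * (dualCoeff q J a * dualCoeff q J a) := by
            rw [dualCoeff, mul_mul_mul_comm, ← mul_pow, ← Real.rpow_add hq₀]
            simp only [mul_neg, one_mul, neg_neg, mul_one, one_pow]
            rw [← Real.rpow_add hq₀]; congr 1; linarith
          rw [e]
          linear_combination (-q ^ (2 * wt M m) * τ * cg q N J M c a m -
            q ^ (2 * wt M m) * dualCoeff q J a * cg q M J N m a.rev c) * h3
      rw [Finset.sum_congr rfl fun m _ => h1 m, Finset.sum_comm]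
      refine Finset.sum_congr rfl fun c _ => ?_
      have h4 := sum_cg_mul_self hq₀ hq₁ (admissible_rotate h) c c
      rw [if_pos rfl] at h4
      conv_rhs => rw [← mul_one (q ^ (2 * wt N c)), ← h4, Finset.mul_sum]
      refine Finset.sum_congr rfl fun m _ => ?_
      rw [Finset.mul_sum, ← Equiv.sum_comp Fin.revPerm]
      simp only [Fin.revPerm_apply, Fin.rev_rev]
    linear_combination (-(cg q N J M c a m * cg q N J M n s r)) * hsq -
      qnum q ((M : ℝ) + 1) * (dualCoeff q J s * cg q M J N r s.rev n) * ht c a m -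
      qnum q ((M : ℝ) + 1) * (τ * cg q N J M c a m) * ht n s r
  · rw [cg_of_not_admissible q h,
      cg_of_not_admissible q (a := M) (fun h' => h (admissible_rotate h'))]
    ring

end

end

end QLorentz

namespace QLorentz

noncomputable section

set_option linter.unusedSectionVars false

/-! ### The algebra `F_q(SU(2))` -/

/-- The vector space `F_q(SU(2))` with basis `u_I^m_n`. -/
abbrev FqSU2 : Type := MatIdx →₀ ℂ

/-- The matrix element `u_I^m_n`. -/
def uElt (B : MatIdx) : FqSU2 := Finsupp.single B 1

/-- The labels of the matrix elements of spin at most `n / 2`. -/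
def idxLE (n : ℕ) : Finset MatIdx := (Finset.range (n + 1)).sigma fun _ => Finset.univ

/-- The structure constants of `F_q(SU(2))`. -/
def structConst (q : ℝ) (A B C : MatIdx) : ℝ :=
  cg q A.1 B.1 C.1 A.2.1 B.2.1 C.2.1 * cg q A.1 B.1 C.1 A.2.2 B.2.2 C.2.2

theorem mem_idxLE {n : ℕ} {B : MatIdx} : B ∈ idxLE n ↔ B.1 ≤ n := by
  simp [idxLE]

theorem sum_idxLE {E : Type*} [AddCommMonoid E] (n : ℕ) (f : MatIdx → E) :
    ∑ B ∈ idxLE n, f B = ∑ M ∈ Finset.range (n + 1), ∑ m, ∑ r, f ⟨M, m, r⟩ := by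
  rw [idxLE, Finset.sum_sigma]
  exact Finset.sum_congr rfl fun M _ => Fintype.sum_prod_type _

theorem structConst_eq_zero (q : ℝ) {A B C : MatIdx} (h : A.1 + B.1 < C.1) :
    structConst q A B C = 0 := by
  rw [structConst, cg_of_not_admissible, zero_mul]
  exact fun h' => absurd h'.2.1 (not_le.2 h)

theorem sum_structConst {E : Type*} [AddCommGroup E] [Module ℂ E] (q : ℝ) (A B : MatIdx) {n : ℕ}
    (hn : A.1 + B.1 ≤ n) (f : MatIdx → E) :
    ∑ C ∈ idxLE (A.1 + B.1), (structConst q A B C : ℂ) • f C =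
      ∑ C ∈ idxLE n, (structConst q A B C : ℂ) • f C := by
  refine Finset.sum_subset (fun C hC => mem_idxLE.2 ((mem_idxLE.1 hC).trans hn)) fun C _ hC => ?_
  rw [structConst_eq_zero q (not_le.1 fun h => hC (mem_idxLE.2 h))]
  simp

/-- The product of `F_q(SU(2))`. -/
def mulF (q : ℝ) : FqSU2 →ₗ[ℂ] FqSU2 →ₗ[ℂ] FqSU2 :=
  Finsupp.linearCombination ℂ fun A => Finsupp.linearCombination ℂ fun B =>
    ∑ C ∈ idxLE (A.1 + B.1), (structConst q A B C : ℂ) • uElt C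

theorem mulF_uElt (q : ℝ) (A B : MatIdx) :
    mulF q (uElt A) (uElt B) = ∑ C ∈ idxLE (A.1 + B.1), (structConst q A B C : ℂ) • uElt C := by
  simp [mulF, uElt, Finsupp.linearCombination_single]

theorem linearMap_ext_uElt {E : Type*} [AddCommGroup E] [Module ℂ E] {f g : FqSU2 →ₗ[ℂ] E}
    (h : ∀ B, f (uElt B) = g (uElt B)) : f = g :=
  Finsupp.lhom_ext' fun B => LinearMap.ext_ring (h B)

section

variable {q : ℝ} (hq₀ : 0 < q) (hq₁ : q < 1)
include hq₀ hq₁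

/-- Upper and lower indices recouple independently except for the common intermediate spin `M`; this
is why `cg_assoc` sums a product of two recouplings over `M`. -/
theorem structConst_assoc (A B L P : MatIdx) (hP : P.1 ≤ A.1 + B.1 + L.1) :
    ∑ M ∈ idxLE (A.1 + B.1), structConst q A B M * structConst q M L P =
      ∑ M ∈ idxLE (B.1 + L.1), structConst q B L M * structConst q A M P := by
  rw [sum_idxLE, sum_idxLE]
  refine Eq.trans (Finset.sum_congr rfl fun M _ => ?_)
    ((cg_assoc hq₀ hq₁ A.1 B.1 L.1 P.1 hP A.2.1 A.2.2 B.2.1 B.2.2 L.2.1 L.2.2 P.2.1 P.2.2).trans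
      (Finset.sum_congr rfl fun M _ => ?_))
  · rw [Finset.sum_mul_sum]
    exact Finset.sum_congr rfl fun m _ => Finset.sum_congr rfl fun r _ => by
      simp only [structConst]; ring
  · rw [Finset.sum_mul_sum]
    exact Finset.sum_congr rfl fun m _ => Finset.sum_congr rfl fun r _ => by
      simp only [structConst]; ring

theorem mulF_assoc (x y z : FqSU2) : mulF q (mulF q x y) z = mulF q x (mulF q y z) := by
  have h : ∀ A B L, mulF q (mulF q (uElt A) (uElt B)) (uElt L) =
      mulF q (uElt A) (mulF q (uElt B) (uElt L)) := by
    intro A B L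
    rw [mulF_uElt, mulF_uElt]
    simp only [map_sum, map_smul, LinearMap.sum_apply, LinearMap.smul_apply, mulF_uElt]
    have h1 : ∀ M ∈ idxLE (A.1 + B.1), (structConst q A B M : ℂ) • ∑ C ∈ idxLE (M.1 + L.1),
        (structConst q M L C : ℂ) • uElt C = ∑ C ∈ idxLE (A.1 + B.1 + L.1),
        ((structConst q A B M * structConst q M L C : ℝ) : ℂ) • uElt C := by
      intro M hM
      have hM := mem_idxLE.1 hM
      rw [sum_structConst q M L (n := A.1 + B.1 + L.1) (by omega), Finset.smul_sum]
      exact Finset.sum_congr rfl fun C _ => by rw [smul_smul, Complex.ofReal_mul]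
    have h2 : ∀ M ∈ idxLE (B.1 + L.1), (structConst q B L M : ℂ) • ∑ C ∈ idxLE (A.1 + M.1),
        (structConst q A M C : ℂ) • uElt C = ∑ C ∈ idxLE (A.1 + B.1 + L.1),
        ((structConst q B L M * structConst q A M C : ℝ) : ℂ) • uElt C := by
      intro M hM
      have hM := mem_idxLE.1 hM
      rw [sum_structConst q A M (n := A.1 + B.1 + L.1) (by omega), Finset.smul_sum]
      exact Finset.sum_congr rfl fun C _ => by rw [smul_smul, Complex.ofReal_mul]
    rw [Finset.sum_congr rfl h1, Finset.sum_congr rfl h2, Finset.sum_comm,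
      Finset.sum_comm (s := idxLE (B.1 + L.1))]
    refine Finset.sum_congr rfl fun C hC => ?_
    rw [← Finset.sum_smul, ← Finset.sum_smul, ← Complex.ofReal_sum, ← Complex.ofReal_sum,
      structConst_assoc hq₀ hq₁ A B L C (mem_idxLE.1 hC)]
  -- Linear extension from basis elements, one argument at a time.
  have h1 : ∀ A B, mulF q (mulF q (uElt A) (uElt B)) = mulF q (uElt A) ∘ₗ mulF q (uElt B) :=
    fun A B => linearMap_ext_uElt (h A B)
  have h2 : ∀ A, ((mulF q).flip z) ∘ₗ mulF q (uElt A) = mulF q (uElt A) ∘ₗ (mulF q).flip z :=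
    fun A => linearMap_ext_uElt fun B => LinearMap.congr_fun (h1 A B) z
  have h3 : (mulF q).flip z ∘ₗ (mulF q).flip y = (mulF q).flip (mulF q y z) :=
    linearMap_ext_uElt fun A => LinearMap.congr_fun (h2 A) y
  exact LinearMap.congr_fun h3 x

/-- Contraction of an expansion in Clebsch-Gordan coefficients. -/
theorem sum_cg_smul_expansion {E : Type*} [AddCommGroup E] [Module ℂ E] {a b c : ℕ}
    (h : Admissible a b c) {s : Finset ℕ} (hc : c ∈ s) (W : ∀ M : ℕ, Fin (M + 1) → E)
    (k : Fin (c + 1)) :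
    ∑ i, ∑ j, (cg q a b c i j k : ℂ) • ∑ M ∈ s, ∑ r, (cg q a b M i j r : ℂ) • W M r = W c k := by
  have h1 : ∑ x : Fin (a + 1) × Fin (b + 1), (cg q a b c x.1 x.2 k : ℂ) •
      ∑ M ∈ s, ∑ r, (cg q a b M x.1 x.2 r : ℂ) • W M r = ∑ M ∈ s, ∑ r,
        ((∑ i, ∑ j, cg q a b c i j k * cg q a b M i j r : ℝ) : ℂ) • W M r := by
    simp only [Finset.smul_sum, smul_smul]
    rw [Finset.sum_comm]
    refine Finset.sum_congr rfl fun M _ => ?_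
    rw [Finset.sum_comm]
    refine Finset.sum_congr rfl fun r _ => ?_
    rw [← Finset.sum_smul, Fintype.sum_prod_type]
    push_cast
    rfl
  rw [← Fintype.sum_prod_type' (f := fun i j => (cg q a b c i j k : ℂ) •
      ∑ M ∈ s, ∑ r, (cg q a b M i j r : ℂ) • W M r), h1, Finset.sum_eq_single c]
  · simp only [sum_cg_mul_self hq₀ hq₁ h]
    simp
  · intro M _ hM
    simp only [sum_cg_mul_of_ne hq₀ hq₁ a b hM.symm]
    simp
  · intro hn; exact absurd hc hn

/-- Orthogonality of the Clebsch-Gordan coefficients, for bilinear expressions. -/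
theorem sum_cg_bilin {E E' E'' : Type*} [AddCommGroup E] [Module ℂ E] [AddCommGroup E']
    [Module ℂ E'] [AddCommGroup E''] [Module ℂ E''] (β : E →ₗ[ℂ] E' →ₗ[ℂ] E'') (a b : ℕ)
    (s : Finset ℕ) (Z : ∀ M : ℕ, Fin (M + 1) → E) (W : ∀ M : ℕ, Fin (M + 1) → E')
    (hZ : ∀ M r, ¬ Admissible a b M → Z M r = 0) :
    ∑ i, ∑ j, β (∑ M ∈ s, ∑ r, (cg q a b M i j r : ℂ) • Z M r)
      (∑ M ∈ s, ∑ r, (cg q a b M i j r : ℂ) • W M r) = ∑ M ∈ s, ∑ r, β (Z M r) (W M r) := by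
  rw [← Fintype.sum_prod_type' (f := fun i j => β (∑ M ∈ s, ∑ r, (cg q a b M i j r : ℂ) • Z M r)
      (∑ M ∈ s, ∑ r, (cg q a b M i j r : ℂ) • W M r))]
  have h1 : ∀ x : Fin (a + 1) × Fin (b + 1),
      β (∑ M ∈ s, ∑ r, (cg q a b M x.1 x.2 r : ℂ) • Z M r)
        (∑ M ∈ s, ∑ r, (cg q a b M x.1 x.2 r : ℂ) • W M r) =
      ∑ M ∈ s, ∑ r, β (Z M r) ((cg q a b M x.1 x.2 r : ℂ) •
        ∑ M ∈ s, ∑ r, (cg q a b M x.1 x.2 r : ℂ) • W M r) := fun x => by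
    rw [map_sum β, LinearMap.sum_apply]
    refine Finset.sum_congr rfl fun M _ => ?_
    rw [map_sum β, LinearMap.sum_apply]
    exact Finset.sum_congr rfl fun r _ => by rw [map_smul, LinearMap.smul_apply, map_smul]
  rw [Finset.sum_congr rfl fun x _ => h1 x, Finset.sum_comm]
  refine Finset.sum_congr rfl fun M hM => ?_
  rw [Finset.sum_comm]
  refine Finset.sum_congr rfl fun r _ => ?_
  by_cases h : Admissible a b M
  · rw [← map_sum, Fintype.sum_prod_type, sum_cg_smul_expansion hq₀ hq₁ h hM]
  · simp [hZ M r h]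

end

/-! ### The principal representations on `F_q(SU(2))` -/

/-- The character `u_J^s_s ↦ q^{ips}`. -/
def phase (q p x : ℝ) : ℂ := (q : ℂ) ^ (Complex.I * (p : ℂ) * (x : ℂ))

theorem phase_add {q : ℝ} (hq₀ : 0 < q) (p x y : ℝ) :
    phase q p (x + y) = phase q p x * phase q p y := by
  rw [phase, phase, phase, ← Complex.cpow_add _ _ (by exact_mod_cast hq₀.ne')]
  congr 1; push_cast; ring

/-- The action `f ↦ ∑_s q^{ips} u_J^b_s f (u_J^a_s)^*` of `u_J^a_b` on `F_q(SU(2))`. -/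
def theta (q p : ℝ) (B : MatIdx) : FqSU2 →ₗ[ℂ] FqSU2 :=
  ∑ s : Fin (B.1 + 1),
    (phase q p (wt B.1 s) * ((dualCoeff q B.1 B.2.1 * dualCoeff q B.1 s : ℝ) : ℂ)) •
      ((mulF q).flip (uElt ⟨B.1, B.2.1.rev, s.rev⟩) ∘ₗ mulF q (uElt ⟨B.1, B.2.2, s⟩))

theorem theta_apply (q p : ℝ) (B : MatIdx) (f : FqSU2) :
    theta q p B f = ∑ s : Fin (B.1 + 1),
      (phase q p (wt B.1 s) * ((dualCoeff q B.1 B.2.1 * dualCoeff q B.1 s : ℝ) : ℂ)) •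
        mulF q (mulF q (uElt ⟨B.1, B.2.2, s⟩) f) (uElt ⟨B.1, B.2.1.rev, s.rev⟩) := by
  simp [theta, LinearMap.sum_apply]

section

variable {q : ℝ} (hq₀ : 0 < q) (hq₁ : q < 1)
include hq₀ hq₁

/-- The factors in `(u_J^a_s)^*` are compatible with products: the `*`-operation is
antimultiplicative on matrix elements. -/
theorem dualCoeff_mul {A B M : ℕ} {i s : Fin (A + 1)} {k t : Fin (B + 1)} {d r : Fin (M + 1)}
    (h1 : cg q A B M i k d ≠ 0) (h2 : cg q A B M s t r ≠ 0) :
    dualCoeff q A i * dualCoeff q A s * (dualCoeff q B k * dualCoeff q B t) =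
      dualCoeff q M d * dualCoeff q M r := by
  have w1 := cg_wt hq₀ hq₁ h1
  have w2 := cg_wt hq₀ hq₁ h2
  have v1 := cg_val hq₀ hq₁ h1
  have v2 := cg_val hq₀ hq₁ h2
  -- Both `i + k - d` and `s + t - r` equal `(A+B-M)/2`, so the exponents differ by an even number.
  have hs : ((-1 : ℝ)) ^ ((i : ℕ) + s + (k + t)) = (-1) ^ ((d : ℕ) + r) := by
    rw [neg_one_pow_eq_pow_mod_two, neg_one_pow_eq_pow_mod_two (n := (d : ℕ) + r)]
    congr 1; omega
  simp only [dualCoeff]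
  have hd : q ^ (-wt M d) = q ^ (-wt A i) * q ^ (-wt B k) := by
    rw [← Real.rpow_add hq₀, ← w1]; congr 1; ring
  have hr : q ^ (-wt M r) = q ^ (-wt A s) * q ^ (-wt B t) := by
    rw [← Real.rpow_add hq₀, ← w2]; congr 1; ring
  rw [hd, hr]
  simp only [pow_add] at hs
  linear_combination (q ^ (-wt A i) * q ^ (-wt B k) * q ^ (-wt A s) * q ^ (-wt B t)) * hs

/-- In `u^j_s (u^l_t f (u^k_t)^*) (u^i_s)^*` the two left factors and the two right factors are
multiplied out. Both products carry the same coefficients `s ⊗ t → r`, the right one after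
`cg_flip_mul` has undone the reversed order. The phase depends on `s + t = r` only, so orthogonality
in `s, t` leaves one sum over `r`. -/
theorem theta_comp (p : ℝ) (A B : MatIdx) :
    theta q p A ∘ₗ theta q p B =
      ∑ C ∈ idxLE (A.1 + B.1), (structConst q A B C : ℂ) • theta q p C := by
  obtain ⟨A, i, j⟩ := A
  obtain ⟨B, k, l⟩ := B
  refine LinearMap.ext fun f => ?_
  set Z : ∀ M : ℕ, Fin (M + 1) → FqSU2 := fun M r =>
    ∑ m, (phase q p (wt M r) * (cg q A B M j l m : ℂ)) • uElt ⟨M, m, r⟩ with hZ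
  set W : ∀ M : ℕ, Fin (M + 1) → FqSU2 := fun M r =>
    ∑ d, ((cg q A B M i k d * (dualCoeff q M d * dualCoeff q M r) : ℝ) : ℂ) •
      uElt ⟨M, d.rev, r.rev⟩ with hW
  have hX : ∀ (s : Fin (A + 1)) (t : Fin (B + 1)),
      (phase q p (wt A s) * phase q p (wt B t)) • mulF q (uElt ⟨A, j, s⟩) (uElt ⟨B, l, t⟩) =
      ∑ M ∈ Finset.range (A + B + 1), ∑ r, (cg q A B M s t r : ℂ) • Z M r := by
    intro s t
    rw [mulF_uElt, sum_idxLE, Finset.smul_sum]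
    refine Finset.sum_congr rfl fun M _ => ?_
    rw [Finset.sum_comm, Finset.smul_sum]
    refine Finset.sum_congr rfl fun r _ => ?_
    rw [hZ, Finset.smul_sum, Finset.smul_sum]
    refine Finset.sum_congr rfl fun m _ => ?_
    rw [smul_smul, smul_smul]
    congr 1
    simp only [structConst]
    by_cases h : cg q A B M s t r = 0
    · simp [h]
    · rw [← cg_wt hq₀ hq₁ h, phase_add hq₀]; push_cast; ring
  have hY : ∀ (s : Fin (A + 1)) (t : Fin (B + 1)),
      ((dualCoeff q A i * dualCoeff q A s * (dualCoeff q B k * dualCoeff q B t) : ℝ) : ℂ) •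
        mulF q (uElt ⟨B, k.rev, t.rev⟩) (uElt ⟨A, i.rev, s.rev⟩) =
      ∑ M ∈ Finset.range (A + B + 1), ∑ r, (cg q A B M s t r : ℂ) • W M r := by
    intro s t
    rw [mulF_uElt, sum_idxLE, Finset.smul_sum, show B + A = A + B from add_comm _ _]
    refine Finset.sum_congr rfl fun M _ => ?_
    rw [Finset.sum_comm, Finset.smul_sum, ← Equiv.sum_comp Fin.revPerm]
    refine Finset.sum_congr rfl fun r _ => ?_
    rw [hW, Finset.smul_sum, Finset.smul_sum, ← Equiv.sum_comp Fin.revPerm]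
    refine Finset.sum_congr rfl fun d _ => ?_
    rw [smul_smul, smul_smul]
    congr 1
    simp only [structConst, Fin.revPerm_apply, cg_flip_mul hq₀ hq₁ B A, Fin.rev_rev]
    by_cases h : cg q A B M s t r = 0
    · simp [h]
    by_cases h' : cg q A B M i k d = 0
    · simp [h']
    rw [dualCoeff_mul hq₀ hq₁ h' h]; push_cast; ring
  have hmain := sum_cg_bilin hq₀ hq₁ (mulF q ∘ₗ (mulF q).flip f) A B
    (Finset.range (A + B + 1)) Z W (fun M r h => by
      simp only [hZ]
      exact Finset.sum_eq_zero fun m _ => by rw [cg_of_not_admissible q h]; simp)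
  have hL : (theta q p ⟨A, i, j⟩ ∘ₗ theta q p ⟨B, k, l⟩) f =
      ∑ s, ∑ t, (mulF q ∘ₗ (mulF q).flip f)
        (∑ M ∈ Finset.range (A + B + 1), ∑ r, (cg q A B M s t r : ℂ) • Z M r)
        (∑ M ∈ Finset.range (A + B + 1), ∑ r, (cg q A B M s t r : ℂ) • W M r) := by
    simp only [← hX, ← hY]
    rw [LinearMap.comp_apply, theta_apply]
    refine Finset.sum_congr rfl fun s _ => ?_
    rw [theta_apply]
    simp only [map_sum, LinearMap.sum_apply, Finset.smul_sum, map_smul, LinearMap.smul_apply]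
    refine Finset.sum_congr rfl fun t _ => ?_
    simp only [LinearMap.comp_apply, LinearMap.flip_apply, mulF_assoc hq₀ hq₁, smul_smul]
    congr 1
    push_cast; ring
  rw [hL, hmain, sum_idxLE, LinearMap.sum_apply]
  refine Finset.sum_congr rfl fun M _ => ?_
  simp only [LinearMap.sum_apply, LinearMap.smul_apply, theta_apply, Finset.smul_sum, smul_smul,
    hZ, hW, map_sum, map_smul, LinearMap.comp_apply, LinearMap.flip_apply]
  rw [Finset.sum_comm]
  refine Finset.sum_congr rfl fun d _ => ?_
  rw [Finset.sum_comm]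
  refine Finset.sum_congr rfl fun m _ => ?_
  refine Finset.sum_congr rfl fun r _ => ?_
  congr 1
  simp only [structConst]
  push_cast; ring

end

end

end QLorentz

namespace QLorentz

noncomputable section

set_option linter.unusedSectionVars false

/-! ### Embedding of the principal representations into `F_q(SU(2))` -/

/-- The matrix element of `π_α(u_J^a_b)` between `e^L_c` and `e^N_{c'}`. -/
def piCoeff (q : ℝ) (α : Label) (B : MatIdx) (N L : ℕ) (c' : Fin (N + 1)) (c : Fin (L + 1)) : ℂ :=
  ∑ M ∈ Finset.range (B.1 + L + 1), ∑ m : Fin (M + 1),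
    ((cg q N B.1 M c' B.2.1 m * cg q B.1 L M B.2.2 c m : ℝ) : ℂ) * Lam q α B.1 M N L

open Classical in
theorem piU_basisVec (q : ℝ) (α : Label) (B : MatIdx) (x : Idx α) :
    piU q α B (basisVec α x) = ∑ N ∈ Finset.range (2 * B.1 + x.1.1 + 1),
      if h : HasSpin α N then
        ∑ c' : Fin (N + 1), piCoeff q α B N x.1.1 c' x.2 • basisVec α ⟨⟨N, h⟩, c'⟩ else 0 := by
  rw [piU, basisVec, Finsupp.linearCombination_single, one_smul]
  rfl

/-- The image of `e^L_c` in `F_q(SU(2))`, proportional to `u_L^c_n`. -/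
def embVec (q : ℝ) (α : Label) (L : ℕ) (c : Fin (L + 1)) : FqSU2 :=
  (Real.sqrt (qnum q ((L : ℝ) + 1)) : ℂ) • ∑ n : Fin (L + 1),
    if 2 * ((n : ℕ) : ℤ) - (L : ℤ) = α.twoN then uElt ⟨L, c, n⟩ else 0

/-- The embedding of `V_α` into `F_q(SU(2))`. -/
def embed (q : ℝ) (α : Label) : VRep α →ₗ[ℂ] FqSU2 :=
  Finsupp.linearCombination ℂ fun x => embVec q α x.1.1 x.2

theorem embed_basisVec (q : ℝ) (α : Label) (x : Idx α) :
    embed q α (basisVec α x) = embVec q α x.1.1 x.2 := by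
  rw [embed, basisVec, Finsupp.linearCombination_single, one_smul]

theorem hasSpin_of_weight {α : Label} {L : ℕ} {n : Fin (L + 1)}
    (h : 2 * ((n : ℕ) : ℤ) - (L : ℤ) = α.twoN) : HasSpin α L := by
  have := n.2
  exact ⟨(L - α.twoN.natAbs) / 2, by omega⟩

theorem exists_weight {α : Label} {L : ℕ} (h : HasSpin α L) :
    ∃ n : Fin (L + 1), 2 * ((n : ℕ) : ℤ) - (L : ℤ) = α.twoN := by
  obtain ⟨k, hk⟩ := h
  exact ⟨⟨((L + α.twoN) / 2).toNat, by omega⟩, by simp only []; omega⟩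

theorem weight_unique {L : ℕ} {z : ℤ} {n n' : Fin (L + 1)} (h : 2 * ((n : ℕ) : ℤ) - (L : ℤ) = z)
    (h' : 2 * ((n' : ℕ) : ℤ) - (L : ℤ) = z) : n' = n := by
  ext; omega

theorem embVec_eq_zero (q : ℝ) {α : Label} {L : ℕ} (h : ¬ HasSpin α L) (c : Fin (L + 1)) :
    embVec q α L c = 0 := by
  rw [embVec, Finset.sum_eq_zero, smul_zero]
  intro n _
  rw [if_neg fun h' => h (hasSpin_of_weight h')]

theorem sum_weight_ite {E : Type*} [AddCommMonoid E] {L : ℕ} {z : ℤ} {n : Fin (L + 1)}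
    (h : 2 * ((n : ℕ) : ℤ) - (L : ℤ) = z) (f : Fin (L + 1) → E) :
    ∑ n' : Fin (L + 1), (if 2 * ((n' : ℕ) : ℤ) - (L : ℤ) = z then f n' else 0) = f n := by
  rw [Finset.sum_eq_single n, if_pos h]
  · intro n' _ hn'
    rw [if_neg fun h' => hn' (weight_unique h h')]
  · simp

/-- A left inverse of the embedding. -/
theorem embed_injective {q : ℝ} (hq₀ : 0 < q) (hq₁ : q < 1) (α : Label) :
    Function.Injective (embed q α) := by
  classical
  set g : FqSU2 →ₗ[ℂ] VRep α := Finsupp.linearCombination ℂ fun B =>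
    if h : HasSpin α B.1 then
      ((Real.sqrt (qnum q ((B.1 : ℝ) + 1)) : ℂ))⁻¹ • basisVec α ⟨⟨B.1, h⟩, B.2.1⟩ else 0 with hg
  have hcomp : g ∘ₗ embed q α = LinearMap.id := by
    refine Finsupp.lhom_ext' fun x => LinearMap.ext_ring ?_
    obtain ⟨n, hn⟩ := exists_weight x.1.2
    change g (embed q α (basisVec α x)) = basisVec α x
    rw [embed_basisVec, embVec, sum_weight_ite hn, map_smul, hg, uElt,
      Finsupp.linearCombination_single, one_smul, dif_pos x.1.2, smul_smul, mul_inv_cancel₀,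
      one_smul]
    have : 0 < qnum q ((x.1.1 : ℝ) + 1) := qnum_pos hq₀ hq₁ (by positivity)
    exact_mod_cast (Real.sqrt_pos.2 this).ne'
  exact Function.LeftInverse.injective (g := g) fun v => LinearMap.congr_fun hcomp v

theorem embed_piU (q : ℝ) (α : Label) (B : MatIdx) (x : Idx α) :
    embed q α (piU q α B (basisVec α x)) = ∑ N ∈ Finset.range (2 * B.1 + x.1.1 + 1),
      ∑ c' : Fin (N + 1), piCoeff q α B N x.1.1 c' x.2 • embVec q α N c' := by
  rw [piU_basisVec, map_sum]
  refine Finset.sum_congr rfl fun N _ => ?_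
  split_ifs with h
  · rw [map_sum]
    exact Finset.sum_congr rfl fun c' _ => by rw [map_smul, embed_basisVec]
  · rw [map_zero]
    exact (Finset.sum_eq_zero fun c' _ => by rw [embVec_eq_zero q h, smul_zero]).symm

section

variable {q : ℝ} (hq₀ : 0 < q) (hq₁ : q < 1)
include hq₀ hq₁

theorem qnum_succ_ne_zero (n : ℕ) : qnum q ((n : ℝ) + 1) ≠ 0 :=
  (qnum_pos hq₀ hq₁ (by positivity)).ne'

/-- Right multiplication by `(u_J^a_s)^*`, written through the coefficients that occur in `piU` and
`Lam`. -/
theorem dualCoeff_structConst (N J M : ℕ) (c n : Fin (N + 1)) (a s : Fin (J + 1))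
    (m r : Fin (M + 1)) :
    dualCoeff q J a * dualCoeff q J s * structConst q ⟨M, m, r⟩ ⟨J, a.rev, s.rev⟩ ⟨N, c, n⟩ =
      qnum q ((N : ℝ) + 1) / qnum q ((M : ℝ) + 1) *
        (cg q N J M c a m * cg q N J M n s r) := by
  have h := cg_dual_mul hq₀ hq₁ N J M c n a s m r
  have hM := qnum_succ_ne_zero hq₀ hq₁ M
  rw [div_mul_eq_mul_div, h, structConst, mul_div_cancel_left₀ _ hM]

theorem theta_embVec_coeff (α : Label) (J N L : ℕ) (a b : Fin (J + 1)) (c' n' : Fin (N + 1))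
    (c : Fin (L + 1)) :
    ∑ s, ∑ n : Fin (L + 1), ∑ C ∈ idxLE (J + L),
      (if 2 * ((n : ℕ) : ℤ) - (L : ℤ) = α.twoN then
        phase q α.p (wt J s) * ((dualCoeff q J a * dualCoeff q J s : ℝ) : ℂ) *
        (Real.sqrt (qnum q ((L : ℝ) + 1)) : ℂ) *
        (structConst q ⟨J, b, s⟩ ⟨L, c, n⟩ C : ℂ) *
        (structConst q C ⟨J, a.rev, s.rev⟩ ⟨N, c', n'⟩ : ℂ) else 0) =
      if 2 * ((n' : ℕ) : ℤ) - (N : ℤ) = α.twoN then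
        piCoeff q α ⟨J, a, b⟩ N L c' c * (Real.sqrt (qnum q ((N : ℝ) + 1)) : ℂ) else 0 := by
  have key : ∀ (s : Fin (J + 1)) (n : Fin (L + 1)) (M : ℕ) (m r : Fin (M + 1)),
      (if 2 * ((n : ℕ) : ℤ) - (L : ℤ) = α.twoN then
        phase q α.p (wt J s) * ((dualCoeff q J a * dualCoeff q J s : ℝ) : ℂ) *
        (Real.sqrt (qnum q ((L : ℝ) + 1)) : ℂ) *
        (structConst q ⟨J, b, s⟩ ⟨L, c, n⟩ ⟨M, m, r⟩ : ℂ) *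
        (structConst q ⟨M, m, r⟩ ⟨J, a.rev, s.rev⟩ ⟨N, c', n'⟩ : ℂ) else 0) =
      if 2 * ((n' : ℕ) : ℤ) - (N : ℤ) = α.twoN then
        ((cg q N J M c' a m * cg q J L M b c m : ℝ) : ℂ) *
          (((Real.sqrt (qnum q ((N : ℝ) + 1) * qnum q ((L : ℝ) + 1)) / qnum q ((M : ℝ) + 1) : ℝ) : ℂ)
            * (phase q α.p (wt J s) *
              if 2 * ((n' : ℕ) : ℤ) - (N : ℤ) = α.twoN ∧ 2 * ((n : ℕ) : ℤ) - (L : ℤ) = α.twoN then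
                ((cg q N J M n' s r * cg q J L M s n r : ℝ) : ℂ) else 0)) *
          (Real.sqrt (qnum q ((N : ℝ) + 1)) : ℂ) else 0 := by
    intro s n M m r
    have hsq : Real.sqrt (qnum q ((N : ℝ) + 1)) * Real.sqrt (qnum q ((N : ℝ) + 1)) =
        qnum q ((N : ℝ) + 1) := Real.mul_self_sqrt (qnum_nonneg hq₀ hq₁ (by positivity))
    have h1 : phase q α.p (wt J s) * ((dualCoeff q J a * dualCoeff q J s : ℝ) : ℂ) *
        (Real.sqrt (qnum q ((L : ℝ) + 1)) : ℂ) *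
        (structConst q ⟨J, b, s⟩ ⟨L, c, n⟩ ⟨M, m, r⟩ : ℂ) *
        (structConst q ⟨M, m, r⟩ ⟨J, a.rev, s.rev⟩ ⟨N, c', n'⟩ : ℂ) =
        ((cg q N J M c' a m * cg q J L M b c m : ℝ) : ℂ) *
          (((Real.sqrt (qnum q ((N : ℝ) + 1) * qnum q ((L : ℝ) + 1)) / qnum q ((M : ℝ) + 1) : ℝ) : ℂ)
            * (phase q α.p (wt J s) *
                ((cg q N J M n' s r * cg q J L M s n r : ℝ) : ℂ))) *
          (Real.sqrt (qnum q ((N : ℝ) + 1)) : ℂ) := by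
      have h2 := dualCoeff_structConst hq₀ hq₁ N J M c' n' a s m r
      rw [Real.sqrt_mul (qnum_nonneg hq₀ hq₁ (by positivity))]
      have h3 : dualCoeff q J a * dualCoeff q J s * Real.sqrt (qnum q ((L : ℝ) + 1)) *
          structConst q ⟨J, b, s⟩ ⟨L, c, n⟩ ⟨M, m, r⟩ *
          structConst q ⟨M, m, r⟩ ⟨J, a.rev, s.rev⟩ ⟨N, c', n'⟩ =
          cg q N J M c' a m * cg q J L M b c m * (Real.sqrt (qnum q ((N : ℝ) + 1)) *
            Real.sqrt (qnum q ((L : ℝ) + 1)) / qnum q ((M : ℝ) + 1)) *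
            (cg q N J M n' s r * cg q J L M s n r) * Real.sqrt (qnum q ((N : ℝ) + 1)) := by
        have : structConst q ⟨J, b, s⟩ ⟨L, c, n⟩ ⟨M, m, r⟩ =
          cg q J L M b c m * cg q J L M s n r := rfl
        rw [this]
        linear_combination (Real.sqrt (qnum q ((L : ℝ) + 1)) *
          (cg q J L M b c m * cg q J L M s n r)) * h2 -
          (Real.sqrt (qnum q ((L : ℝ) + 1)) * cg q J L M b c m * cg q J L M s n r *
          cg q N J M c' a m * cg q N J M n' s r / qnum q ((M : ℝ) + 1)) * hsq
      have h4 := congrArg (fun z : ℝ => phase q α.p (wt J s) * (z : ℂ)) h3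
      simp only [Complex.ofReal_mul, Complex.ofReal_div] at h4 ⊢
      linear_combination h4
    -- In weights, `n' + s = r = s + n` when neither coefficient vanishes: left multiplication
    -- shifts the lower index by `s` and the starred factor shifts it back, so the fixed weight
    -- defining `V_α` is preserved.
    by_cases hz : cg q N J M n' s r * cg q J L M s n r = 0
    · rw [h1, hz]; simp
    · have v1 := cg_val hq₀ hq₁ (left_ne_zero_of_mul hz)
      have v2 := cg_val hq₀ hq₁ (right_ne_zero_of_mul hz)
      by_cases hn : 2 * ((n : ℕ) : ℤ) - (L : ℤ) = α.twoN
      · have hn' : 2 * ((n' : ℕ) : ℤ) - (N : ℤ) = α.twoN := by omega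
        rw [if_pos hn, if_pos hn', if_pos ⟨hn', hn⟩, h1]
      · have hn' : ¬ 2 * ((n' : ℕ) : ℤ) - (N : ℤ) = α.twoN := by omega
        rw [if_neg hn, if_neg hn']
  simp only [sum_idxLE, key]
  split_ifs with hn'
  · have hLam : ∀ M, Lam q α J M N L =
        ((Real.sqrt (qnum q ((N : ℝ) + 1) * qnum q ((L : ℝ) + 1)) / qnum q ((M : ℝ) + 1) : ℝ) : ℂ) *
          ∑ s : Fin (J + 1), phase q α.p (wt J s) * ∑ n : Fin (L + 1), ∑ r : Fin (M + 1),
            if 2 * ((n' : ℕ) : ℤ) - (N : ℤ) = α.twoN ∧ 2 * ((n : ℕ) : ℤ) - (L : ℤ) = α.twoN then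
              ((cg q N J M n' s r * cg q J L M s n r : ℝ) : ℂ) else 0 := by
      intro M
      simp only [Lam]
      congr 1
      refine Finset.sum_congr rfl fun s _ => ?_
      rw [Finset.sum_eq_single n']
      · rfl
      · intro i _ hi
        refine Finset.sum_eq_zero fun l _ => Finset.sum_eq_zero fun k _ => ?_
        rw [if_neg fun h => hi (weight_unique hn' h.1)]
      · simp
    simp only [piCoeff, hLam, Finset.mul_sum, Finset.sum_mul]
    rw [Finset.sum_congr rfl fun s _ => Finset.sum_comm, Finset.sum_comm]
    refine Finset.sum_congr rfl fun M _ => ?_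
    rw [Finset.sum_congr rfl fun s _ => Finset.sum_comm, Finset.sum_comm]
  · simp

/-- The starred factor contributes `[N+1]/[M+1]`; the square roots in `embVec` redistribute this
into the symmetric prefactor of `Lam`. -/
theorem theta_embVec (α : Label) (B : MatIdx) (L : ℕ) (c : Fin (L + 1)) :
    theta q α.p B (embVec q α L c) = ∑ N ∈ Finset.range (2 * B.1 + L + 1),
      ∑ c' : Fin (N + 1), piCoeff q α B N L c' c • embVec q α N c' := by
  obtain ⟨J, a, b⟩ := B
  have hR : ∑ N ∈ Finset.range (2 * J + L + 1),
      ∑ c' : Fin (N + 1), piCoeff q α ⟨J, a, b⟩ N L c' c • embVec q α N c' =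
      ∑ D ∈ idxLE (2 * J + L), (if 2 * ((D.2.2 : ℕ) : ℤ) - (D.1 : ℤ) = α.twoN then
        piCoeff q α ⟨J, a, b⟩ D.1 L D.2.1 c * (Real.sqrt (qnum q ((D.1 : ℝ) + 1)) : ℂ) else 0) •
        uElt D := by
    rw [sum_idxLE]
    refine Finset.sum_congr rfl fun N _ => Finset.sum_congr rfl fun c' _ => ?_
    rw [embVec, smul_smul, Finset.smul_sum]
    refine Finset.sum_congr rfl fun n' _ => ?_
    simp only [smul_ite, smul_zero, ite_smul, zero_smul]
  have hL : theta q α.p ⟨J, a, b⟩ (embVec q α L c) = ∑ D ∈ idxLE (2 * J + L),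
      (∑ s, ∑ n : Fin (L + 1), ∑ C ∈ idxLE (J + L),
      (if 2 * ((n : ℕ) : ℤ) - (L : ℤ) = α.twoN then
        phase q α.p (wt J s) * ((dualCoeff q J a * dualCoeff q J s : ℝ) : ℂ) *
        (Real.sqrt (qnum q ((L : ℝ) + 1)) : ℂ) *
        (structConst q ⟨J, b, s⟩ ⟨L, c, n⟩ C : ℂ) *
        (structConst q C ⟨J, a.rev, s.rev⟩ D : ℂ) else 0)) • uElt D := by
    rw [theta_apply]
    simp only [Finset.sum_smul]
    rw [Finset.sum_comm]
    refine Finset.sum_congr rfl fun s _ => ?_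
    rw [Finset.sum_comm, embVec]
    simp only [map_smul, map_sum, LinearMap.smul_apply, LinearMap.sum_apply, Finset.smul_sum]
    refine Finset.sum_congr rfl fun n _ => ?_
    rw [Finset.sum_comm]
    split_ifs with hn
    · simp only [mulF_uElt, map_sum, map_smul, LinearMap.sum_apply, LinearMap.smul_apply,
        Finset.smul_sum]
      refine Finset.sum_congr rfl fun C hC => ?_
      have hC := mem_idxLE.1 hC
      simp only [← Finset.smul_sum]
      rw [sum_structConst q C ⟨J, a.rev, s.rev⟩ (n := 2 * J + L) (by simp only []; omega)]
      simp only [Finset.smul_sum, smul_smul]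
      refine Finset.sum_congr rfl fun D _ => ?_
      congr 1; ring
    · simp
  rw [hL, hR]
  refine Finset.sum_congr rfl fun D _ => ?_
  obtain ⟨N, c', n'⟩ := D
  rw [theta_embVec_coeff hq₀ hq₁]

theorem theta_comp_embed (α : Label) (B : MatIdx) :
    theta q α.p B ∘ₗ embed q α = embed q α ∘ₗ piU q α B :=
  Finsupp.lhom_ext' fun x => LinearMap.ext_ring <| by
    change theta q α.p B (embed q α (basisVec α x)) = embed q α (piU q α B (basisVec α x))
    rw [embed_basisVec, embed_piU, theta_embVec hq₀ hq₁]

/-- The principal representation is a representation of `F_q(SU(2))^{op}`. -/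
theorem piU_comp (α : Label) (A B : MatIdx) :
    piU q α A ∘ₗ piU q α B =
      ∑ C ∈ idxLE (A.1 + B.1), (structConst q A B C : ℂ) • piU q α C := by
  refine LinearMap.ext fun v => embed_injective hq₀ hq₁ α ?_
  have h : ∀ B w, embed q α (piU q α B w) = theta q α.p B (embed q α w) := fun B w =>
    (LinearMap.congr_fun (theta_comp_embed hq₀ hq₁ α B) w).symm
  have h2 := LinearMap.congr_fun (theta_comp hq₀ hq₁ α.p A B) (embed q α v)
  simp only [LinearMap.comp_apply, LinearMap.sum_apply, LinearMap.smul_apply, map_sum, map_smul,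
    h] at h2 ⊢
  exact h2

end

end

end QLorentz

namespace QLorentz

noncomputable section

set_option linter.unusedSectionVars false

/-! ### The braiding is a morphism -/

theorem tensor_ext_basisVec {α : Label} {E F : Type*} [AddCommGroup E] [Module ℂ E]
    [AddCommGroup F] [Module ℂ F] {f g : VRep α ⊗[ℂ] E →ₗ[ℂ] F}
    (h : ∀ x w, f (basisVec α x ⊗ₜ w) = g (basisVec α x ⊗ₜ w)) : f = g :=
  TensorProduct.ext <| Finsupp.lhom_ext' fun x => LinearMap.ext_ring <| LinearMap.ext fun w => h x w

theorem piX_matUnit_basisVec (α : Label) (x : Idx α) (m n : Fin (x.1.1 + 1)) :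
    piX α (matUnit ⟨x.1.1, m, n⟩) (basisVec α x) =
      if n = x.2 then basisVec α ⟨x.1, m⟩ else 0 := by
  rw [piX, basisVec, Finsupp.linearCombination_single, one_smul]
  have h : ∀ c', matUnit ⟨x.1.1, m, n⟩ x.1.1 c' x.2 = if m = c' ∧ n = x.2 then 1 else 0 := by
    intro c'
    simp [matUnit, Matrix.single_apply]
  simp only [h]
  by_cases hn : n = x.2
  · rw [Finset.sum_eq_single m]
    · simp [hn]
    · intro c' _ hc'; simp [Ne.symm hc']
    · simp
  · simp [hn]

theorem rAct_basisVec (q : ℝ) (α β : Label) (x : Idx α) (w : VRep β) :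
    rAct q α β (basisVec α x ⊗ₜ w) =
      ∑ m, basisVec α ⟨x.1, m⟩ ⊗ₜ piU q β ⟨x.1.1, m, x.2⟩ w := by
  rw [rAct, TensorProduct.lift.tmul]
  nth_rewrite 1 [basisVec]
  rw [Finsupp.linearCombination_single, one_smul, LinearMap.sum_apply]
  refine Finset.sum_congr rfl fun m _ => ?_
  rw [LinearMap.sum_apply, Finset.sum_eq_single x.2]
  · simp [piX_matUnit_basisVec]
  · intro n _ hn
    simp [piX_matUnit_basisVec, hn]
  · simp

/-- The action of `Δ(u_J^a_b) = ∑_p u_J^p_b ⊗ u_J^a_p` on `V_α ⊗ V_β`. -/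
def piU₂ (q : ℝ) (α β : Label) (B : MatIdx) : VRep α ⊗[ℂ] VRep β →ₗ[ℂ] VRep α ⊗[ℂ] VRep β :=
  ∑ p : Fin (B.1 + 1),
    TensorProduct.map (piU q α ⟨B.1, p, B.2.2⟩) (piU q β ⟨B.1, B.2.1, p⟩)

/-- The action of `∑_p u_J^a_p ⊗ u_J^p_b` on `V_α ⊗ V_β`. -/
def piU₂op (q : ℝ) (α β : Label) (B : MatIdx) : VRep α ⊗[ℂ] VRep β →ₗ[ℂ] VRep α ⊗[ℂ] VRep β :=
  ∑ p : Fin (B.1 + 1),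
    TensorProduct.map (piU q α ⟨B.1, B.2.1, p⟩) (piU q β ⟨B.1, p, B.2.2⟩)

theorem piU₄_eq (q : ℝ) (α₁ α₂ α₃ α₄ : Label) (B : MatIdx) :
    piU₄ q α₁ α₂ α₃ α₄ B = ∑ c : Fin (B.1 + 1),
      TensorProduct.map (piU₂ q α₁ α₂ ⟨B.1, c, B.2.2⟩) (piU₂ q α₃ α₄ ⟨B.1, B.2.1, c⟩) := by
  rw [piU₄, Finset.sum_comm]
  refine Finset.sum_congr rfl fun c _ => ?_
  simp only [piU₂, ← TensorProduct.mapBilinear_apply, map_sum, LinearMap.sum_apply]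
  rw [Finset.sum_comm]

section

variable {q : ℝ} (hq₀ : 0 < q) (hq₁ : q < 1)
include hq₀ hq₁

/-- This and the next lemma group the same product in two ways, according to whether the lower or
the upper indices will be contracted. -/
theorem piU_comp_lower (α : Label) (A B : ℕ) (i j : Fin (A + 1)) (k l : Fin (B + 1)) :
    piU q α ⟨A, i, j⟩ ∘ₗ piU q α ⟨B, k, l⟩ = ∑ M ∈ Finset.range (A + B + 1), ∑ s,
      (cg q A B M j l s : ℂ) • ∑ t, (cg q A B M i k t : ℂ) • piU q α ⟨M, t, s⟩ := by
  rw [piU_comp hq₀ hq₁, sum_idxLE]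
  refine Finset.sum_congr rfl fun M _ => ?_
  rw [Finset.sum_comm]
  refine Finset.sum_congr rfl fun s _ => ?_
  rw [Finset.smul_sum]
  refine Finset.sum_congr rfl fun t _ => ?_
  rw [smul_smul]; congr 1; simp only [structConst]; push_cast; ring

theorem piU_comp_upper (α : Label) (A B : ℕ) (i j : Fin (A + 1)) (k l : Fin (B + 1)) :
    piU q α ⟨A, i, j⟩ ∘ₗ piU q α ⟨B, k, l⟩ = ∑ M ∈ Finset.range (A + B + 1), ∑ t,
      (cg q A B M i k t : ℂ) • ∑ s, (cg q A B M j l s : ℂ) • piU q α ⟨M, t, s⟩ := by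
  rw [piU_comp hq₀ hq₁, sum_idxLE]
  refine Finset.sum_congr rfl fun M _ => ?_
  refine Finset.sum_congr rfl fun s _ => ?_
  rw [Finset.smul_sum]
  refine Finset.sum_congr rfl fun t _ => ?_
  rw [smul_smul]; congr 1; simp only [structConst]; push_cast; ring

/-- Orthogonality in `V_N ⊗ V_J` contracts the lower indices of the product. The right-hand side is
a normal form shared with `sum_piCoeff_upper`, where the upper indices are contracted in `V_J ⊗
V_I`; equality of the two is the content of `RΔ = Δ^{op}R`. -/
theorem sum_piCoeff_lower (α β : Label) (J N I : ℕ) (a b : Fin (J + 1)) (m : Fin (N + 1))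
    (n : Fin (I + 1)) :
    ∑ c', ∑ p, piCoeff q α ⟨J, p, b⟩ N I c' n • (piU q β ⟨N, m, c'⟩ ∘ₗ piU q β ⟨J, a, p⟩) =
      ∑ M ∈ Finset.range (J + I + 1), ∑ r, ((cg q J I M b n r : ℂ) * Lam q α J M N I) •
        ∑ t, (cg q N J M m a t : ℂ) • piU q β ⟨M, t, r⟩ := by
  rw [← Fintype.sum_prod_type' (f := fun c' p => piCoeff q α ⟨J, p, b⟩ N I c' n •
    (piU q β ⟨N, m, c'⟩ ∘ₗ piU q β ⟨J, a, p⟩))]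
  simp only [piCoeff, Finset.sum_smul]
  rw [Finset.sum_comm]
  refine Finset.sum_congr rfl fun M _ => ?_
  rw [Finset.sum_comm]
  refine Finset.sum_congr rfl fun r _ => ?_
  by_cases h : Admissible N J M
  · rw [← sum_cg_smul_expansion hq₀ hq₁ h (s := Finset.range (N + J + 1))
      (Finset.mem_range.2 (Nat.lt_succ_of_le h.2.1))
      (fun M r => ∑ t, (cg q N J M m a t : ℂ) • piU q β ⟨M, t, r⟩) r,
      ← Fintype.sum_prod_type', Finset.smul_sum]
    refine Finset.sum_congr rfl fun x _ => ?_
    rw [piU_comp_lower hq₀ hq₁, smul_smul]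
    congr 1; push_cast; ring
  · simp [cg_of_not_admissible q h]

theorem sum_piCoeff_upper (α β : Label) (J N I : ℕ) (a b : Fin (J + 1)) (m : Fin (N + 1))
    (n : Fin (I + 1)) :
    ∑ p, ∑ m', piCoeff q α ⟨J, a, p⟩ N I m m' • (piU q β ⟨J, p, b⟩ ∘ₗ piU q β ⟨I, m', n⟩) =
      ∑ M ∈ Finset.range (J + I + 1), ∑ r, ((cg q J I M b n r : ℂ) * Lam q α J M N I) •
        ∑ t, (cg q N J M m a t : ℂ) • piU q β ⟨M, t, r⟩ := by
  rw [← Fintype.sum_prod_type' (f := fun p m' => piCoeff q α ⟨J, a, p⟩ N I m m' •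
    (piU q β ⟨J, p, b⟩ ∘ₗ piU q β ⟨I, m', n⟩))]
  simp only [piCoeff, Finset.sum_smul]
  rw [Finset.sum_comm]
  refine Finset.sum_congr rfl fun M _ => ?_
  simp only [Finset.smul_sum]
  rw [Finset.sum_comm]
  conv_rhs => rw [Finset.sum_comm]
  refine Finset.sum_congr rfl fun t _ => ?_
  by_cases h : Admissible J I M
  · have := sum_cg_smul_expansion hq₀ hq₁ h (s := Finset.range (J + I + 1))
      (Finset.mem_range.2 (Nat.lt_succ_of_le h.2.1))
      (fun M t => ∑ s, (cg q J I M b n s : ℂ) • piU q β ⟨M, t, s⟩) t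
    rw [← Fintype.sum_prod_type' (f := fun i j => (cg q J I M i j t : ℂ) •
      ∑ M ∈ Finset.range (J + I + 1), ∑ r, (cg q J I M i j r : ℂ) •
        ∑ s, (cg q J I M b n s : ℂ) • piU q β ⟨M, r, s⟩)] at this
    have h2 := congrArg (fun X : VRep β →ₗ[ℂ] VRep β => ((cg q N J M m a t : ℂ) * Lam q α J M N I) • X) this
    simp only [Finset.smul_sum] at h2
    refine Eq.trans ?_ (h2.trans ?_)
    · refine Finset.sum_congr rfl fun x _ => ?_
      simp only [← Finset.smul_sum]
      rw [piU_comp_upper hq₀ hq₁, smul_smul]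
      congr 1; push_cast; ring
    · refine Finset.sum_congr rfl fun s _ => ?_
      rw [smul_smul, smul_smul]
      congr 1; ring
  · simp [cg_of_not_admissible q h]

/-- On `e^I_n ⊗ w` both sides are `∑ e^N_m ⊗ (…)w`, and each second factor has the same normal form.
Multiplicativity of `π_β` is essential here. -/
theorem rAct_comp_piU₂ (α β : Label) (B : MatIdx) :
    rAct q α β ∘ₗ piU₂ q α β B = piU₂op q α β B ∘ₗ rAct q α β := by
  classical
  obtain ⟨J, a, b⟩ := B
  refine tensor_ext_basisVec (E := VRep β) (F := VRep α ⊗[ℂ] VRep β) fun x w => ?_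
  obtain ⟨⟨I, hI⟩, n⟩ := x
  have hL : (rAct q α β ∘ₗ piU₂ q α β ⟨J, a, b⟩) (basisVec α ⟨⟨I, hI⟩, n⟩ ⊗ₜ w) =
      ∑ N ∈ Finset.range (2 * J + I + 1), if h : HasSpin α N then
        ∑ m : Fin (N + 1), basisVec α ⟨⟨N, h⟩, m⟩ ⊗ₜ[ℂ] (∑ c', ∑ p,
          piCoeff q α ⟨J, p, b⟩ N I c' n • (piU q β ⟨N, m, c'⟩ ∘ₗ piU q β ⟨J, a, p⟩)) w else 0 := by
    simp only [LinearMap.comp_apply, piU₂, LinearMap.sum_apply, TensorProduct.map_tmul,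
      piU_basisVec, TensorProduct.sum_tmul, map_sum]
    rw [Finset.sum_comm]
    refine Finset.sum_congr rfl fun N _ => ?_
    split_ifs with h
    · simp only [TensorProduct.sum_tmul, map_sum, ← TensorProduct.smul_tmul', map_smul,
        rAct_basisVec, LinearMap.smul_apply, TensorProduct.tmul_sum, TensorProduct.tmul_smul,
        Finset.smul_sum, LinearMap.comp_apply]
      rw [Finset.sum_comm]
      conv_rhs => rw [Finset.sum_comm]
      refine Finset.sum_congr rfl fun c' _ => ?_
      rw [Finset.sum_comm]
    · simp
  have hR : (piU₂op q α β ⟨J, a, b⟩ ∘ₗ rAct q α β) (basisVec α ⟨⟨I, hI⟩, n⟩ ⊗ₜ w) =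
      ∑ N ∈ Finset.range (2 * J + I + 1), if h : HasSpin α N then
        ∑ m : Fin (N + 1), basisVec α ⟨⟨N, h⟩, m⟩ ⊗ₜ[ℂ] (∑ p, ∑ m',
          piCoeff q α ⟨J, a, p⟩ N I m m' • (piU q β ⟨J, p, b⟩ ∘ₗ piU q β ⟨I, m', n⟩)) w else 0 := by
    simp only [LinearMap.comp_apply, piU₂op, LinearMap.sum_apply, TensorProduct.map_tmul,
      rAct_basisVec, piU_basisVec, TensorProduct.sum_tmul, map_sum]
    rw [Finset.sum_congr rfl fun p _ => Finset.sum_comm, Finset.sum_comm]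
    refine Finset.sum_congr rfl fun N _ => ?_
    split_ifs with h
    · simp only [TensorProduct.sum_tmul, ← TensorProduct.smul_tmul',
        LinearMap.smul_apply, TensorProduct.tmul_sum, TensorProduct.tmul_smul,
        LinearMap.comp_apply]
      rw [Finset.sum_congr rfl fun p _ => Finset.sum_comm, Finset.sum_comm]
      exact Finset.sum_congr rfl fun m _ => Finset.sum_comm
    · simp
  rw [hL, hR]
  simp only [sum_piCoeff_lower hq₀ hq₁, sum_piCoeff_upper hq₀ hq₁]

theorem braid_comp_piU₂ (α β : Label) (B : MatIdx) :
    braid q α β ∘ₗ piU₂ q α β B = piU₂ q β α B ∘ₗ braid q α β := by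
  have h : (TensorProduct.comm ℂ (VRep α) (VRep β)).toLinearMap ∘ₗ piU₂op q α β B =
      piU₂ q β α B ∘ₗ (TensorProduct.comm ℂ (VRep α) (VRep β)).toLinearMap := by
    refine TensorProduct.ext' fun v w => ?_
    simp [piU₂, piU₂op]
  rw [braid, LinearMap.comp_assoc, rAct_comp_piU₂ hq₀ hq₁, ← LinearMap.comp_assoc, h,
    LinearMap.comp_assoc]

/-- By coassociativity the fourfold action splits into two twofold ones, and the braiding meets only
the first. -/
theorem braid₁₂_comp_piU₄ (α β α₃ α₄ : Label) (B : MatIdx) :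
    braid₁₂ q α β α₃ α₄ ∘ₗ piU₄ q α β α₃ α₄ B =
      piU₄ q β α α₃ α₄ B ∘ₗ braid₁₂ q α β α₃ α₄ := by
  rw [piU₄_eq, piU₄_eq]
  refine LinearMap.ext fun v => ?_
  simp only [LinearMap.comp_apply, LinearMap.sum_apply, map_sum]
  refine Finset.sum_congr rfl fun c _ => ?_
  rw [← LinearMap.comp_apply, ← LinearMap.comp_apply, braid₁₂, ← TensorProduct.map_comp,
    ← TensorProduct.map_comp, braid_comp_piU₂ hq₀ hq₁]
  simp

end

end

end QLorentz

namespace QLorentz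

noncomputable section

open scoped Kronecker
open Matrix

set_option linter.unusedSectionVars false

/-! ### The intertwiners `λ_{[K],J}` -/

/-- The matrix of `ε_J`. -/
def epsCoeff (q : ℝ) (d : ℕ) (i j : Fin (d + 1)) : ℝ :=
  if (i : ℕ) + (j : ℕ) = d then
    (-1) ^ (i : ℕ) * (q ^ ((d : ℝ) / 2 * ((d : ℝ) / 2 + 1)) * q ^ wt d i)
  else 0

/-- The coefficients of `λ_{[K],J}`. -/
def lamCoeff (q : ℝ) (K₁ K₂ K₃ K₄ J : ℕ) (x : Fin (K₁ + 1) × Fin (K₂ + 1))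
    (y : Fin (K₃ + 1) × Fin (K₄ + 1)) : ℝ :=
  ∑ k, ∑ k', epsCoeff q J k k' * (cg q K₁ K₂ J x.1 x.2 k * cg q K₃ K₄ J y.1 y.2 k')

theorem epsMap_apply (q : ℝ) (d : ℕ) (v w : VSpin d) :
    epsMap q d v w = ∑ i, ∑ j, (epsCoeff q d i j : ℂ) * (v i * w j) := by
  rw [epsMap, Matrix.toLinearMap₂'_apply]
  refine Finset.sum_congr rfl fun i _ => Finset.sum_congr rfl fun j _ => ?_
  simp only [epsCoeff, Matrix.of_apply, smul_eq_mul]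
  split_ifs
  · push_cast; ring
  · simp

theorem cgProj_single (q : ℝ) (a b c : ℕ) (i : Fin (a + 1)) (j : Fin (b + 1)) :
    cgProj q a b c (Pi.single i 1 ⊗ₜ Pi.single j 1) = fun k => (cg q a b c i j k : ℂ) := by
  ext k
  rw [cgProj, TensorProduct.lift.tmul, LinearMap.mk₂_apply, Finset.sum_eq_single i,
    Finset.sum_eq_single j]
  · simp
  · intro j' _ h; simp [h]
  · simp
  · intro i' _ h; simp [h]
  · simp

theorem lambdaMap_single (q : ℝ) (K₁ K₂ K₃ K₄ J : ℕ) (i₁ : Fin (K₁ + 1)) (i₂ : Fin (K₂ + 1))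
    (i₃ : Fin (K₃ + 1)) (i₄ : Fin (K₄ + 1)) :
    lambdaMap q K₁ K₂ K₃ K₄ J ((Pi.single i₁ 1 ⊗ₜ Pi.single i₂ 1) ⊗ₜ
      (Pi.single i₃ 1 ⊗ₜ Pi.single i₄ 1)) = (lamCoeff q K₁ K₂ K₃ K₄ J (i₁, i₂) (i₃, i₄) : ℂ) := by
  rw [lambdaMap, LinearMap.comp_apply, TensorProduct.map_tmul, contractLeft_apply,
    LinearMap.comp_apply, cgProj_single, cgProj_single, epsMap_apply, lamCoeff]
  push_cast
  rfl

theorem proj_basisVec_self (α : Label) {I : ℕ} (h : HasSpin α I) (c : Fin (I + 1)) :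
    proj α I (basisVec α ⟨⟨I, h⟩, c⟩) = Pi.single c 1 := by
  classical
  ext i
  rw [proj, dif_pos h, LinearMap.pi_apply, Finsupp.lapply_apply, basisVec, Finsupp.single_apply,
    Pi.single_apply]
  congr 1
  simp only [Sigma.mk.injEq, heq_eq_eq, true_and, eq_comm]

theorem proj_basisVec_ne (α : Label) {I K : ℕ} (hIK : I ≠ K) (h : HasSpin α I) (c : Fin (I + 1)) :
    proj α K (basisVec α ⟨⟨I, h⟩, c⟩) = 0 := by
  classical
  rw [proj]
  split_ifs with hK
  · ext i
    rw [LinearMap.pi_apply, Finsupp.lapply_apply, basisVec, Finsupp.single_apply, if_neg]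
    · rfl
    · intro e
      exact hIK (congrArg (fun z : Idx α => z.1.1) e)
  · rfl

/-- The linear form `λ_{[K],J} ∘ (⊗ f^{K_i}_{α_i})`. -/
def lamProj (q : ℝ) (α₁ α₂ α₃ α₄ : Label) (K₁ K₂ K₃ K₄ J : ℕ) : VFour α₁ α₂ α₃ α₄ →ₗ[ℂ] ℂ :=
  lambdaMap q K₁ K₂ K₃ K₄ J ∘ₗ proj₄ α₁ α₂ α₃ α₄ K₁ K₂ K₃ K₄

/-- The basis of `V[α]`. -/
def basisVec₄ (α₁ α₂ α₃ α₄ : Label) (x₁ : Idx α₁) (x₂ : Idx α₂) (x₃ : Idx α₃) (x₄ : Idx α₄) :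
    VFour α₁ α₂ α₃ α₄ :=
  (basisVec α₁ x₁ ⊗ₜ[ℂ] basisVec α₂ x₂) ⊗ₜ[ℂ] (basisVec α₃ x₃ ⊗ₜ[ℂ] basisVec α₄ x₄)

theorem vFour_ext {α₁ α₂ α₃ α₄ : Label} {E : Type*} [AddCommGroup E] [Module ℂ E]
    {f g : VFour α₁ α₂ α₃ α₄ →ₗ[ℂ] E} (h : ∀ x₁ x₂ x₃ x₄, f (basisVec₄ α₁ α₂ α₃ α₄ x₁ x₂ x₃ x₄) =
      g (basisVec₄ α₁ α₂ α₃ α₄ x₁ x₂ x₃ x₄)) : f = g := by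
  have h' : f ∘ₗ (coords₄ α₁ α₂ α₃ α₄).symm.toLinearMap =
      g ∘ₗ (coords₄ α₁ α₂ α₃ α₄).symm.toLinearMap := by
    refine Finsupp.lhom_ext' fun y => LinearMap.ext_ring ?_
    have e : (coords₄ α₁ α₂ α₃ α₄).symm (Finsupp.single y 1) =
        basisVec₄ α₁ α₂ α₃ α₄ y.1.1 y.1.2 y.2.1 y.2.2 := by
      rw [LinearEquiv.symm_apply_eq]
      simp [coords₄, basisVec₄, basisVec, finsuppTensorFinsupp'_single_tmul_single]
    simp only [LinearMap.comp_apply, LinearEquiv.coe_coe, Finsupp.lsingle_apply, e, h]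
  refine LinearMap.ext fun v => ?_
  have := LinearMap.congr_fun h' (coords₄ α₁ α₂ α₃ α₄ v)
  simpa using this

theorem lamProj_basisVec₄_self (q : ℝ) (α₁ α₂ α₃ α₄ : Label) (K₁ K₂ K₃ K₄ J : ℕ)
    (h₁ : HasSpin α₁ K₁) (h₂ : HasSpin α₂ K₂) (h₃ : HasSpin α₃ K₃) (h₄ : HasSpin α₄ K₄)
    (c₁ : Fin (K₁ + 1)) (c₂ : Fin (K₂ + 1)) (c₃ : Fin (K₃ + 1)) (c₄ : Fin (K₄ + 1)) :
    lamProj q α₁ α₂ α₃ α₄ K₁ K₂ K₃ K₄ J (basisVec₄ α₁ α₂ α₃ α₄ ⟨⟨K₁, h₁⟩, c₁⟩ ⟨⟨K₂, h₂⟩, c₂⟩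
      ⟨⟨K₃, h₃⟩, c₃⟩ ⟨⟨K₄, h₄⟩, c₄⟩) = (lamCoeff q K₁ K₂ K₃ K₄ J (c₁, c₂) (c₃, c₄) : ℂ) := by
  rw [lamProj, LinearMap.comp_apply, basisVec₄, proj₄]
  simp only [TensorProduct.map_tmul, proj_basisVec_self, lambdaMap_single]

theorem lamProj_basisVec₄_ne (q : ℝ) (α₁ α₂ α₃ α₄ : Label) (K₁ K₂ K₃ K₄ J : ℕ)
    (x₁ : Idx α₁) (x₂ : Idx α₂) (x₃ : Idx α₃) (x₄ : Idx α₄)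
    (h : ¬ (x₁.1.1 = K₁ ∧ x₂.1.1 = K₂ ∧ x₃.1.1 = K₃ ∧ x₄.1.1 = K₄)) :
    lamProj q α₁ α₂ α₃ α₄ K₁ K₂ K₃ K₄ J (basisVec₄ α₁ α₂ α₃ α₄ x₁ x₂ x₃ x₄) = 0 := by
  obtain ⟨⟨I₁, h₁⟩, c₁⟩ := x₁
  obtain ⟨⟨I₂, h₂⟩, c₂⟩ := x₂
  obtain ⟨⟨I₃, h₃⟩, c₃⟩ := x₃
  obtain ⟨⟨I₄, h₄⟩, c₄⟩ := x₄
  rw [lamProj, LinearMap.comp_apply, basisVec₄, proj₄]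
  simp only [TensorProduct.map_tmul]
  simp only [not_and_or] at h
  rcases h with h | h | h | h
  · rw [proj_basisVec_ne α₁ h, TensorProduct.zero_tmul, TensorProduct.zero_tmul, LinearMap.map_zero]
  · rw [proj_basisVec_ne α₂ h, TensorProduct.tmul_zero, TensorProduct.zero_tmul, LinearMap.map_zero]
  · rw [proj_basisVec_ne α₃ h, TensorProduct.zero_tmul, TensorProduct.tmul_zero, LinearMap.map_zero]
  · rw [proj_basisVec_ne α₄ h, TensorProduct.tmul_zero, TensorProduct.tmul_zero, LinearMap.map_zero]

theorem piX₄_basisVec₄ (q : ℝ) (α₁ α₂ α₃ α₄ : Label) (X : UqHat) (x₁ : Idx α₁) (x₂ : Idx α₂)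
    (x₃ : Idx α₃) (x₄ : Idx α₄) :
    piX₄ q α₁ α₂ α₃ α₄ X (basisVec₄ α₁ α₂ α₃ α₄ x₁ x₂ x₃ x₄) =
      ∑ c₁ : Fin (x₁.1.1 + 1), ∑ c₂ : Fin (x₂.1.1 + 1),
      ∑ c₃ : Fin (x₃.1.1 + 1), ∑ c₄ : Fin (x₄.1.1 + 1),
        comul₄ q X x₁.1.1 x₂.1.1 x₃.1.1 x₄.1.1 ((c₁, c₂), (c₃, c₄))
            ((x₁.2, x₂.2), (x₃.2, x₄.2)) •
          basisVec₄ α₁ α₂ α₃ α₄ ⟨x₁.1, c₁⟩ ⟨x₂.1, c₂⟩ ⟨x₃.1, c₃⟩ ⟨x₄.1, c₄⟩ := by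
  have e : coords₄ α₁ α₂ α₃ α₄ (basisVec₄ α₁ α₂ α₃ α₄ x₁ x₂ x₃ x₄) =
      Finsupp.single ((x₁, x₂), (x₃, x₄)) 1 := by
    simp [coords₄, basisVec₄, basisVec, finsuppTensorFinsupp'_single_tmul_single]
  rw [piX₄, LinearMap.comp_apply, LinearEquiv.coe_coe, e, Finsupp.linearCombination_single,
    one_smul]
  rfl

/-- The invariant vector of `V_A ⊗ V_B ⊗ V_C ⊗ V_D` in the channel `(S, T)`. -/
def invVec (q : ℝ) (A B C D S T : ℕ) :
    Matrix ((Fin (A + 1) × Fin (B + 1)) × (Fin (C + 1) × Fin (D + 1))) (Fin 1) ℝ :=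
  (cgMat q A B S ⊗ₖ cgMat q C D T) * cgMat q S T 0

theorem invVec_apply (q : ℝ) (A B C D S T : ℕ)
    (r : (Fin (A + 1) × Fin (B + 1)) × (Fin (C + 1) × Fin (D + 1))) (z : Fin 1) :
    invVec q A B C D S T r z = ∑ m : Fin (S + 1) × Fin (T + 1),
      cg q A B S r.1.1 r.1.2 m.1 * cg q C D T r.2.1 r.2.2 m.2 * cg q S T 0 m.1 m.2 z := by
  simp [invVec, Matrix.mul_apply, cgMat]

/-! ### Invariance of `λ_{[K],J}` and elimination of the `X`-part of the Haar sum. -/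

theorem comul₄_trivial (q : ℝ) (A B C D : ℕ)
    (r s : (Fin (A + 1) × Fin (B + 1)) × (Fin (C + 1) × Fin (D + 1))) :
    comul₄ q (matUnit ⟨0, 0, 0⟩) A B C D r s =
      ((∑ S ∈ Finset.range (A + B + 1), ∑ T ∈ Finset.range (C + D + 1),
        invVec q A B C D S T r 0 * invVec q A B C D S T s 0 : ℝ) : ℂ) := by
  have h2 : ∀ (S T : ℕ) (m n : Fin (S + 1) × Fin (T + 1)),
      comul₂ q (matUnit ⟨0, 0, 0⟩) S T m n =
        ((cg q S T 0 m.1 m.2 0 * cg q S T 0 n.1 n.2 0 : ℝ) : ℂ) := by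
    intro S T m n
    rw [comul₂, Matrix.of_apply, Finset.sum_eq_single 0]
    · simp [matUnit]
    · intro K _ hK
      simp [matUnit, Pi.single_eq_of_ne hK]
    · simp
  rw [comul₄, Matrix.of_apply]
  push_cast
  refine Finset.sum_congr rfl fun S _ => Finset.sum_congr rfl fun T _ => ?_
  rw [invVec_apply, invVec_apply]
  push_cast
  rw [Finset.sum_mul_sum]
  refine Finset.sum_congr rfl fun m _ => Finset.sum_congr rfl fun n _ => ?_
  rw [h2]
  push_cast; ring

section

variable {q : ℝ} (hq₀ : 0 < q) (hq₁ : q < 1)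
include hq₀ hq₁

omit hq₀ hq₁ in
theorem admissible_self_zero (J : ℕ) : Admissible J J 0 := ⟨by simp, by omega, by omega, by omega⟩

theorem hwVec_self_zero (J : ℕ) (k k' : Fin (J + 1)) :
    hwVec q J J 0 (k, k') = if (k : ℕ) + k' = J then (-q⁻¹) ^ (J - (k : ℕ)) else 0 := by
  simp only [hwVec]
  by_cases h : (k : ℕ) + k' = J
  · rw [if_pos (by omega), if_pos h, ← Finset.card_range (J - (k : ℕ)), ← Finset.prod_const,
      Finset.card_range]
    refine Finset.prod_congr rfl fun l hl => ?_
    have hl := Finset.mem_range.1 hl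
    have hl' : (l : ℝ) < J := by exact_mod_cast (by omega : l < J)
    have e1 : qnum q (((J : ℝ) + (0 : ℕ) - J) / 2 + l + 1) = qnum q ((l : ℝ) + 1) := by
      congr 1; push_cast; ring
    have e2 : qnum q (((J : ℝ) + J - (0 : ℕ)) / 2 - l) = qnum q ((J : ℝ) - l) := by
      congr 1; push_cast; ring
    have n1 : qnum q ((l : ℝ) + 1) ≠ 0 := qnum_succ_ne_zero hq₀ hq₁ l
    have n2 : qnum q ((J : ℝ) - l) ≠ 0 := (qnum_pos hq₀ hq₁ (by linarith)).ne'
    rw [e1, e2, div_self (mul_ne_zero n1 n2), Real.sqrt_one, mul_one]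
    simp [Real.rpow_neg_one]
  · rw [if_neg (by omega), if_neg h]

/-- `d_J ∘ (ε_J ⊗ id)` is proportional to `C^0_{JJ}`. -/
theorem exists_epsCoeff_eq (J : ℕ) : ∃ e : ℝ, ∀ k k', epsCoeff q J k k' = e * cg q J J 0 k k' 0 := by
  have hp := sum_hwVec_sq_pos (q := q) (admissible_self_zero J)
  -- The factors undo the normalisation of the highest weight vector, absorb the sign and weight
  -- shift between `(-q⁻¹)^{J-k}` and `(-1)^k q^{k-J/2}`, and restore the scalar in `ε_J`.
  refine ⟨Real.sqrt (∑ x, hwVec q J J 0 x ^ 2) * ((-1) ^ J * q ^ ((J : ℝ) / 2) *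
    q ^ ((J : ℝ) / 2 * ((J : ℝ) / 2 + 1))), fun k k' => ?_⟩
  have hk := k.2
  rw [cg, if_pos (admissible_self_zero J)]
  simp only [Fin.val_zero, Nat.sub_self, cgVec, Pi.smul_apply, smul_eq_mul]
  have hs := (Real.sqrt_pos.2 hp).ne'
  rw [hwVec_self_zero hq₀ hq₁, epsCoeff]
  split_ifs with h
  · have e1 : (-q⁻¹) ^ (J - (k : ℕ)) = (-1) ^ J * (-1) ^ (k : ℕ) * q ^ ((k : ℝ) - J) := by
      rw [neg_pow, inv_pow, ← Real.rpow_natCast q, ← Real.rpow_neg hq₀.le,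
        Nat.cast_sub (by omega), neg_sub]
      congr 1
      rw [← pow_add, neg_one_pow_eq_pow_mod_two, neg_one_pow_eq_pow_mod_two (n := J + k)]
      congr 1; omega
    have e2 : q ^ wt J k = q ^ ((J : ℝ) / 2) * q ^ ((k : ℝ) - J) := by
      rw [← Real.rpow_add hq₀]; congr 1; simp only [wt]; ring
    have e3 : ((-1 : ℝ)) ^ J * (-1) ^ J = 1 := by rw [← mul_pow]; simp
    rw [e1, e2]
    field_simp
    linear_combination -e3
  · simp

/-- Hence `λ` is a multiple of the single invariant vector in the channel `(J, J)`. -/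
theorem exists_lamCoeff_eq (K₁ K₂ K₃ K₄ J : ℕ) : ∃ e : ℝ, ∀ x y,
    lamCoeff q K₁ K₂ K₃ K₄ J x y = e * invVec q K₁ K₂ K₃ K₄ J J (x, y) 0 := by
  obtain ⟨e, he⟩ := exists_epsCoeff_eq hq₀ hq₁ J
  refine ⟨e, fun x y => ?_⟩
  rw [lamCoeff, invVec_apply, Fintype.sum_prod_type, Finset.mul_sum]
  refine Finset.sum_congr rfl fun k _ => ?_
  rw [Finset.mul_sum]
  exact Finset.sum_congr rfl fun k' _ => by rw [he]; ring

theorem invVec_orthogonal (A B C D S T J : ℕ) (h : ¬ (S = J ∧ T = J)) :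
    (invVec q A B C D S T)ᵀ * invVec q A B C D J J = 0 := by
  simp only [invVec, Matrix.transpose_mul]
  rw [Matrix.mul_assoc, ← Matrix.mul_assoc (cgMat q A B S ⊗ₖ cgMat q C D T)ᵀ,
    ← Matrix.kroneckerMap_transpose, ← Matrix.mul_kronecker_mul]
  rw [not_and_or] at h
  rcases h with h | h
  · rw [cgMat_transpose_mul_of_ne hq₀ hq₁ A B h]; simp
  · rw [cgMat_transpose_mul_of_ne hq₀ hq₁ C D h]; simp

theorem invVec_norm (A B C D J : ℕ) (h : Admissible A B J) (h' : Admissible C D J) :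
    (invVec q A B C D J J)ᵀ * invVec q A B C D J J = 1 := by
  simp only [invVec, Matrix.transpose_mul]
  rw [Matrix.mul_assoc, ← Matrix.mul_assoc (cgMat q A B J ⊗ₖ cgMat q C D J)ᵀ,
    ← Matrix.kroneckerMap_transpose, ← Matrix.mul_kronecker_mul,
    cgMat_transpose_mul_self hq₀ hq₁ h, cgMat_transpose_mul_self hq₀ hq₁ h',
    Matrix.one_kronecker_one, Matrix.one_mul,
    cgMat_transpose_mul_self hq₀ hq₁ (admissible_self_zero J)]

/-- `X_0` acts as `∑_{S,T}` of the rank-one operators built from the `invVec`; orthonormality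
retains only `S = T = J`. If a fusion rule fails, `λ` itself is zero. -/
theorem sum_comul₄_trivial_lamCoeff (A B C D J : ℕ) (x : Fin (A + 1) × Fin (B + 1))
    (y : Fin (C + 1) × Fin (D + 1)) :
    ∑ r : (Fin (A + 1) × Fin (B + 1)) × (Fin (C + 1) × Fin (D + 1)),
      comul₄ q (matUnit ⟨0, 0, 0⟩) A B C D r (x, y) * (lamCoeff q A B C D J r.1 r.2 : ℂ) =
      (lamCoeff q A B C D J x y : ℂ) := by
  obtain ⟨e, he⟩ := exists_lamCoeff_eq hq₀ hq₁ A B C D J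
  simp only [comul₄_trivial, he, ← Complex.ofReal_mul, ← Complex.ofReal_sum]
  congr 1
  have h1 : ∀ S T, ∑ r, invVec q A B C D S T r 0 * invVec q A B C D J J r 0 =
      ((invVec q A B C D S T)ᵀ * invVec q A B C D J J) 0 0 := fun S T => by
    rw [Matrix.mul_apply]; rfl
  have h2 : ∑ r, (∑ S ∈ Finset.range (A + B + 1), ∑ T ∈ Finset.range (C + D + 1),
      invVec q A B C D S T r 0 * invVec q A B C D S T (x, y) 0) *
        (e * invVec q A B C D J J r 0) = e * ∑ S ∈ Finset.range (A + B + 1),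
      ∑ T ∈ Finset.range (C + D + 1), invVec q A B C D S T (x, y) 0 *
        ((invVec q A B C D S T)ᵀ * invVec q A B C D J J) 0 0 := by
    simp only [← h1, Finset.mul_sum, Finset.sum_mul]
    rw [Finset.sum_comm]
    refine Finset.sum_congr rfl fun S _ => ?_
    rw [Finset.sum_comm]
    exact Finset.sum_congr rfl fun T _ => Finset.sum_congr rfl fun r _ => by ring
  rw [h2]
  congr 1
  by_cases h : Admissible A B J ∧ Admissible C D J
  · rw [Finset.sum_eq_single J, Finset.sum_eq_single J, invVec_norm hq₀ hq₁ A B C D J h.1 h.2]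
    · simp
    · intro T _ hT
      rw [invVec_orthogonal hq₀ hq₁ _ _ _ _ _ _ _ (fun h => hT h.2)]; simp
    · intro h'; exact absurd (Finset.mem_range.2 (Nat.lt_succ_of_le h.2.2.1)) h'
    · intro S _ hS
      refine Finset.sum_eq_zero fun T _ => ?_
      rw [invVec_orthogonal hq₀ hq₁ _ _ _ _ _ _ _ (fun h => hS h.1)]; simp
    · intro h'; exact absurd (Finset.mem_range.2 (Nat.lt_succ_of_le h.1.2.1)) h'
  · have hz : invVec q A B C D J J = 0 := by
      rw [invVec]
      rw [not_and_or] at h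
      rcases h with h | h <;> rw [cgMat_of_not_admissible q h] <;> simp
    simp [hz]

theorem lamProj_comp_piX₄ (α₁ α₂ α₃ α₄ : Label) (K₁ K₂ K₃ K₄ J : ℕ) :
    lamProj q α₁ α₂ α₃ α₄ K₁ K₂ K₃ K₄ J ∘ₗ piX₄ q α₁ α₂ α₃ α₄ (matUnit ⟨0, 0, 0⟩) =
      lamProj q α₁ α₂ α₃ α₄ K₁ K₂ K₃ K₄ J := by
  refine vFour_ext fun x₁ x₂ x₃ x₄ => ?_
  rw [LinearMap.comp_apply, piX₄_basisVec₄]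
  simp only [map_sum, map_smul]
  by_cases h : x₁.1.1 = K₁ ∧ x₂.1.1 = K₂ ∧ x₃.1.1 = K₃ ∧ x₄.1.1 = K₄
  · obtain ⟨⟨I₁, h₁⟩, c₁⟩ := x₁
    obtain ⟨⟨I₂, h₂⟩, c₂⟩ := x₂
    obtain ⟨⟨I₃, h₃⟩, c₃⟩ := x₃
    obtain ⟨⟨I₄, h₄⟩, c₄⟩ := x₄
    obtain ⟨rfl, rfl, rfl, rfl⟩ := h
    simp only [lamProj_basisVec₄_self]
    rw [← sum_comul₄_trivial_lamCoeff hq₀ hq₁]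
    simp only [Fintype.sum_prod_type, smul_eq_mul]
  · rw [lamProj_basisVec₄_ne _ _ _ _ _ _ _ _ _ _ _ _ _ _ h]
    refine Finset.sum_eq_zero fun c₁ _ => Finset.sum_eq_zero fun c₂ _ =>
      Finset.sum_eq_zero fun c₃ _ => Finset.sum_eq_zero fun c₄ _ => ?_
    rw [lamProj_basisVec₄_ne q α₁ α₂ α₃ α₄ K₁ K₂ K₃ K₄ J ⟨x₁.1, c₁⟩ ⟨x₂.1, c₂⟩ ⟨x₃.1, c₃⟩
      ⟨x₄.1, c₄⟩ h, smul_zero]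

/-- `haar` vanishes for non-zero `X`-spin, and at spin zero `λ` absorbs `X_0`. -/
theorem iotaTerm_eq (α₁ α₂ α₃ α₄ : Label) (K₁ K₂ K₃ K₄ J : ℕ) (v : VFour α₁ α₂ α₃ α₄)
    (A : MatIdx × MatIdx) :
    iotaTerm q α₁ α₂ α₃ α₄ K₁ K₂ K₃ K₄ J v A =
      lamProj q α₁ α₂ α₃ α₄ K₁ K₂ K₃ K₄ J (piU₄ q α₁ α₂ α₃ α₄ A.2 v) * (haar q A : ℂ) := by
  by_cases h : A.1.1 = 0
  · obtain ⟨⟨d, m, n⟩, B⟩ := A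
    simp only at h
    subst h
    rw [show m = 0 from Fin.fin_one_eq_zero m, show n = 0 from Fin.fin_one_eq_zero n, iotaTerm]
    congr 1
    exact LinearMap.congr_fun (lamProj_comp_piX₄ hq₀ hq₁ α₁ α₂ α₃ α₄ K₁ K₂ K₃ K₄ J) _
  · have : haar q A = 0 := by rw [haar, if_neg fun h' => h h'.1]
    rw [iotaTerm, this]; simp

end

end

end QLorentz

namespace QLorentz

noncomputable section

set_option linter.unusedSectionVars false

/-! ### Transformation of the intertwiners under the braiding -/

theorem Lam_eq_zero_of_left (q : ℝ) (α : Label) {J M N : ℕ} (L : ℕ) (h : ¬ Admissible N J M) :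
    Lam q α J M N L = 0 := by
  rw [Lam]
  simp [cg_of_not_admissible q h]

theorem Lam_eq_zero_of_right (q : ℝ) (α : Label) {J M L : ℕ} (N : ℕ) (h : ¬ Admissible J L M) :
    Lam q α J M N L = 0 := by
  rw [Lam]
  simp [cg_of_not_admissible q h]

theorem Lam_eq_zero_of_not_hasSpin_left (q : ℝ) {α : Label} {N : ℕ} (h : ¬ HasSpin α N)
    (J M L : ℕ) : Lam q α J M N L = 0 := by
  rw [Lam]
  have : ∀ i : Fin (N + 1), ¬ 2 * ((i : ℕ) : ℤ) - (N : ℤ) = α.twoN :=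
    fun i hi => h (hasSpin_of_weight hi)
  simp [this]

theorem Lam_eq_zero_of_not_hasSpin_right (q : ℝ) {α : Label} {L : ℕ} (h : ¬ HasSpin α L)
    (J M N : ℕ) : Lam q α J M N L = 0 := by
  rw [Lam]
  have : ∀ i : Fin (L + 1), ¬ 2 * ((i : ℕ) : ℤ) - (L : ℤ) = α.twoN :=
    fun i hi => h (hasSpin_of_weight hi)
  simp [this]

theorem Lam_eq_zero_of_lt (q : ℝ) (α : Label) {J M L : ℕ} (N : ℕ) (h : J + M < L) :
    Lam q α J M N L = 0 :=
  Lam_eq_zero_of_right q α N fun h' => by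
    have := h'.2.2.2
    omega

theorem finite_Lam_ne_zero (q : ℝ) (α : Label) (J M N : ℕ) :
    {L : ℕ | Lam q α J M N L ≠ 0}.Finite := by
  refine (Finset.range (J + M + 1)).finite_toSet.subset fun L hL => ?_
  rw [Finset.mem_coe, Finset.mem_range]
  by_contra h
  exact hL (Lam_eq_zero_of_lt q α N (by omega))

theorem piCoeff_eq_zero_of_lt (q : ℝ) (α : Label) (B : MatIdx) {N L : ℕ} (h : 2 * B.1 + L < N)
    (c' : Fin (N + 1)) (c : Fin (L + 1)) : piCoeff q α B N L c' c = 0 := by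
  refine Finset.sum_eq_zero fun M hM => Finset.sum_eq_zero fun m _ => ?_
  have hM := Finset.mem_range.1 hM
  rw [Lam_eq_zero_of_left, mul_zero]
  intro h'
  have := h'.2.2.1
  omega

theorem proj_piU (q : ℝ) (α : Label) (B : MatIdx) (x : Idx α) (N : ℕ) :
    proj α N (piU q α B (basisVec α x)) = fun c' => piCoeff q α B N x.1.1 c' x.2 := by
  classical
  ext c'
  by_cases hN : HasSpin α N
  · rw [piU_basisVec, map_sum]
    have h1 : ∀ N', N' ≠ N → proj α N (if h : HasSpin α N' then
        ∑ c' : Fin (N' + 1), piCoeff q α B N' x.1.1 c' x.2 • basisVec α ⟨⟨N', h⟩, c'⟩ else 0) = 0 := by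
      intro N' hne
      split_ifs with h
      · rw [map_sum]
        exact Finset.sum_eq_zero fun c' _ => by rw [map_smul, proj_basisVec_ne α hne, smul_zero]
      · rw [map_zero]
    by_cases hr : N < 2 * B.1 + x.1.1 + 1
    · rw [Finset.sum_eq_single N]
      · rw [dif_pos hN, map_sum, Finset.sum_apply, Finset.sum_eq_single c']
        · rw [map_smul, proj_basisVec_self]; simp
        · intro d _ hd
          rw [map_smul, proj_basisVec_self]; simp [hd.symm]
        · simp
      · intro N' _ hne; exact h1 N' hne
      · intro h; exact absurd (Finset.mem_range.2 hr) h
    · rw [piCoeff_eq_zero_of_lt q α B (by omega), Finset.sum_eq_zero]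
      · rfl
      · intro N' hN'
        have := Finset.mem_range.1 hN'
        exact h1 N' (by omega)
  · rw [proj, dif_neg hN]
    refine (Finset.sum_eq_zero fun M _ => Finset.sum_eq_zero fun m _ => ?_).symm
    rw [Lam_eq_zero_of_not_hasSpin_left q hN, mul_zero]

theorem cgProj_apply (q : ℝ) (a b c : ℕ) (v : VSpin a) (w : VSpin b) (k : Fin (c + 1)) :
    cgProj q a b c (v ⊗ₜ w) k = ∑ i, ∑ j, (cg q a b c i j k : ℂ) * (v i * w j) := by
  rw [cgProj, TensorProduct.lift.tmul, LinearMap.mk₂_apply]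

theorem braid_basisVec (q : ℝ) (α β : Label) (x : Idx α) (w : VRep β) :
    braid q α β (basisVec α x ⊗ₜ w) =
      ∑ m, piU q β ⟨x.1.1, m, x.2⟩ w ⊗ₜ basisVec α ⟨x.1, m⟩ := by
  rw [braid, LinearMap.comp_apply, rAct_basisVec, map_sum]
  rfl

section

variable {q : ℝ} (hq₀ : 0 < q) (hq₁ : q < 1)
include hq₀ hq₁

/-- The matrix element is a sum over channels `M` beginning with `C^{NI}_M`; contraction with
`C^J_{NI}` leaves only `M = J`. This is where the coefficient of the proposition appears. -/
theorem sum_cg_piCoeff (α : Label) (I J K N : ℕ) (n : Fin (I + 1)) (c : Fin (K + 1))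
    (k : Fin (J + 1)) :
    ∑ c', ∑ m, (cg q N I J c' m k : ℂ) * piCoeff q α ⟨I, m, n⟩ N K c' c =
      Lam q α I J N K * (cg q I K J n c k : ℂ) := by
  by_cases h : Admissible N I J
  · by_cases h' : Admissible I K J
    · have := sum_cg_smul_expansion hq₀ hq₁ h (s := Finset.range (I + K + 1))
        (Finset.mem_range.2 (Nat.lt_succ_of_le h'.2.1))
        (fun M r => Lam q α I M N K * (cg q I K M n c r : ℂ)) k
      rw [← this]
      refine Finset.sum_congr rfl fun c' _ => Finset.sum_congr rfl fun m _ => ?_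
      rw [smul_eq_mul, piCoeff]
      congr 1
      refine Finset.sum_congr rfl fun M _ => Finset.sum_congr rfl fun r _ => ?_
      rw [smul_eq_mul]; push_cast; ring
    · rw [cg_of_not_admissible q h', Complex.ofReal_zero, mul_zero]
      simp only [piCoeff, Finset.mul_sum]
      rw [← Fintype.sum_prod_type' (f := fun c' m => ∑ M ∈ Finset.range (I + K + 1),
        ∑ r : Fin (M + 1), (cg q N I J c' m k : ℂ) *
          (((cg q N I M c' m r * cg q I K M n c r : ℝ) : ℂ) * Lam q α I M N K)), Finset.sum_comm]
      refine Finset.sum_eq_zero fun M _ => ?_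
      rw [Finset.sum_comm]
      refine Finset.sum_eq_zero fun r _ => ?_
      by_cases hM : M = J
      · subst hM
        exact Finset.sum_eq_zero fun x _ => by rw [cg_of_not_admissible q h']; simp
      · have h0 := sum_cg_mul_of_ne hq₀ hq₁ N I (Ne.symm hM) k r
        rw [← Fintype.sum_prod_type' (f := fun i j => cg q N I J i j k * cg q N I M i j r)] at h0
        have h1 := congrArg (fun z : ℝ => (z : ℂ) * ((cg q I K M n c r : ℂ) * Lam q α I M N K)) h0
        simp only [Complex.ofReal_sum, Finset.sum_mul, Complex.ofReal_zero, zero_mul] at h1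
        rw [← h1]
        exact Finset.sum_congr rfl fun x _ => by push_cast; ring
  · rw [Lam_eq_zero_of_left q α K h, zero_mul]
    simp [cg_of_not_admissible q h]

/-- The `R`-matrix fixes the spin of the first factor, so `K₂` is untouched, while `π_β(u)` can
bring any component `V_K` into `V_{K₁}`. The cutoff `K ≤ K₂ + J` loses nothing because `Λ` vanishes
beyond it. -/
theorem cgProj_comp_braid (α β : Label) (K₁ K₂ J : ℕ) :
    cgProj q K₁ K₂ J ∘ₗ TensorProduct.map (proj β K₁) (proj α K₂) ∘ₗ braid q α β =
      ∑ K ∈ Finset.range (K₂ + J + 1), Lam q β K₂ J K₁ K •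
        (cgProj q K₂ K J ∘ₗ TensorProduct.map (proj α K₂) (proj β K)) := by
  refine tensor_ext_basisVec (E := VRep β) (F := VSpin J) fun x w => ?_
  suffices h : ∀ y, (cgProj q K₁ K₂ J ∘ₗ TensorProduct.map (proj β K₁) (proj α K₂) ∘ₗ
      braid q α β) (basisVec α x ⊗ₜ basisVec β y) =
      (∑ K ∈ Finset.range (K₂ + J + 1), Lam q β K₂ J K₁ K •
        (cgProj q K₂ K J ∘ₗ TensorProduct.map (proj α K₂) (proj β K)))
        (basisVec α x ⊗ₜ basisVec β y) by
    have h' : (cgProj q K₁ K₂ J ∘ₗ TensorProduct.map (proj β K₁) (proj α K₂) ∘ₗ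
        braid q α β) ∘ₗ TensorProduct.mk ℂ (VRep α) (VRep β) (basisVec α x) =
        (∑ K ∈ Finset.range (K₂ + J + 1), Lam q β K₂ J K₁ K •
        (cgProj q K₂ K J ∘ₗ TensorProduct.map (proj α K₂) (proj β K))) ∘ₗ
        TensorProduct.mk ℂ (VRep α) (VRep β) (basisVec α x) :=
      Finsupp.lhom_ext' fun y => LinearMap.ext_ring (h y)
    exact LinearMap.congr_fun h' w
  intro y
  obtain ⟨⟨I, hI⟩, n⟩ := x
  obtain ⟨⟨K, hK⟩, c⟩ := y
  simp only [LinearMap.comp_apply, braid_basisVec, map_sum, TensorProduct.map_tmul,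
    LinearMap.sum_apply, LinearMap.smul_apply, proj_piU]
  by_cases hIK : I = K₂
  · subst hIK
    simp only [proj_basisVec_self]
    have hR : ∑ K' ∈ Finset.range (I + J + 1), Lam q β I J K₁ K' •
        cgProj q I K' J (Pi.single n 1 ⊗ₜ[ℂ] proj β K' (basisVec β ⟨⟨K, hK⟩, c⟩)) =
        fun k => Lam q β I J K₁ K * (cg q I K J n c k : ℂ) := by
      by_cases hr : K < I + J + 1
      · rw [Finset.sum_eq_single K]
        · rw [proj_basisVec_self, cgProj_single]; rfl
        · intro K' _ hne
          rw [proj_basisVec_ne β hne.symm, TensorProduct.tmul_zero, map_zero, smul_zero]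
        · intro h; exact absurd (Finset.mem_range.2 hr) h
      · rw [Lam_eq_zero_of_lt q β K₁ (by omega), Finset.sum_eq_zero]
        · ext k; simp
        · intro K' hK'
          have := Finset.mem_range.1 hK'
          rw [proj_basisVec_ne β (by omega), TensorProduct.tmul_zero, map_zero, smul_zero]
    rw [hR]
    ext k
    rw [Finset.sum_apply, ← sum_cg_piCoeff hq₀ hq₁, Finset.sum_comm]
    refine Finset.sum_congr rfl fun m _ => ?_
    rw [cgProj_apply]
    refine Finset.sum_congr rfl fun c' _ => ?_
    rw [Finset.sum_eq_single m]
    · simp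
    · intro j _ hj; simp [hj]
    · simp
  · rw [Finset.sum_eq_zero, Finset.sum_eq_zero]
    · intro K' _
      rw [proj_basisVec_ne α hIK, TensorProduct.zero_tmul, map_zero, smul_zero]
    · intro m _
      rw [proj_basisVec_ne α hIK, TensorProduct.tmul_zero, map_zero]

omit hq₀ hq₁ in
theorem lamProj_eq (α₁ α₂ α₃ α₄ : Label) (K₁ K₂ K₃ K₄ J : ℕ) :
    lamProj q α₁ α₂ α₃ α₄ K₁ K₂ K₃ K₄ J = contractLeft ℂ (VSpin J) ∘ₗ
      TensorProduct.map
        (epsMap q J ∘ₗ (cgProj q K₁ K₂ J ∘ₗ TensorProduct.map (proj α₁ K₁) (proj α₂ K₂)))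
        (cgProj q K₃ K₄ J ∘ₗ TensorProduct.map (proj α₃ K₃) (proj α₄ K₄)) := by
  rw [lamProj, lambdaMap, proj₄, LinearMap.comp_assoc, ← TensorProduct.map_comp]
  rfl

theorem lamProj_comp_braid₁₂ (α β α₃ α₄ : Label) (K₁ K₂ K₃ K₄ J : ℕ) :
    lamProj q β α α₃ α₄ K₁ K₂ K₃ K₄ J ∘ₗ braid₁₂ q α β α₃ α₄ =
      ∑ K ∈ Finset.range (K₂ + J + 1), Lam q β K₂ J K₁ K •
        lamProj q α β α₃ α₄ K₂ K K₃ K₄ J := by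
  refine TensorProduct.ext' fun v w => ?_
  have h := LinearMap.congr_fun (cgProj_comp_braid hq₀ hq₁ α β K₁ K₂ J) v
  simp only [LinearMap.comp_apply, LinearMap.sum_apply, LinearMap.smul_apply] at h
  simp only [lamProj_eq, LinearMap.comp_apply, LinearMap.sum_apply, LinearMap.smul_apply, braid₁₂,
    TensorProduct.map_tmul, h, map_sum, map_smul, LinearMap.id_apply, contractLeft_apply]

theorem iotaTerm_braid₁₂ (α β α₃ α₄ : Label) (K₁ K₂ K₃ K₄ J : ℕ) (v : VFour α β α₃ α₄)
    (A : MatIdx × MatIdx) :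
    iotaTerm q β α α₃ α₄ K₁ K₂ K₃ K₄ J (braid₁₂ q α β α₃ α₄ v) A =
      ∑ K ∈ Finset.range (K₂ + J + 1), Lam q β K₂ J K₁ K *
        iotaTerm q α β α₃ α₄ K₂ K K₃ K₄ J v A := by
  have h1 := LinearMap.congr_fun (braid₁₂_comp_piU₄ hq₀ hq₁ α β α₃ α₄ A.2) v
  have h2 := LinearMap.congr_fun (lamProj_comp_braid₁₂ hq₀ hq₁ α β α₃ α₄ K₁ K₂ K₃ K₄ J)
    (piU₄ q α β α₃ α₄ A.2 v)
  simp only [LinearMap.comp_apply, LinearMap.sum_apply, LinearMap.smul_apply, smul_eq_mul] at h1 h2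
  simp only [iotaTerm_eq hq₀ hq₁]
  rw [← h1, h2, Finset.sum_mul]
  exact Finset.sum_congr rfl fun K _ => by ring

end

end

end QLorentz

namespace QLorentz

noncomputable section

set_option linter.unusedSectionVars false

/-! ### Convergence of the series -/

theorem norm_phase {q : ℝ} (hq₀ : 0 < q) (p x : ℝ) : ‖phase q p x‖ = 1 := by
  rw [phase, Complex.norm_cpow_eq_rpow_re_of_pos hq₀]
  simp

/-- The expansion of `λ_{[K],J}` in coordinates. -/
theorem lambdaMap_tmul (q : ℝ) (K₁ K₂ K₃ K₄ J : ℕ) (f₁ : VSpin K₁) (f₂ : VSpin K₂) (f₃ : VSpin K₃)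
    (f₄ : VSpin K₄) :
    lambdaMap q K₁ K₂ K₃ K₄ J ((f₁ ⊗ₜ f₂) ⊗ₜ (f₃ ⊗ₜ f₄)) =
      ∑ c₁, ∑ c₂, ∑ c₃, ∑ c₄, (lamCoeff q K₁ K₂ K₃ K₄ J (c₁, c₂) (c₃, c₄) : ℂ) *
        (f₁ c₁ * f₂ c₂ * (f₃ c₃ * f₄ c₄)) := by
  have e : ∀ {K : ℕ} (f : VSpin K), f = ∑ c, f c • (Pi.single c 1 : VSpin K) := fun f => by
    exact pi_eq_sum_univ' f
  conv_lhs => rw [e f₁]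
  simp only [TensorProduct.sum_tmul, ← TensorProduct.smul_tmul', map_sum, map_smul]
  refine Finset.sum_congr rfl fun c₁ _ => ?_
  conv_lhs => rw [e f₂]
  simp only [TensorProduct.sum_tmul, TensorProduct.tmul_sum, ← TensorProduct.smul_tmul',
    TensorProduct.tmul_smul, map_sum, map_smul, Finset.smul_sum]
  refine Finset.sum_congr rfl fun c₂ _ => ?_
  conv_lhs => rw [e f₃]
  simp only [TensorProduct.sum_tmul, TensorProduct.tmul_sum, ← TensorProduct.smul_tmul',
    TensorProduct.tmul_smul, map_sum, map_smul, Finset.smul_sum]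
  refine Finset.sum_congr rfl fun c₃ _ => ?_
  conv_lhs => rw [e f₄]
  simp only [TensorProduct.tmul_sum, TensorProduct.tmul_smul, map_sum, map_smul,
    lambdaMap_single, smul_eq_mul, Finset.mul_sum]
  exact Finset.sum_congr rfl fun c₄ _ => by ring

theorem lamProj_piU₄ (q : ℝ) (α₁ α₂ α₃ α₄ : Label) (K₁ K₂ K₃ K₄ J : ℕ) (B : MatIdx)
    (x₁ : Idx α₁) (x₂ : Idx α₂) (x₃ : Idx α₃) (x₄ : Idx α₄) :
    lamProj q α₁ α₂ α₃ α₄ K₁ K₂ K₃ K₄ J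
      (piU₄ q α₁ α₂ α₃ α₄ B (basisVec₄ α₁ α₂ α₃ α₄ x₁ x₂ x₃ x₄)) =
      ∑ b₁, ∑ b₂, ∑ b₃, ∑ c₁, ∑ c₂, ∑ c₃, ∑ c₄,
        (lamCoeff q K₁ K₂ K₃ K₄ J (c₁, c₂) (c₃, c₄) : ℂ) *
        (piCoeff q α₁ ⟨B.1, b₁, B.2.2⟩ K₁ x₁.1.1 c₁ x₁.2 *
          piCoeff q α₂ ⟨B.1, b₂, b₁⟩ K₂ x₂.1.1 c₂ x₂.2 *
          (piCoeff q α₃ ⟨B.1, b₃, b₂⟩ K₃ x₃.1.1 c₃ x₃.2 *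
          piCoeff q α₄ ⟨B.1, B.2.1, b₃⟩ K₄ x₄.1.1 c₄ x₄.2)) := by
  simp only [piU₄, LinearMap.sum_apply, map_sum, basisVec₄, TensorProduct.map_tmul, lamProj,
    LinearMap.comp_apply, proj₄, proj_piU, lambdaMap_tmul]

section

variable {q : ℝ} (hq₀ : 0 < q) (hq₁ : q < 1)
include hq₀ hq₁

/-- The phases have modulus one, as `p` is real, and the Clebsch-Gordan coefficients are at most
one; the decay comes from `1/[M+1] ≤ q^M`. -/
theorem norm_Lam_le (α : Label) (J M N L : ℕ) :
    ‖Lam q α J M N L‖ ≤ Real.sqrt (qnum q ((N : ℝ) + 1) * qnum q ((L : ℝ) + 1)) * q ^ M *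
      ((J + 1) * ((N + 1) * ((L + 1) * (M + 1)))) := by
  have hM : q ^ (-(M : ℝ)) ≤ qnum q ((M : ℝ) + 1) := rpow_le_qnum hq₀ hq₁ (by positivity)
  have hM' : (qnum q ((M : ℝ) + 1))⁻¹ ≤ q ^ M := by
    rw [Real.rpow_neg hq₀.le, Real.rpow_natCast] at hM
    exact inv_le_of_inv_le₀ (by positivity) hM
  rw [Lam, norm_mul]
  refine mul_le_mul ?_ ?_ (norm_nonneg _) (by positivity)
  · rw [Complex.norm_real, Real.norm_of_nonneg, div_eq_mul_inv]
    · exact mul_le_mul_of_nonneg_left hM' (Real.sqrt_nonneg _)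
    · exact div_nonneg (Real.sqrt_nonneg _) (qnum_nonneg hq₀ hq₁ (by positivity))
  · have h1 : ∀ (s : Fin (J + 1)) (i : Fin (N + 1)) (l : Fin (L + 1)) (k : Fin (M + 1)),
        ‖(if 2 * ((i : ℕ) : ℤ) - (N : ℤ) = α.twoN ∧ 2 * ((l : ℕ) : ℤ) - (L : ℤ) = α.twoN then
          ((cg q N J M i s k * cg q J L M s l k : ℝ) : ℂ) else 0)‖ ≤ 1 := by
      intro s i l k
      split_ifs
      · rw [Complex.norm_real, Real.norm_eq_abs, abs_mul]
        exact mul_le_one₀ (abs_cg_le_one hq₀ hq₁ ..) (abs_nonneg _) (abs_cg_le_one hq₀ hq₁ ..)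
      · simp
    have h2 : ∀ s : Fin (J + 1), ‖(q : ℂ) ^ (Complex.I * (α.p : ℂ) * (wt J s : ℂ)) *
        ∑ i : Fin (N + 1), ∑ l : Fin (L + 1), ∑ k : Fin (M + 1),
        (if 2 * ((i : ℕ) : ℤ) - (N : ℤ) = α.twoN ∧ 2 * ((l : ℕ) : ℤ) - (L : ℤ) = α.twoN then
          ((cg q N J M i s k * cg q J L M s l k : ℝ) : ℂ) else 0)‖ ≤
        ∑ i : Fin (N + 1), ∑ l : Fin (L + 1), ∑ k : Fin (M + 1), (1 : ℝ) := by
      intro s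
      rw [norm_mul, ← phase, norm_phase hq₀, one_mul]
      exact norm_sum_le_of_le _ fun i _ => norm_sum_le_of_le _ fun l _ =>
        norm_sum_le_of_le _ fun k _ => h1 s i l k
    refine (norm_sum_le_of_le _ fun s _ => h2 s).trans_eq ?_
    simp only [Finset.sum_const, Finset.card_univ, Fintype.card_fin, nsmul_eq_mul]
    push_cast; ring

/-- The triangle inequality gives `M ≥ J - L`, which turns decay in `M` into decay in `J`. The power
`4` counts the sums over `M` and `m` and the two polynomial factors of `norm_Lam_le` that grow with
`J`. -/
theorem exists_norm_piCoeff_le (α : Label) (N L : ℕ) : ∃ C : ℝ, 0 ≤ C ∧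
    ∀ (B : MatIdx) (c' : Fin (N + 1)) (c : Fin (L + 1)),
      ‖piCoeff q α B N L c' c‖ ≤ C * (((B.1 : ℝ) + 1) ^ 4 * q ^ B.1) := by
  set S := Real.sqrt (qnum q ((N : ℝ) + 1) * qnum q ((L : ℝ) + 1)) with hS
  have hS0 : 0 ≤ S := Real.sqrt_nonneg _
  refine ⟨S * (q ^ L)⁻¹ * ((N + 1) * (L + 1) ^ 4), by positivity, fun B c' c => ?_⟩
  obtain ⟨J, a, b⟩ := B
  simp only [piCoeff]
  set R : ℝ := (L + 1) * (J + 1) with hR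
  have hR0 : 0 ≤ R := by positivity
  have key : ∀ M ∈ Finset.range (J + L + 1), ∀ m ∈ (Finset.univ : Finset (Fin (M + 1))),
      ‖((cg q N J M c' a m * cg q J L M b c m : ℝ) : ℂ) * Lam q α J M N L‖ ≤
        S * (q ^ J * (q ^ L)⁻¹) * ((J + 1) * ((N + 1) * ((L + 1) * R))) := by
    intro M hM m _
    have hM := Finset.mem_range.1 hM
    have hMR : (M : ℝ) + 1 ≤ R := by
      have : (M : ℝ) ≤ J + L := by exact_mod_cast (by omega : M ≤ J + L)
      rw [hR]; nlinarith [(Nat.cast_nonneg L : (0 : ℝ) ≤ L), (Nat.cast_nonneg J : (0 : ℝ) ≤ J)]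
    by_cases h : Admissible J L M
    · have hq : q ^ M ≤ q ^ J * (q ^ L)⁻¹ := by
        rw [← div_eq_mul_inv, le_div_iff₀ (by positivity), ← pow_add]
        exact pow_le_pow_of_le_one hq₀.le hq₁.le (by have := h.2.2.1; omega)
      rw [norm_mul]
      have h1 : ‖((cg q N J M c' a m * cg q J L M b c m : ℝ) : ℂ)‖ ≤ 1 := by
        rw [Complex.norm_real, Real.norm_eq_abs, abs_mul]
        exact mul_le_one₀ (abs_cg_le_one hq₀ hq₁ ..) (abs_nonneg _) (abs_cg_le_one hq₀ hq₁ ..)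
      calc _ ≤ 1 * ‖Lam q α J M N L‖ := by gcongr
        _ ≤ _ := by
          rw [one_mul]
          refine (norm_Lam_le hq₀ hq₁ α J M N L).trans ?_
          rw [← hS]
          gcongr
    · rw [Lam_eq_zero_of_right q α N h, mul_zero, norm_zero]
      positivity
  have key2 : ∀ M ∈ Finset.range (J + L + 1), ‖∑ m : Fin (M + 1),
      ((cg q N J M c' a m * cg q J L M b c m : ℝ) : ℂ) * Lam q α J M N L‖ ≤
        R * (S * (q ^ J * (q ^ L)⁻¹) * ((J + 1) * ((N + 1) * ((L + 1) * R)))) := by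
    intro M hM
    refine (norm_sum_le_of_le _ (key M hM)).trans ?_
    have hM := Finset.mem_range.1 hM
    have hMR : (M : ℝ) + 1 ≤ R := by
      have : (M : ℝ) ≤ J + L := by exact_mod_cast (by omega : M ≤ J + L)
      rw [hR]; nlinarith [(Nat.cast_nonneg L : (0 : ℝ) ≤ L), (Nat.cast_nonneg J : (0 : ℝ) ≤ J)]
    rw [Finset.sum_const, Finset.card_univ, Fintype.card_fin, nsmul_eq_mul]
    push_cast
    gcongr
  refine (norm_sum_le_of_le _ key2).trans ?_
  rw [Finset.sum_const, Finset.card_range, nsmul_eq_mul]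
  have hJL : ((J + L + 1 : ℕ) : ℝ) ≤ R := by
    rw [hR]; push_cast
    nlinarith [(Nat.cast_nonneg L : (0 : ℝ) ≤ L), (Nat.cast_nonneg J : (0 : ℝ) ≤ J)]
  calc _ ≤ R * (R * (S * (q ^ J * (q ^ L)⁻¹) * ((J + 1) * ((N + 1) * ((L + 1) * R))))) := by gcongr
    _ = _ := by rw [hR]; ring

/-- Four matrix elements contribute degree `16`, the three intermediate indices of the coproduct
degree `3`. -/
theorem exists_norm_lamProj_piU₄_le (α₁ α₂ α₃ α₄ : Label) (K₁ K₂ K₃ K₄ J : ℕ)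
    (x₁ : Idx α₁) (x₂ : Idx α₂) (x₃ : Idx α₃) (x₄ : Idx α₄) : ∃ C : ℝ, 0 ≤ C ∧ ∀ B : MatIdx,
      ‖lamProj q α₁ α₂ α₃ α₄ K₁ K₂ K₃ K₄ J
        (piU₄ q α₁ α₂ α₃ α₄ B (basisVec₄ α₁ α₂ α₃ α₄ x₁ x₂ x₃ x₄))‖ ≤
      C * (((B.1 : ℝ) + 1) ^ 19 * q ^ (4 * B.1)) := by
  obtain ⟨C₁, h₁, hC₁⟩ := exists_norm_piCoeff_le hq₀ hq₁ α₁ K₁ x₁.1.1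
  obtain ⟨C₂, h₂, hC₂⟩ := exists_norm_piCoeff_le hq₀ hq₁ α₂ K₂ x₂.1.1
  obtain ⟨C₃, h₃, hC₃⟩ := exists_norm_piCoeff_le hq₀ hq₁ α₃ K₃ x₃.1.1
  obtain ⟨C₄, h₄, hC₄⟩ := exists_norm_piCoeff_le hq₀ hq₁ α₄ K₄ x₄.1.1
  refine ⟨(∑ c₁, ∑ c₂, ∑ c₃, ∑ c₄, ‖(lamCoeff q K₁ K₂ K₃ K₄ J (c₁, c₂) (c₃, c₄) : ℂ)‖) *
    (C₁ * C₂ * (C₃ * C₄)), by positivity, fun B => ?_⟩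
  rw [lamProj_piU₄]
  have key : ∀ (b₁ b₂ b₃ : Fin (B.1 + 1)) (c₁ : Fin (K₁ + 1)) (c₂ : Fin (K₂ + 1))
      (c₃ : Fin (K₃ + 1)) (c₄ : Fin (K₄ + 1)),
      ‖(lamCoeff q K₁ K₂ K₃ K₄ J (c₁, c₂) (c₃, c₄) : ℂ) *
        (piCoeff q α₁ ⟨B.1, b₁, B.2.2⟩ K₁ x₁.1.1 c₁ x₁.2 *
          piCoeff q α₂ ⟨B.1, b₂, b₁⟩ K₂ x₂.1.1 c₂ x₂.2 *
          (piCoeff q α₃ ⟨B.1, b₃, b₂⟩ K₃ x₃.1.1 c₃ x₃.2 *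
          piCoeff q α₄ ⟨B.1, B.2.1, b₃⟩ K₄ x₄.1.1 c₄ x₄.2))‖ ≤
      ‖(lamCoeff q K₁ K₂ K₃ K₄ J (c₁, c₂) (c₃, c₄) : ℂ)‖ *
        ((C₁ * (((B.1 : ℝ) + 1) ^ 4 * q ^ B.1)) * (C₂ * (((B.1 : ℝ) + 1) ^ 4 * q ^ B.1)) *
        ((C₃ * (((B.1 : ℝ) + 1) ^ 4 * q ^ B.1)) * (C₄ * (((B.1 : ℝ) + 1) ^ 4 * q ^ B.1)))) := by
    intro b₁ b₂ b₃ c₁ c₂ c₃ c₄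
    simp only [norm_mul]
    gcongr
    · exact hC₁ ⟨B.1, b₁, B.2.2⟩ c₁ x₁.2
    · exact hC₂ ⟨B.1, b₂, b₁⟩ c₂ x₂.2
    · exact hC₃ ⟨B.1, b₃, b₂⟩ c₃ x₃.2
    · exact hC₄ ⟨B.1, B.2.1, b₃⟩ c₄ x₄.2
  refine (norm_sum_le_of_le _ fun b₁ _ => norm_sum_le_of_le _ fun b₂ _ =>
    norm_sum_le_of_le _ fun b₃ _ => norm_sum_le_of_le _ fun c₁ _ => norm_sum_le_of_le _ fun c₂ _ =>
    norm_sum_le_of_le _ fun c₃ _ => norm_sum_le_of_le _ fun c₄ _ =>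
      key b₁ b₂ b₃ c₁ c₂ c₃ c₄).trans_eq ?_
  simp only [← Finset.sum_mul, Finset.sum_const, Finset.card_univ, Fintype.card_fin, nsmul_eq_mul]
  push_cast
  ring

/-- The `q`-dimension and the factor `q^{-2a}` each grow at most like `q^{-d}`, up to a polynomial,
where `d` is twice the spin. -/
theorem abs_haar_le (A : MatIdx × MatIdx) :
    |haar q A| ≤ if A.1.1 = 0 then ((A.2.1 : ℝ) + 1) * (q ^ (2 * A.2.1))⁻¹ else 0 := by
  rw [haar]
  by_cases h : A.1.1 = 0
  · rw [if_pos h]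
    have hw : ∀ i : Fin (A.2.1 + 1), q ^ (-2 * wt A.2.1 i) ≤ (q ^ A.2.1)⁻¹ := fun i => by
      rw [← Real.rpow_natCast, ← Real.rpow_neg hq₀.le]
      refine Real.rpow_le_rpow_of_exponent_ge hq₀ hq₁.le ?_
      have : (i : ℝ) ≤ A.2.1 := by exact_mod_cast Nat.le_of_lt_succ i.2
      simp only [wt]; linarith
    have hn : qnum q ((A.2.1 : ℝ) + 1) ≤ (A.2.1 + 1) * (q ^ A.2.1)⁻¹ := by
      rw [← sum_rpow_wt' hq₀ hq₁]
      refine (Finset.sum_le_sum fun i _ => (?_ : _ ≤ (q ^ A.2.1)⁻¹)).trans_eq (by simp)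
      have := hw i.rev
      rwa [wt_rev, neg_mul_neg] at this
    have h0 : 0 ≤ qnum q ((A.2.1 : ℝ) + 1) := qnum_nonneg hq₀ hq₁ (by positivity)
    split_ifs with h'
    · rw [abs_of_nonneg (by positivity), two_mul, pow_add, mul_inv, ← mul_assoc]
      have := hw A.2.2.1
      gcongr
    · rw [abs_zero]; positivity
  · rw [if_neg h, if_neg fun h' => h h'.1, abs_zero]

/-- Degree `20` is `19` plus one from the Haar weight; summing over the two matrix indices of a
given spin raises it to `22`. -/
theorem summable_iota_bound : Summable fun A : MatIdx × MatIdx =>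
    (if A.1.1 = 0 then (1 : ℝ) else 0) * (((A.2.1 : ℝ) + 1) ^ 20 * q ^ (2 * A.2.1)) := by
  have h1 : Summable fun A : MatIdx => if A.1 = 0 then (1 : ℝ) else 0 :=
    summable_of_ne_finset_zero (s := idxLE 0) fun A hA => by
      rw [mem_idxLE] at hA
      rw [if_neg (by omega)]
  have h2 : Summable fun A : MatIdx => ((A.1 : ℝ) + 1) ^ 20 * q ^ (2 * A.1) := by
    refine (summable_sigma_of_nonneg fun A => by positivity).2
      ⟨fun d => Summable.of_finite, ?_⟩
    have h3 : ∀ d : ℕ, ∑' _ : Fin (d + 1) × Fin (d + 1), ((d : ℝ) + 1) ^ 20 * q ^ (2 * d) =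
        (q ^ 2)⁻¹ * (((d + 1 : ℕ) : ℝ) ^ 22 * (q ^ 2) ^ (d + 1)) := fun d => by
      rw [tsum_fintype]
      simp only [Finset.sum_const, Finset.card_univ, Fintype.card_prod, Fintype.card_fin,
        nsmul_eq_mul]
      push_cast
      field_simp
      ring
    simp only [h3]
    refine Summable.mul_left _ ?_
    refine (summable_nat_add_iff (f := fun d : ℕ => (d : ℝ) ^ 22 * (q ^ 2) ^ d) 1).2 ?_
    refine summable_pow_mul_geometric_of_norm_lt_one 22 ?_
    rw [Real.norm_of_nonneg (by positivity)]
    exact pow_lt_one₀ hq₀.le hq₁ two_ne_zero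
  exact h1.mul_of_nonneg h2 (fun A => by positivity) fun A => by positivity

/-- On basis vectors, `q^{4d}` from the four matrix elements outweighs `q^{-2d}` from the Haar
weight. Finite linear combinations preserve absolute convergence. -/
theorem iotaConverges (α₁ α₂ α₃ α₄ : Label) (K₁ K₂ K₃ K₄ J : ℕ) :
    IotaConverges q α₁ α₂ α₃ α₄ K₁ K₂ K₃ K₄ J := by
  have hb : ∀ x₁ x₂ x₃ x₄, Summable fun A => ‖iotaTerm q α₁ α₂ α₃ α₄ K₁ K₂ K₃ K₄ J
      (basisVec₄ α₁ α₂ α₃ α₄ x₁ x₂ x₃ x₄) A‖ := by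
    intro x₁ x₂ x₃ x₄
    obtain ⟨C, hC, h⟩ := exists_norm_lamProj_piU₄_le hq₀ hq₁ α₁ α₂ α₃ α₄ K₁ K₂ K₃ K₄ J x₁ x₂ x₃ x₄
    refine Summable.of_nonneg_of_le (fun A => norm_nonneg _) (fun A => ?_)
      ((summable_iota_bound hq₀ hq₁).mul_left C)
    rw [iotaTerm_eq hq₀ hq₁, norm_mul, Complex.norm_real, Real.norm_eq_abs]
    calc _ ≤ C * (((A.2.1 : ℝ) + 1) ^ 19 * q ^ (4 * A.2.1)) *
        (if A.1.1 = 0 then ((A.2.1 : ℝ) + 1) * (q ^ (2 * A.2.1))⁻¹ else 0) :=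
          mul_le_mul (h A.2) (abs_haar_le hq₀ hq₁ A) (abs_nonneg _) (by positivity)
      _ = _ := by
        split_ifs
        · rw [show 4 * A.2.1 = 2 * A.2.1 + 2 * A.2.1 by ring, pow_add q]
          field_simp
        · simp
  intro v
  have key : ∀ f, Summable fun A => ‖iotaTerm q α₁ α₂ α₃ α₄ K₁ K₂ K₃ K₄ J
      ((coords₄ α₁ α₂ α₃ α₄).symm f) A‖ := by
    intro f
    induction f using Finsupp.induction_linear with
    | zero =>
      refine summable_zero.congr fun A => ?_
      simp only [iotaTerm, LinearEquiv.map_zero, LinearMap.map_zero, zero_mul, norm_zero]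
    | add f g hf hg =>
      refine Summable.of_nonneg_of_le (fun A => norm_nonneg _) (fun A => ?_) (hf.add hg)
      rw [map_add]
      refine le_trans (le_of_eq ?_) (norm_add_le _ _)
      simp only [iotaTerm, map_add, add_mul]
    | single y a =>
      have e : (coords₄ α₁ α₂ α₃ α₄).symm (Finsupp.single y a) =
          a • basisVec₄ α₁ α₂ α₃ α₄ y.1.1 y.1.2 y.2.1 y.2.2 := by
        rw [LinearEquiv.symm_apply_eq]
        simp [coords₄, basisVec₄, basisVec, finsuppTensorFinsupp'_single_tmul_single]
      refine ((hb y.1.1 y.1.2 y.2.1 y.2.2).mul_left ‖a‖).congr fun A => ?_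
      rw [e, ← norm_mul]
      simp only [iotaTerm, map_smul, smul_eq_mul, mul_assoc]
  simpa using key (coords₄ α₁ α₂ α₃ α₄ v)

theorem iota_braid₁₂ (α β α₃ α₄ : Label) (K₁ K₂ K₃ K₄ J : ℕ) (v : VFour α β α₃ α₄) :
    iota q β α α₃ α₄ K₁ K₂ K₃ K₄ J (braid₁₂ q α β α₃ α₄ v) =
      ∑ᶠ K : ℕ, Lam q β K₂ J K₁ K * iota q α β α₃ α₄ K₂ K K₃ K₄ J v := by
  rw [finsum_eq_sum_of_support_subset (s := Finset.range (K₂ + J + 1))]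
  · simp only [iota, iotaTerm_braid₁₂ hq₀ hq₁]
    rw [Summable.tsum_finsetSum fun K _ =>
      ((iotaConverges hq₀ hq₁ α β α₃ α₄ K₂ K K₃ K₄ J v).of_norm).mul_left _]
    exact Finset.sum_congr rfl fun K _ => tsum_mul_left
  · intro K hK
    rw [Finset.mem_coe, Finset.mem_range]
    by_contra h
    exact hK (by simp only [Lam_eq_zero_of_lt q β K₁ (show K₂ + J < K by omega), zero_mul])

end

end

end QLorentz

namespace QLorentz

noncomputable section

set_option linter.unusedSectionVars false

/-! ### Adjoints of the operators `π_α(u_J^a_b)` -/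

theorem conj_phase {q : ℝ} (hq₀ : 0 < q) (p x : ℝ) :
    (starRingEnd ℂ) (phase q p x) = phase q p (-x) := by
  have h := Complex.cpow_conj (q : ℂ) (Complex.I * (p : ℂ) * (x : ℂ)) (by
    rw [Complex.arg_ofReal_of_nonneg hq₀.le]; exact Real.pi_ne_zero.symm)
  rw [Complex.conj_ofReal] at h
  rw [phase, phase, ← h]
  congr 1
  simp

/-- The coefficient of `q^{ips}` in the matrix element of `π_α(u_J^a_b)` between `e^K_c` and
`e^K_{c'}`; the index `n` is that of the weight which defines `V_α`. -/
def piKernel (q : ℝ) (J K : ℕ) (a b : Fin (J + 1)) (c' c n : Fin (K + 1)) (s : Fin (J + 1)) : ℝ :=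
  dualCoeff q J a * dualCoeff q J s * ∑ C ∈ idxLE (J + K),
    structConst q ⟨J, b, s⟩ ⟨K, c, n⟩ C * structConst q C ⟨J, a.rev, s.rev⟩ ⟨K, c', n⟩

section

variable {q : ℝ} (hq₀ : 0 < q) (hq₁ : q < 1)
include hq₀ hq₁

/-- Separates the dependence on `p` from a real kernel, so that complex conjugation acts on the
phases alone. -/
theorem piCoeff_eq_sum_phase (α : Label) (J K : ℕ) (a b : Fin (J + 1)) (c' c n : Fin (K + 1))
    (hn : 2 * ((n : ℕ) : ℤ) - (K : ℤ) = α.twoN) :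
    piCoeff q α ⟨J, a, b⟩ K K c' c =
      ∑ s, phase q α.p (wt J s) * (piKernel q J K a b c' c n s : ℂ) := by
  have h := theta_embVec_coeff hq₀ hq₁ α J K K a b c' n c
  rw [if_pos hn] at h
  have hs : (Real.sqrt (qnum q ((K : ℝ) + 1)) : ℂ) ≠ 0 := by
    exact_mod_cast (Real.sqrt_pos.2 (qnum_pos hq₀ hq₁ (by positivity))).ne'
  refine mul_right_cancel₀ hs (h.symm.trans ?_)
  rw [Finset.sum_mul]
  refine Finset.sum_congr rfl fun s _ => ?_
  have e : ∀ n' : Fin (K + 1), (∑ C ∈ idxLE (J + K),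
      (if 2 * ((n' : ℕ) : ℤ) - (K : ℤ) = α.twoN then
        phase q α.p (wt J s) * ((dualCoeff q J a * dualCoeff q J s : ℝ) : ℂ) *
        (Real.sqrt (qnum q ((K : ℝ) + 1)) : ℂ) *
        (structConst q ⟨J, b, s⟩ ⟨K, c, n'⟩ C : ℂ) *
        (structConst q C ⟨J, a.rev, s.rev⟩ ⟨K, c', n⟩ : ℂ) else 0)) =
      if 2 * ((n' : ℕ) : ℤ) - (K : ℤ) = α.twoN then ∑ C ∈ idxLE (J + K),
        phase q α.p (wt J s) * ((dualCoeff q J a * dualCoeff q J s : ℝ) : ℂ) *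
        (Real.sqrt (qnum q ((K : ℝ) + 1)) : ℂ) *
        (structConst q ⟨J, b, s⟩ ⟨K, c, n'⟩ C : ℂ) *
        (structConst q C ⟨J, a.rev, s.rev⟩ ⟨K, c', n⟩ : ℂ) else 0 := fun n' => by
    split_ifs <;> simp
  simp only [e]
  rw [sum_weight_ite hn, piKernel]
  push_cast
  rw [Finset.mul_sum, Finset.mul_sum, Finset.sum_mul]
  exact Finset.sum_congr rfl fun C _ => by ring

omit hq₁ in
theorem dualCoeff_ne_zero (J : ℕ) (a : Fin (J + 1)) : dualCoeff q J a ≠ 0 :=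
  mul_ne_zero (pow_ne_zero _ (by norm_num)) (Real.rpow_pos_of_pos hq₀ _).ne'

/-- In `u^b_s u^c_n (u^a_s)^*` the brackets are moved; then `cg_dual_mul`, in the form of
`dualCoeff_structConst`, trades multiplication by a matrix element for multiplication by its adjoint
on either side. -/
theorem piKernel_adjoint (J K : ℕ) (a b : Fin (J + 1)) (c' c n : Fin (K + 1)) (s : Fin (J + 1)) :
    piKernel q J K a b c' c n s =
      dualCoeff q J a / dualCoeff q J b * piKernel q J K a.rev b.rev c c' n s.rev := by
  have key : ∀ C : MatIdx, structConst q ⟨K, c, n⟩ ⟨J, a.rev, s.rev⟩ C *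
      structConst q ⟨J, b, s⟩ C ⟨K, c', n⟩ =
      dualCoeff q J a.rev * dualCoeff q J s.rev / (dualCoeff q J b * dualCoeff q J s) *
        (structConst q ⟨J, b.rev, s.rev⟩ ⟨K, c', n⟩ C *
        structConst q C ⟨J, a, s⟩ ⟨K, c, n⟩) := by
    rintro ⟨M, m, k⟩
    -- The ratio `[K+1]/[M+1]` occurs in both relations and cancels in the final combination.
    have h1 := dualCoeff_structConst hq₀ hq₁ K J M c n a.rev s.rev m k
    have h2 := dualCoeff_structConst hq₀ hq₁ K J M c'.rev n.rev b s m.rev k.rev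
    simp only [Fin.rev_rev] at h1
    have h3 : structConst q ⟨J, b, s⟩ ⟨M, m, k⟩ ⟨K, c', n⟩ =
        structConst q ⟨M, m.rev, k.rev⟩ ⟨J, b.rev, s.rev⟩ ⟨K, c'.rev, n.rev⟩ :=
      cg_flip_mul hq₀ hq₁ J M K b s m k c' n
    have h4 : structConst q ⟨J, b.rev, s.rev⟩ ⟨K, c', n⟩ ⟨M, m, k⟩ =
        cg q K J M c'.rev b m.rev * cg q K J M n.rev s k.rev := by
      have := cg_flip_mul hq₀ hq₁ J K M b.rev s.rev c' n m k
      simp only [Fin.rev_rev] at this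
      exact this
    have h5 : structConst q ⟨K, c, n⟩ ⟨J, a.rev, s.rev⟩ ⟨M, m, k⟩ =
        cg q K J M c a.rev m * cg q K J M n s.rev k := rfl
    rw [← h5] at h1
    rw [← h4] at h2
    rw [h3]
    have hK := qnum_succ_ne_zero hq₀ hq₁ K
    have hM := qnum_succ_ne_zero hq₀ hq₁ M
    have hb := dualCoeff_ne_zero hq₀ J b
    have hs := dualCoeff_ne_zero hq₀ J s
    generalize structConst q ⟨K, c, n⟩ ⟨J, a.rev, s.rev⟩ ⟨M, m, k⟩ = x1 at *
    generalize structConst q ⟨M, m.rev, k.rev⟩ ⟨J, b.rev, s.rev⟩ ⟨K, c'.rev, n.rev⟩ = x2 at *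
    generalize structConst q ⟨J, b.rev, s.rev⟩ ⟨K, c', n⟩ ⟨M, m, k⟩ = x3 at *
    generalize structConst q ⟨M, m, k⟩ ⟨J, a, s⟩ ⟨K, c, n⟩ = x4 at *
    rw [div_mul_eq_mul_div, eq_div_iff (mul_ne_zero hb hs)]
    linear_combination x1 * h2 - x3 * h1
  have ha := structConst_assoc hq₀ hq₁ ⟨J, b, s⟩ ⟨K, c, n⟩ ⟨J, a.rev, s.rev⟩ ⟨K, c', n⟩
    (by simp only []; omega)
  simp only [] at ha
  rw [piKernel, ha, piKernel, Fin.rev_rev, Fin.rev_rev, add_comm K J, Finset.sum_congr rfl fun C _ => key C,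
    ← Finset.mul_sum]
  have hs := dualCoeff_ne_zero hq₀ J s
  have hb := dualCoeff_ne_zero hq₀ J b
  field_simp

/-- The `*`-structure: `π_α(u_J^a_b)` is adjoint to a multiple of `π_α(u_J^{-a}_{-b})`. -/
theorem piCoeff_adjoint (α : Label) (J K : ℕ) (h : HasSpin α K) (a b : Fin (J + 1))
    (c' c : Fin (K + 1)) :
    piCoeff q α ⟨J, a, b⟩ K K c' c = ((dualCoeff q J a / dualCoeff q J b : ℝ) : ℂ) *
      (starRingEnd ℂ) (piCoeff q α ⟨J, a.rev, b.rev⟩ K K c c') := by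
  obtain ⟨n, hn⟩ := exists_weight h
  rw [piCoeff_eq_sum_phase hq₀ hq₁ α J K _ _ _ _ n hn,
    piCoeff_eq_sum_phase hq₀ hq₁ α J K _ _ _ _ n hn, map_sum, Finset.mul_sum,
    ← Equiv.sum_comp Fin.revPerm]
  refine Finset.sum_congr rfl fun s _ => ?_
  rw [map_mul, conj_phase hq₀, Complex.conj_ofReal, Fin.revPerm_apply, wt_rev,
    piKernel_adjoint hq₀ hq₁, Fin.rev_rev]
  push_cast
  ring

/-- The flip signs of the two coefficients cancel, and for equal outer spins `K` the factor `Lam` is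
the same on both sides. -/
theorem piCoeff_rev (α : Label) (J K : ℕ) (a b : Fin (J + 1)) (c' c : Fin (K + 1)) :
    piCoeff q α ⟨J, a.rev, b.rev⟩ K K c c' = piCoeff q α ⟨J, b, a⟩ K K c'.rev c.rev := by
  simp only [piCoeff]
  refine Finset.sum_congr rfl fun M _ => ?_
  rw [← Equiv.sum_comp Fin.revPerm]
  refine Finset.sum_congr rfl fun m _ => ?_
  have := cg_flip_mul' hq₀ hq₁ K J M c a.rev m.rev m.rev b.rev c'
  simp only [Fin.rev_rev] at this
  rw [Fin.revPerm_apply, this, mul_comm (cg q J K M a c.rev m)]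

theorem piCoeff_conj (α : Label) (J K : ℕ) (h : HasSpin α K) (a b : Fin (J + 1))
    (c' c : Fin (K + 1)) :
    piCoeff q α ⟨J, a, b⟩ K K c' c = ((dualCoeff q J a / dualCoeff q J b : ℝ) : ℂ) *
      (starRingEnd ℂ) (piCoeff q α ⟨J, b, a⟩ K K c'.rev c.rev) := by
  rw [piCoeff_adjoint hq₀ hq₁ α J K h, piCoeff_rev hq₀ hq₁]

theorem piCoeff_val {α : Label} {B : MatIdx} {N L : ℕ} {c' : Fin (N + 1)} {c : Fin (L + 1)}
    (h : piCoeff q α B N L c' c ≠ 0) :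
    2 * ((c' : ℤ) + B.2.1) - N = 2 * ((B.2.2 : ℤ) + c) - L := by
  obtain ⟨M, -, hM⟩ := Finset.exists_ne_zero_of_sum_ne_zero h
  obtain ⟨m, -, hm⟩ := Finset.exists_ne_zero_of_sum_ne_zero hM
  have h1 := left_ne_zero_of_mul hm
  rw [Complex.ofReal_ne_zero] at h1
  have h2 := cg_val hq₀ hq₁ (left_ne_zero_of_mul h1)
  have h3 := cg_val hq₀ hq₁ (right_ne_zero_of_mul h1)
  omega

/-! ### The unit of `F_q(SU(2))` -/

/-- `V_0` is trivial, so `V_K ⊗ V_0 ≅ V_K`; Schur's lemma and the norm leave only a sign. -/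
theorem exists_cg_zero (K : ℕ) : ∃ r : ℝ, r * r = 1 ∧
    ∀ c m, cg q K 0 K c 0 m = if c = m then r else 0 := by
  have hh := isHom_cgMat hq₀ hq₁ K 0 K
  have hz : ∀ z z', (spin q 0).low z z' = 0 := fun z z' => by
    simp [spin, Jminus]
  have hw : (spin q 0).wt 0 = 0 := by simp [spin]
  have hT : IsHom (spin q K) (spin q K) (Matrix.of fun c m => cg q K 0 K c 0 m) := by
    refine ⟨fun c m h => ?_, ?_, ?_⟩
    · have := hh.wt (c, 0) m h
      rw [QModule.tensor_wt, hw, add_zero] at this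
      exact this
    · ext c m
      have := congrFun (congrFun hh.low (c, 0)) m
      rw [tensor_low_mul_apply] at this
      simp only [hz, hw, zero_mul, Finset.sum_const_zero, mul_zero, zero_add, Int.cast_zero,
        zero_div, Real.rpow_zero, one_mul] at this
      simpa [Matrix.mul_apply, cgMat] using this
    · ext c m
      have := congrFun (congrFun hh.up (c, 0)) m
      rw [tensor_lowT_mul_apply] at this
      simp only [hz, hw, zero_mul, Finset.sum_const_zero, mul_zero, zero_add, Int.cast_zero,
        zero_div, Real.rpow_zero, one_mul] at this
      simpa [Matrix.mul_apply, cgMat] using this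
  have hr := hT.eq_smul_one hq₀ hq₁
  set r := cg q K 0 K (Fin.last K) 0 (Fin.last K) with hrdef
  have h1 : ∀ c m, cg q K 0 K c 0 m = if c = m then r else 0 := fun c m => by
    have := congrFun (congrFun hr c) m
    simpa [Matrix.one_apply] using this
  refine ⟨r, ?_, h1⟩
  have h2 := sum_cg_mul_self hq₀ hq₁ (a := K) (b := 0) (c := K)
    ⟨by simp, by omega, by omega, by omega⟩ (Fin.last K) (Fin.last K)
  simpa [h1] using h2

/-- `u_0` is the unit. The signs in the Clebsch-Gordan coefficients recur in `Lam` and cancel. -/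
theorem piCoeff_one {α : Label} {K : ℕ} (h : HasSpin α K) (c' c : Fin (K + 1)) :
    piCoeff q α ⟨0, 0, 0⟩ K K c' c = if c' = c then 1 else 0 := by
  obtain ⟨n, hn⟩ := exists_weight h
  obtain ⟨r, hr, h1⟩ := exists_cg_zero hq₀ hq₁ K
  obtain ⟨σ, hσ, h2⟩ := exists_cg_flip hq₀ hq₁ 0 K K
  have h3 : ∀ c m, cg q 0 K K 0 c m = if c = m then σ * r else 0 := fun c m => by
    rw [h2, show (0 : Fin (0 + 1)).rev = 0 from rfl, h1]
    simp [Fin.rev_inj]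
  have hL : Lam q α 0 K K K = ((σ : ℝ) : ℂ) := by
    have hK := qnum_succ_ne_zero hq₀ hq₁ K
    have hw : wt 0 0 = 0 := by simp [wt]
    rw [Lam, Real.sqrt_mul_self (qnum_nonneg hq₀ hq₁ (by positivity)), div_self hK]
    rw [Fin.sum_univ_one, hw]
    simp only [Complex.ofReal_zero, mul_zero, Complex.cpow_zero, one_mul, Complex.ofReal_one]
    rw [Finset.sum_eq_single n, Finset.sum_eq_single n, Finset.sum_eq_single n, if_pos ⟨hn, hn⟩]
    · rw [h1, h3, if_pos rfl, if_pos rfl]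
      congr 1
      linear_combination σ * hr
    · intro k _ hk
      rw [if_pos ⟨hn, hn⟩, h1, if_neg hk.symm]; simp
    · simp
    · intro l _ hl
      exact Finset.sum_eq_zero fun k _ => if_neg fun h' => hl (weight_unique hn h'.2)
    · simp
    · intro i _ hi
      exact Finset.sum_eq_zero fun l _ => Finset.sum_eq_zero fun k _ =>
        if_neg fun h' => hi (weight_unique hn h'.1)
    · simp
  simp only [piCoeff]
  rw [Finset.sum_eq_single K]
  · rw [hL, Finset.sum_eq_single c]
    · rw [h1, h3, if_pos rfl]
      split_ifs
      · rw [← Complex.ofReal_mul]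
        norm_cast
        linear_combination (r * r) * hσ + hr
      · simp
    · intro m _ hm
      rw [h3, if_neg hm.symm]; simp
    · simp
  · intro M _ hM
    refine Finset.sum_eq_zero fun m _ => ?_
    rw [Lam_eq_zero_of_right, mul_zero]
    intro h'
    have := h'.2.1
    have := h'.2.2.2
    omega
  · intro h'
    exact absurd (Finset.mem_range.2 (by omega)) h'

end

end

end QLorentz

namespace QLorentz

noncomputable section

set_option linter.unusedSectionVars false

/-! ### Positivity of the intertwiner -/

/-- The vector `C^{ab}_J(e^J_k)` of `V_a ⊗ V_b ⊂ V_α ⊗ V_β`. -/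
def cgBasisVec (q : ℝ) {α β : Label} {a b : ℕ} (hα : HasSpin α a) (hβ : HasSpin β b) (J : ℕ)
    (k : Fin (J + 1)) : VRep α ⊗[ℂ] VRep β :=
  ∑ i : Fin (a + 1) × Fin (b + 1),
    (cg q a b J i.1 i.2 k : ℂ) • (basisVec α ⟨⟨a, hα⟩, i.1⟩ ⊗ₜ[ℂ] basisVec β ⟨⟨b, hβ⟩, i.2⟩)

/-- The matrix element between `e^J_k` and `e^J_l` of `π_α ⊗ π_β (Δ(u))`, compressed to the
component `V_J` of `V_a ⊗ V_b`. -/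
def cgCompress (q : ℝ) (α β : Label) (a b J : ℕ) (B : MatIdx) (l k : Fin (J + 1)) : ℂ :=
  ∑ j : Fin (a + 1) × Fin (b + 1), ∑ i : Fin (a + 1) × Fin (b + 1), ∑ p : Fin (B.1 + 1),
    ((cg q a b J j.1 j.2 l * cg q a b J i.1 i.2 k : ℝ) : ℂ) *
      (piCoeff q α ⟨B.1, p, B.2.2⟩ a a j.1 i.1 * piCoeff q β ⟨B.1, B.2.1, p⟩ b b j.2 i.2)

theorem cgProj_piU₂_cgBasisVec (q : ℝ) {α β : Label} {a b : ℕ} (hα : HasSpin α a)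
    (hβ : HasSpin β b) (J : ℕ) (B : MatIdx) (l k : Fin (J + 1)) :
    cgProj q a b J (TensorProduct.map (proj α a) (proj β b)
      (piU₂ q α β B (cgBasisVec q hα hβ J k))) l = cgCompress q α β a b J B l k := by
  simp only [cgBasisVec, piU₂, map_sum, map_smul, LinearMap.sum_apply, TensorProduct.map_tmul,
    proj_piU, Finset.sum_apply, Pi.smul_apply, smul_eq_mul, cgProj_apply, cgCompress]
  rw [Finset.sum_comm (s := (Finset.univ : Finset (Fin (a + 1) × Fin (b + 1))))]
  refine Finset.sum_congr rfl fun i _ => ?_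
  rw [Finset.sum_comm (s := (Finset.univ : Finset (Fin (a + 1) × Fin (b + 1))))]
  rw [Finset.mul_sum]
  refine Finset.sum_congr rfl fun p _ => ?_
  rw [Fintype.sum_prod_type, Finset.mul_sum]
  refine Finset.sum_congr rfl fun j _ => ?_
  rw [Finset.mul_sum]
  refine Finset.sum_congr rfl fun j' _ => ?_
  push_cast
  ring

/-- The vector of `V_α ⊗ V_β ⊗ V_β ⊗ V_α` dual to `λ_{[K],J}`. -/
def lamVec (q : ℝ) {α β : Label} {a b : ℕ} (hα : HasSpin α a) (hβ : HasSpin β b) (J : ℕ) :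
    VFour α β β α :=
  ∑ k, ∑ k', (epsCoeff q J k k' : ℂ) • (cgBasisVec q hα hβ J k ⊗ₜ[ℂ] cgBasisVec q hβ hα J k')

theorem sum_epsCoeff_mul (q : ℝ) (J : ℕ) (k : Fin (J + 1)) (f : Fin (J + 1) → ℂ) :
    ∑ k', (epsCoeff q J k k' : ℂ) * f k' = (epsCoeff q J k k.rev : ℂ) * f k.rev := by
  rw [Finset.sum_eq_single k.rev]
  · intro k' _ hk'
    rw [epsCoeff, if_neg]
    · simp
    · intro h
      apply hk'
      ext
      rw [Fin.val_rev]; omega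
  · simp

section

variable {q : ℝ} (hq₀ : 0 < q) (hq₁ : q < 1)
include hq₀ hq₁

/-- Reflection symmetry: exchanging `α` and `β` reverses the coproduct, and by `piCoeff_conj` this
is complex conjugation. The ratios of dual coefficients telescope over the intermediate index `p`.
-/
theorem cgCompress_swap {α β : Label} {a b : ℕ} (hα : HasSpin α a) (hβ : HasSpin β b) (J L : ℕ)
    (t c : Fin (L + 1)) (l k : Fin (J + 1)) :
    cgCompress q β α b a J ⟨L, t, c⟩ l k = ((dualCoeff q L t / dualCoeff q L c : ℝ) : ℂ) *
      (starRingEnd ℂ) (cgCompress q α β a b J ⟨L, c, t⟩ l.rev k.rev) := by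
  set e : Fin (b + 1) × Fin (a + 1) ≃ Fin (a + 1) × Fin (b + 1) :=
    (Equiv.prodComm _ _).trans (Equiv.prodCongr Fin.revPerm Fin.revPerm) with he
  simp only [cgCompress, map_sum, Finset.mul_sum]
  refine Fintype.sum_equiv e _ _ fun j => Fintype.sum_equiv e _ _ fun i =>
    Finset.sum_congr rfl fun p _ => ?_
  rw [piCoeff_conj hq₀ hq₁ β L b hβ p c, piCoeff_conj hq₀ hq₁ α L a hα t p,
    cg_flip_mul hq₀ hq₁ b a J]
  have h1 : (e j).1 = j.2.rev := rfl
  have h2 : (e j).2 = j.1.rev := rfl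
  have h3 : (e i).1 = i.2.rev := rfl
  have h4 : (e i).2 = i.1.rev := rfl
  rw [h1, h2, h3, h4]
  simp only [map_mul, Complex.conj_ofReal]
  have hp := dualCoeff_ne_zero hq₀ L p
  have hc := dualCoeff_ne_zero hq₀ L c
  have hd : ((dualCoeff q L p / dualCoeff q L c : ℝ) : ℂ) *
      ((dualCoeff q L t / dualCoeff q L p : ℝ) : ℂ) =
      ((dualCoeff q L t / dualCoeff q L c : ℝ) : ℂ) := by
    rw [← Complex.ofReal_mul]
    congr 1
    field_simp
  rw [← hd]
  ring

theorem cgCompress_val {α β : Label} {a b J : ℕ} {B : MatIdx} {l k : Fin (J + 1)}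
    (h : cgCompress q α β a b J B l k ≠ 0) : (l : ℕ) + B.2.1 = (B.2.2 : ℕ) + k := by
  obtain ⟨j, -, h⟩ := Finset.exists_ne_zero_of_sum_ne_zero h
  obtain ⟨i, -, h⟩ := Finset.exists_ne_zero_of_sum_ne_zero h
  obtain ⟨p, -, h⟩ := Finset.exists_ne_zero_of_sum_ne_zero h
  have h1 := left_ne_zero_of_mul h
  rw [Complex.ofReal_ne_zero] at h1
  have h2 := cg_val hq₀ hq₁ (left_ne_zero_of_mul h1)
  have h3 := cg_val hq₀ hq₁ (right_ne_zero_of_mul h1)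
  have h4 := piCoeff_val hq₀ hq₁ (left_ne_zero_of_mul (right_ne_zero_of_mul h))
  have h5 := piCoeff_val hq₀ hq₁ (right_ne_zero_of_mul (right_ne_zero_of_mul h))
  simp only [] at h4 h5
  omega

theorem cgCompress_one {α β : Label} {a b J : ℕ} (hα : HasSpin α a) (hβ : HasSpin β b)
    (h : Admissible a b J) (l k : Fin (J + 1)) :
    cgCompress q α β a b J ⟨0, 0, 0⟩ l k = if l = k then 1 else 0 := by
  simp only [cgCompress]
  have h1 : ∀ j i : Fin (a + 1) × Fin (b + 1), ∑ p : Fin (0 + 1),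
      ((cg q a b J j.1 j.2 l * cg q a b J i.1 i.2 k : ℝ) : ℂ) *
        (piCoeff q α ⟨0, p, 0⟩ a a j.1 i.1 * piCoeff q β ⟨0, 0, p⟩ b b j.2 i.2) =
      if j = i then ((cg q a b J j.1 j.2 l * cg q a b J i.1 i.2 k : ℝ) : ℂ) else 0 := by
    intro j i
    rw [Fin.sum_univ_one, piCoeff_one hq₀ hq₁ hα, piCoeff_one hq₀ hq₁ hβ]
    by_cases e1 : j.1 = i.1 <;> by_cases e2 : j.2 = i.2 <;> simp [e1, e2, Prod.ext_iff]
  simp only [h1, Finset.sum_ite_eq, Finset.mem_univ, if_true]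
  rw [← Complex.ofReal_sum, Fintype.sum_prod_type, sum_cg_mul_self hq₀ hq₁ h]
  split_ifs <;> simp

/-- The order `α, β, β, α` makes the second half of the coproduct the conjugate of the first, so
each summand is a squared modulus times a real factor, whose sign is shown to be positive. -/
theorem lamProj_piU₄_lamVec {α β : Label} {a b : ℕ} (hα : HasSpin α a) (hβ : HasSpin β b)
    (J L : ℕ) (t : Fin (L + 1)) :
    lamProj q α β β α a b b a J (piU₄ q α β β α ⟨L, t, t⟩ (lamVec q hα hβ J)) =
      ((∑ c, ∑ k, ∑ l, |epsCoeff q J k k.rev| * |epsCoeff q J l l.rev| *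
        |dualCoeff q L t / dualCoeff q L c| * ‖cgCompress q α β a b J ⟨L, c, t⟩ l k‖ ^ 2 : ℝ) : ℂ) := by
  have h1 : lamProj q α β β α a b b a J (piU₄ q α β β α ⟨L, t, t⟩ (lamVec q hα hβ J)) =
      ∑ c, ∑ k, ∑ k', (epsCoeff q J k k' : ℂ) * ∑ l, ∑ l', (epsCoeff q J l l' : ℂ) *
        (cgCompress q α β a b J ⟨L, c, t⟩ l k * cgCompress q β α b a J ⟨L, t, c⟩ l' k') := by
    rw [piU₄_eq, LinearMap.sum_apply, map_sum]
    refine Finset.sum_congr rfl fun c _ => ?_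
    simp only [lamVec, map_sum, map_smul, TensorProduct.map_tmul, lamProj_eq,
      LinearMap.comp_apply, contractLeft_apply, epsMap_apply, cgProj_piU₂_cgBasisVec, smul_eq_mul]
  rw [h1]
  push_cast
  refine Finset.sum_congr rfl fun c _ => Finset.sum_congr rfl fun k _ => ?_
  rw [sum_epsCoeff_mul, Finset.mul_sum]
  refine Finset.sum_congr rfl fun l _ => ?_
  rw [sum_epsCoeff_mul, cgCompress_swap hq₀ hq₁ hα hβ, Fin.rev_rev, Fin.rev_rev]
  set D := cgCompress q α β a b J ⟨L, c, t⟩ l k with hD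
  have hDD : D * (starRingEnd ℂ) D = (‖D‖ : ℂ) ^ 2 := Complex.mul_conj' D
  by_cases h0 : D = 0
  · simp [h0]
  · have hv := cgCompress_val hq₀ hq₁ h0
    simp only [] at hv
    -- The total sign is `(-1)^{k+l+t+c}`, and weight conservation `l + c = t + k` makes the
    -- exponent even.
    have hs : epsCoeff q J k k.rev * epsCoeff q J l l.rev * (dualCoeff q L t / dualCoeff q L c) =
        |epsCoeff q J k k.rev| * |epsCoeff q J l l.rev| * |dualCoeff q L t / dualCoeff q L c| := by
      rw [← abs_mul, ← abs_mul, abs_of_nonneg]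
      have e1 : ∀ k : Fin (J + 1), epsCoeff q J k k.rev =
          (-1) ^ (k : ℕ) * (q ^ ((J : ℝ) / 2 * ((J : ℝ) / 2 + 1)) * q ^ wt J k) := fun k => by
        rw [epsCoeff, if_pos]
        have := k.2
        rw [Fin.val_rev]; omega
      have e2 : dualCoeff q L t / dualCoeff q L c =
          (-1) ^ ((t : ℕ) + c) * (q ^ (-wt L t) / q ^ (-wt L c)) := by
        have h1 : ((-1 : ℝ)) ^ (c : ℕ) * (-1) ^ (c : ℕ) = 1 := by rw [← mul_pow]; simp
        have h2 : ((-1 : ℝ)) ^ (c : ℕ) ≠ 0 := pow_ne_zero _ (by norm_num)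
        have h3 := (Real.rpow_pos_of_pos hq₀ (-wt L c)).ne'
        rw [dualCoeff, dualCoeff, pow_add]
        field_simp
        linear_combination -h1
      have e3 : ((-1 : ℝ)) ^ (k : ℕ) * (-1) ^ (l : ℕ) * (-1) ^ ((t : ℕ) + c) = 1 := by
        rw [← pow_add, ← pow_add, Even.neg_one_pow]
        exact ⟨t + k, by omega⟩
      rw [e1, e1, e2]
      have e4 : (-1) ^ (k : ℕ) * (q ^ ((J : ℝ) / 2 * ((J : ℝ) / 2 + 1)) * q ^ wt J k) *
          ((-1) ^ (l : ℕ) * (q ^ ((J : ℝ) / 2 * ((J : ℝ) / 2 + 1)) * q ^ wt J l)) *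
          ((-1) ^ ((t : ℕ) + c) * (q ^ (-wt L t) / q ^ (-wt L c))) =
          ((-1) ^ (k : ℕ) * (-1) ^ (l : ℕ) * (-1) ^ ((t : ℕ) + c)) *
          ((q ^ ((J : ℝ) / 2 * ((J : ℝ) / 2 + 1)) * q ^ wt J k) *
          (q ^ ((J : ℝ) / 2 * ((J : ℝ) / 2 + 1)) * q ^ wt J l) *
          (q ^ (-wt L t) / q ^ (-wt L c))) := by ring
      rw [e4, e3]
      positivity
    have hs' := congrArg (fun x : ℝ => (x : ℂ)) hs
    simp only [Complex.ofReal_mul] at hs'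
    rw [← hDD, ← hs']
    ring

theorem haar_nonneg (A : MatIdx × MatIdx) : 0 ≤ haar q A := by
  rw [haar]
  have := qnum_nonneg hq₀ hq₁ (x := (A.2.1 : ℝ) + 1) (by positivity)
  split_ifs <;> positivity

/-- The intertwiner does not vanish on the vector dual to `λ_{[K],J}`. -/
theorem iota_lamVec_ne_zero {α β : Label} {a b J : ℕ} (hα : HasSpin α a) (hβ : HasSpin β b)
    (h : Admissible a b J) : iota q α β β α a b b a J (lamVec q hα hβ J) ≠ 0 := by
  have hex : ∀ A, ∃ r : ℝ, 0 ≤ r ∧ iotaTerm q α β β α a b b a J (lamVec q hα hβ J) A = r := by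
    rintro ⟨A, ⟨L, t, t'⟩⟩
    rw [iotaTerm_eq hq₀ hq₁]
    by_cases ht : t = t'
    · subst ht
      rw [lamProj_piU₄_lamVec hq₀ hq₁, ← Complex.ofReal_mul]
      exact ⟨_, mul_nonneg (by positivity) (haar_nonneg hq₀ hq₁ _), rfl⟩
    · exact ⟨0, le_rfl, by simp [haar, ht]⟩
  choose r hr0 hr using hex
  -- The summand of the unit is strictly positive: there the compressed operator is the identity of
  -- `V_J`.
  have hpos : 0 < r (⟨0, 0, 0⟩, ⟨0, 0, 0⟩) := by
    have h1 := hr (⟨0, 0, 0⟩, ⟨0, 0, 0⟩)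
    rw [iotaTerm_eq hq₀ hq₁, lamProj_piU₄_lamVec hq₀ hq₁, ← Complex.ofReal_mul,
      Complex.ofReal_inj] at h1
    rw [← h1]
    refine mul_pos ?_ ?_
    · refine Finset.sum_pos' (fun c _ => by positivity) ⟨0, Finset.mem_univ _, ?_⟩
      refine Finset.sum_pos' (fun c _ => by positivity) ⟨0, Finset.mem_univ _, ?_⟩
      refine Finset.sum_pos' (fun c _ => by positivity) ⟨0, Finset.mem_univ _, ?_⟩
      rw [cgCompress_one hq₀ hq₁ hα hβ h, if_pos rfl]
      have h2 : epsCoeff q J 0 (Fin.rev 0) ≠ 0 := by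
        rw [epsCoeff, if_pos (by simp)]
        have := Real.rpow_pos_of_pos hq₀
        exact mul_ne_zero (by simp) (mul_ne_zero (this _).ne' (this _).ne')
      have h3 := dualCoeff_ne_zero hq₀ 0 0
      have := abs_pos.2 h2
      have := abs_pos.2 (div_ne_zero h3 h3)
      simp only [norm_one]
      positivity
    · rw [haar, if_pos ⟨rfl, rfl⟩]
      have := qnum_pos hq₀ hq₁ (x := ((0 : ℕ) : ℝ) + 1) (by positivity)
      positivity
  have hsum : Summable r := by
    refine (iotaConverges hq₀ hq₁ α β β α a b b a J (lamVec q hα hβ J)).congr fun A => ?_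
    rw [hr, Complex.norm_real, Real.norm_of_nonneg (hr0 A)]
  rw [iota]
  simp only [hr]
  rw [← Complex.ofReal_tsum]
  exact Complex.ofReal_ne_zero.2 (hsum.tsum_pos hr0 _ hpos).ne'

end

end

end QLorentz

namespace QLorentz

noncomputable section

set_option linter.unusedSectionVars false

/-! ### The coefficient of the braiding on the lowest component -/

theorem hasSpin_eprl (γ : ℝ) (K : ℕ) : HasSpin (eprl γ K) K := ⟨0, by simp [eprl]⟩

theorem cg_last {q : ℝ} {a b c : ℕ} (h : Admissible a b c) (i : Fin (a + 1)) (j : Fin (b + 1)) :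
    cg q a b c i j (Fin.last c) =
      (Real.sqrt (∑ x, hwVec q a b c x ^ 2))⁻¹ * hwVec q a b c (i, j) := by
  rw [cg, if_pos h, Fin.val_last, Nat.sub_self]
  rfl

theorem admissible_succ_one (D : ℕ) : Admissible (D + 1) 1 D :=
  ⟨⟨D + 1, by ring⟩, by omega, by omega, by omega⟩

theorem admissible_one_succ (D : ℕ) : Admissible 1 (D + 1) D :=
  admissible_swap (admissible_succ_one D)

section

variable {q : ℝ} (hq₀ : 0 < q) (hq₁ : q < 1)
include hq₀ hq₁

/-- The product defining `hwVec` is empty in the first coefficient and has one negative factor in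
the second, so only the sign convention matters. -/
theorem cg_top_mul_nonpos (D : ℕ) :
    cg q (D + 1) 1 D (Fin.last _) 0 (Fin.last _) * cg q 1 (D + 1) D 0 (Fin.last _) (Fin.last _) ≤
      0 := by
  rw [cg_last (admissible_succ_one D), cg_last (admissible_one_succ D)]
  refine mul_nonpos_of_nonneg_of_nonpos (mul_nonneg (by positivity) ?_)
    (mul_nonpos_of_nonneg_of_nonpos (by positivity) ?_)
  · simp only [hwVec]
    split_ifs
    · simp
    · exact le_rfl
  · simp only [hwVec]
    split_ifs
    · simp only [Fin.val_zero, Nat.sub_zero, Finset.prod_range_one]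
      rw [neg_mul]
      exact neg_nonpos.2 (mul_nonneg (Real.rpow_pos_of_pos hq₀ _).le (Real.sqrt_nonneg _))
    · exact le_rfl

/-- The fixed weight `n = (D+1)/2` is the top of `V_{(D+1)/2}` and exceeds the spin `D/2` of the
channel, so `n + s` is a weight of that channel only for `s = -1/2`. -/
theorem exists_Lam_top {α : Label} {D : ℕ} (hα : α.twoN = (D : ℤ) + 1) :
    ∃ r : ℝ, r ≤ 0 ∧ Lam q α 1 D (D + 1) (D + 1) = r * phase q α.p (-1 / 2) := by
  refine ⟨Real.sqrt (qnum q (((D + 1 : ℕ) : ℝ) + 1) * qnum q (((D + 1 : ℕ) : ℝ) + 1)) /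
    qnum q ((D : ℝ) + 1) * (cg q (D + 1) 1 D (Fin.last _) 0 (Fin.last _) *
      cg q 1 (D + 1) D 0 (Fin.last _) (Fin.last _)),
    mul_nonpos_of_nonneg_of_nonpos (div_nonneg (Real.sqrt_nonneg _)
      (qnum_nonneg hq₀ hq₁ (by positivity))) (cg_top_mul_nonpos hq₀ hq₁ D), ?_⟩
  have hn : 2 * (((Fin.last (D + 1) : Fin (D + 1 + 1)) : ℕ) : ℤ) - ((D + 1 : ℕ) : ℤ) = α.twoN := by
    rw [hα, Fin.val_last]; push_cast; ring
  have hw : wt 1 0 = -1 / 2 := by simp [wt]; norm_num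
  rw [Lam, Finset.sum_eq_single 0, Finset.sum_eq_single (Fin.last _),
    Finset.sum_eq_single (Fin.last _), Finset.sum_eq_single (Fin.last _), if_pos ⟨hn, hn⟩, hw, phase]
  · push_cast; ring
  · intro k _ hk
    rw [if_pos ⟨hn, hn⟩]
    by_contra h
    rw [← ne_eq, Complex.ofReal_ne_zero] at h
    have := cg_val hq₀ hq₁ (left_ne_zero_of_mul h)
    apply hk
    ext
    simp only [Fin.val_last, Fin.val_zero] at this ⊢
    push_cast at this
    omega
  · simp
  · intro l _ hl
    exact Finset.sum_eq_zero fun k _ => if_neg fun h' => hl (weight_unique hn h'.2)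
  · simp
  · intro i _ hi
    exact Finset.sum_eq_zero fun l _ => Finset.sum_eq_zero fun k _ =>
      if_neg fun h' => hi (weight_unique hn h'.1)
  · simp
  · intro s _ hs
    have hs1 : (s : ℕ) = 1 := by
      have := s.2
      have : (s : ℕ) ≠ 0 := fun h => hs (Fin.ext h)
      omega
    rw [Finset.sum_eq_zero, mul_zero]
    refine fun i _ => Finset.sum_eq_zero fun l _ => Finset.sum_eq_zero fun k _ => ?_
    split_ifs with h
    · by_contra h'
      rw [← ne_eq, Complex.ofReal_ne_zero] at h'
      have := cg_val hq₀ hq₁ (left_ne_zero_of_mul h')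
      have hk := k.2
      have hi := h.1
      rw [hα] at hi
      push_cast at this hi
      omega
    · rfl
  · simp

theorem Lam_top_ne_one {α : Label} {D : ℕ} (hα : α.twoN = (D : ℤ) + 1)
    (hp : phase q α.p (-1 / 2) ≠ -1) : Lam q α 1 D (D + 1) (D + 1) ≠ 1 := by
  obtain ⟨r, hr, h⟩ := exists_Lam_top hq₀ hq₁ hα
  rw [h]
  intro h1
  have h2 := congrArg norm h1
  rw [norm_mul, norm_phase hq₀, Complex.norm_real, Real.norm_eq_abs, abs_of_nonpos hr, mul_one,
    norm_one] at h2
  have h3 : r = -1 := by linarith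
  rw [h3] at h1
  push_cast at h1
  exact hp (by linear_combination -h1)

/-- Non-invariance under the braiding, for the spins `(D+1)/2, 1/2, (D+1)/2, 1/2`. -/
theorem iota_braid₁₂_ne (γ : ℝ) (D : ℕ) (hp : phase q (eprl γ (D + 1)).p (-1 / 2) ≠ -1) :
    ∃ v, iota q (eprl γ (D + 1)) (eprl γ 1) (eprl γ (D + 1)) (eprl γ 1) (D + 1) 1 (D + 1) 1 D
        (braid₁₂ q (eprl γ 1) (eprl γ (D + 1)) (eprl γ (D + 1)) (eprl γ 1) v) ≠
      iota q (eprl γ 1) (eprl γ (D + 1)) (eprl γ (D + 1)) (eprl γ 1) 1 (D + 1) (D + 1) 1 D v := by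
  refine ⟨lamVec q (hasSpin_eprl γ 1) (hasSpin_eprl γ (D + 1)) D, ?_⟩
  have hne := iota_lamVec_ne_zero hq₀ hq₁ (hasSpin_eprl γ 1) (hasSpin_eprl γ (D + 1))
    (admissible_one_succ D)
  -- The fusion rule for `1, K, D` gives `K ≤ D + 1`, while every component of the representation
  -- has `K ≥ D + 1`.
  rw [iota_braid₁₂ hq₀ hq₁, finsum_eq_single _ (D + 1)]
  · intro h
    have hL := Lam_top_ne_one hq₀ hq₁ (α := eprl γ (D + 1)) (D := D) (by simp [eprl]) hp
    exact hL (mul_right_cancel₀ hne (h.trans (one_mul _).symm))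
  · intro K hK
    by_cases hs : HasSpin (eprl γ (D + 1)) K
    · rw [Lam_eq_zero_of_right, zero_mul]
      intro h
      have h1 := h.2.2.2
      obtain ⟨k, hk⟩ := hs
      simp only [eprl, Int.natAbs_natCast] at hk
      omega
    · rw [Lam_eq_zero_of_not_hasSpin_right q hs, zero_mul]

/-! ### The Barrett-Crane coefficient and the choice of the EPRL spins. -/

theorem Lam_zero (α : Label) (hα : α.twoN = 0) : Lam q α 0 0 0 0 = 1 := by
  have h := sum_cg_mul_self hq₀ hq₁ (a := 0) (b := 0) (c := 0)
    ⟨by simp, by omega, by omega, by omega⟩ 0 0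
  have e : ∀ {E : Type} [AddCommMonoid E] (f : Fin (0 + 1) → E), ∑ i, f i = f 0 :=
    fun f => Fin.sum_univ_one f
  simp only [e, if_true] at h
  have hw : wt 0 0 = 0 := by simp [wt]
  rw [Lam, Real.sqrt_mul_self (qnum_nonneg hq₀ hq₁ (by positivity)),
    div_self (qnum_succ_ne_zero hq₀ hq₁ 0)]
  simp only [e]
  rw [hw, h]
  simp [hα]

theorem phase_eq (p x : ℝ) :
    phase q p x = Complex.exp (((-(kappa q * p * x) : ℝ) : ℂ) * Complex.I) := by
  rw [phase, Complex.cpow_def_of_ne_zero (by exact_mod_cast hq₀.ne'), ← Complex.ofReal_log hq₀.le,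
    kappa]
  congr 1
  push_cast; ring

/-- The phase is `exp(iγκ(D+1)/4)`. If the label set is non-empty it contains spin `1/2`, so `γκ ≤
8π`, and for `D = 0` the phase is `-1` only at `γκ = 4π`. -/
theorem exists_noninvariant {γ : ℝ} (hγ : 0 < γ) (hne : (eprlSpins q γ).Nonempty) :
    ∃ D : ℕ, 1 ∈ eprlSpins q γ ∧ D + 1 ∈ eprlSpins q γ ∧
      phase q (eprl γ (D + 1)).p (-1 / 2) ≠ -1 := by
  have hκ : 0 < kappa q := neg_pos.2 (Real.log_neg hq₀ hq₁)
  have hpi := Real.pi_pos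
  have h1 : 1 ∈ eprlSpins q γ := by
    obtain ⟨K, hK0, hK⟩ := hne
    refine ⟨one_pos, le_trans ?_ hK⟩
    have : (1 : ℝ) ≤ K := by exact_mod_cast hK0
    push_cast
    linarith
  have h1' : γ * kappa q ≤ 8 * Real.pi := by
    have := h1.2
    rw [le_div_iff₀ (by positivity)] at this
    push_cast at this
    linarith
  by_cases hc : γ * kappa q = 4 * Real.pi
  -- In the exceptional case spin `1` lies exactly on the bound `4π/(γκ) = 1`, and the phase for `D
  -- = 1` is `exp(2πi) = 1`.
  · refine ⟨1, h1, ⟨by norm_num, ?_⟩, ?_⟩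
    · rw [hc, div_self (by positivity)]; norm_num
    · have e : -(kappa q * (eprl γ (1 + 1)).p * (-1 / 2)) = 2 * Real.pi := by
        simp only [eprl]; push_cast; linear_combination hc / 2
      rw [phase_eq hq₀ hq₁, e]
      push_cast
      rw [Complex.exp_two_pi_mul_I]
      norm_num
  · refine ⟨0, h1, h1, fun h => hc ?_⟩
    have e : -(kappa q * (eprl γ (0 + 1)).p * (-1 / 2)) = γ * kappa q / 4 := by
      simp only [eprl]; push_cast; ring
    rw [phase_eq hq₀ hq₁, e] at h
    have h2 := congrArg Complex.re h
    rw [Complex.exp_ofReal_mul_I_re, Complex.neg_re, Complex.one_re, Real.cos_eq_neg_one_iff] at h2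
    obtain ⟨k, hk⟩ := h2
    have hx : 0 < γ * kappa q := by positivity
    have hk0 : k = 0 := by
      have hlo : (-1 : ℝ) < k := by
        by_contra hcon
        have : (k : ℝ) ≤ -1 := not_lt.1 hcon
        nlinarith
      have hhi : (k : ℝ) < 1 := by
        by_contra hcon
        have : (1 : ℝ) ≤ k := not_lt.1 hcon
        nlinarith
      have hlo' : -1 < k := by exact_mod_cast hlo
      have hhi' : k < 1 := by exact_mod_cast hhi
      omega
    rw [hk0] at hk
    push_cast at hk
    linarith

end

end

end QLorentz

/-! ### Assembly of the three statements. -/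

theorem mainTheorem3 (q : ℝ) (hq₀ : 0 < q) (hq₁ : q < 1) (γ : ℝ) (hγ : 0 < γ) :
    -- transformation of the `q`-EPRL intertwiner under the braiding
    (∀ K₁ ∈ eprlSpins q γ, ∀ K₂ ∈ eprlSpins q γ, ∀ K₃ ∈ eprlSpins q γ, ∀ K₄ ∈ eprlSpins q γ,
      ∀ J : ℕ,
        IotaConverges q (eprl γ K₁) (eprl γ K₂) (eprl γ K₃) (eprl γ K₄) K₁ K₂ K₃ K₄ J ∧
        (∀ K : ℕ, HasSpin (eprl γ K₁) K →
          IotaConverges q (eprl γ K₂) (eprl γ K₁) (eprl γ K₃) (eprl γ K₄) K₂ K K₃ K₄ J) ∧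
        {K : ℕ | Lam q (eprl γ K₁) K₂ J K₁ K ≠ 0}.Finite ∧
        ∀ v : VFour (eprl γ K₂) (eprl γ K₁) (eprl γ K₃) (eprl γ K₄),
          iota q (eprl γ K₁) (eprl γ K₂) (eprl γ K₃) (eprl γ K₄) K₁ K₂ K₃ K₄ J
              (braid₁₂ q (eprl γ K₂) (eprl γ K₁) (eprl γ K₃) (eprl γ K₄) v) =
            ∑ᶠ K : ℕ, Lam q (eprl γ K₁) K₂ J K₁ K *
              iota q (eprl γ K₂) (eprl γ K₁) (eprl γ K₃) (eprl γ K₄) K₂ K K₃ K₄ J v) ∧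
    -- the `q`-EPRL intertwiner is not invariant under the braiding
    ((eprlSpins q γ).Nonempty →
      ∃ K₁ ∈ eprlSpins q γ, ∃ K₂ ∈ eprlSpins q γ, ∃ K₃ ∈ eprlSpins q γ, ∃ K₄ ∈ eprlSpins q γ,
        ∃ J : ℕ, ∃ v : VFour (eprl γ K₂) (eprl γ K₁) (eprl γ K₃) (eprl γ K₄),
          iota q (eprl γ K₁) (eprl γ K₂) (eprl γ K₃) (eprl γ K₄) K₁ K₂ K₃ K₄ J
              (braid₁₂ q (eprl γ K₂) (eprl γ K₁) (eprl γ K₃) (eprl γ K₄) v) ≠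
            iota q (eprl γ K₂) (eprl γ K₁) (eprl γ K₃) (eprl γ K₄) K₂ K₁ K₃ K₄ J v) ∧
    -- the quantum Barrett-Crane intertwiner is invariant under the braiding
    (∀ p₁ ∈ Set.Icc 0 (2 * Real.pi / kappa q), ∀ p₂ ∈ Set.Icc 0 (2 * Real.pi / kappa q),
      ∀ p₃ ∈ Set.Icc 0 (2 * Real.pi / kappa q), ∀ p₄ ∈ Set.Icc 0 (2 * Real.pi / kappa q),
        IotaConverges q (simpleRep p₁) (simpleRep p₂) (simpleRep p₃) (simpleRep p₄) 0 0 0 0 0 ∧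
        IotaConverges q (simpleRep p₂) (simpleRep p₁) (simpleRep p₃) (simpleRep p₄) 0 0 0 0 0 ∧
        ∀ v : VFour (simpleRep p₂) (simpleRep p₁) (simpleRep p₃) (simpleRep p₄),
          iota q (simpleRep p₁) (simpleRep p₂) (simpleRep p₃) (simpleRep p₄) 0 0 0 0 0
              (braid₁₂ q (simpleRep p₂) (simpleRep p₁) (simpleRep p₃) (simpleRep p₄) v) =
            iota q (simpleRep p₂) (simpleRep p₁) (simpleRep p₃) (simpleRep p₄) 0 0 0 0 0 v) := by
  have hconv := fun α₁ α₂ α₃ α₄ K₁ K₂ K₃ K₄ J =>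
    iotaConverges hq₀ hq₁ α₁ α₂ α₃ α₄ K₁ K₂ K₃ K₄ J
  refine ⟨fun K₁ _ K₂ _ K₃ _ K₄ _ J => ⟨hconv _ _ _ _ _ _ _ _ _,
    fun K _ => hconv _ _ _ _ _ _ _ _ _, finite_Lam_ne_zero .., iota_braid₁₂ hq₀ hq₁ _ _ _ _ _ _ _ _ _⟩,
    fun hne => ?_, fun p₁ _ p₂ _ p₃ _ p₄ _ =>
    ⟨hconv _ _ _ _ _ _ _ _ _, hconv _ _ _ _ _ _ _ _ _, fun v => ?_⟩⟩
  · obtain ⟨D, h1, hD, hp⟩ := exists_noninvariant hq₀ hq₁ hγ hne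
    exact ⟨D + 1, hD, 1, h1, D + 1, hD, 1, h1, D, iota_braid₁₂_ne hq₀ hq₁ γ D hp⟩
  · rw [iota_braid₁₂ hq₀ hq₁, finsum_eq_single _ 0, Lam_zero hq₀ hq₁ _ rfl, one_mul]
    intro K hK
    -- With `K₂ = J = 0` the triangle inequality excludes every `K > 0`.
    rw [Lam_eq_zero_of_lt q _ 0 (Nat.pos_of_ne_zero hK), zero_mul]
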